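/- Let $k$ be a field and let $\mathcal C$ be a small $k$-linear abelian monoidal category (not assumed symmetric) with unit object $I$, whose tensor product is $k$-bilinear and right exact in each variable. *The category $\Lambda$.* $\Lambda$ is Connes' cyclic category: its objects are $[n]$, $n\ge 1$ (a circle with a cyclically ordered set $V([n])$ of $n$ marked points); a morphism $f:[n]\to[n']$ is a map $V([n])\to V([n'])$ together with a total order on each fibre $f^{-1}(v)$, such that running through the ordered fibres $f^{-1}(v)$, for $v$ in the cyclic order of $V([n'])$, gives the cyclic order of $V([n])$. Each such $f$ gives a functor $f_!:\mathcal C^{n}\to\mathcal C^{n'}$, $(f_!X)_v=\bigotimes_{i\in f^{-1}(v)}X_i$ (ordered tensor product, equal to $I$ for an empty fibre). *The category $\mathcal C_\#$.* Its objects are pairs $\langle [n],X\rangle$ with $X\in\mathcal C^n$; a morphism $\langle[n],X\rangle\to\langle[n'],X'\rangle$ is a pair of a morphism $f:[n]\to[n']$ and a morphism $f_!X\to X'$ in $\mathcal C^{n'}$. It is called cocartesian if $f_!X\to X'$ is invertible. $\mathcal C^{opp}_\#$ denotes the same construction applied to the monoidal category $\mathcal C^{opp}$. *Sheaves.* $\operatorname{Shv}(\mathcal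 C^n)$ is the abelian category of functors $(\mathcal C^{opp})^n\to k\text{-Vect}$ which are $k$-linear and left exact in each variable. For $f:[n]\to[n']$, $(f_!)_!:\operatorname{Shv}(\mathcal C^n)\to\operatorname{Shv}(\mathcal C^{n'})$ is the left adjoint of the restriction functor $(f_!)^*$. $\operatorname{Shv}(\mathcal C_\#)$ is the abelian category of functors $E:\mathcal C^{opp}_\#\to k\text{-Vect}$ whose restriction $E([n])$ to each $(\mathcal C^{opp})^n$ lies in $\operatorname{Shv}(\mathcal C^n)$. Every $f:[n]\to[n']$ induces a map $E([n])\to(f_!)^*E([n'])$, equivalently a map $(f_!)_!E([n])\to E([n'])$; $E$ is called cocartesian if the latter is invertible for all $f$. $\operatorname{Shv}_{cart}(\mathcal C_\#)\subset\operatorname{Shv}(\mathcal C_\#)$ consists of the cocartesian $E$ such that $E([1])$ is representable by an object of $\mathcal C$. *Trace functors.* Let $\operatorname{tr}:\mathcal C\to k\text{-Vect}$ be a right exact $k$-linear trace functor, that is, a functor $\operatorname{tr}:\mathcal C_\#\to k\text{-Vect}$ which inverts all cocartesian morphisms and whose restriction to $\mathcal C$ (the fibre over $[1]$) is $k$-linear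 and right exact. It extends canonically to $\operatorname{Shv}(\mathcal C^n)$: $\operatorname{tr}(E)$ is the coend $\int^{X\in\mathcal C^n}E(X)\otimes_k\operatorname{tr}\langle[n],X\rangle$. By functoriality one obtains $\operatorname{tr}_\#:\operatorname{Shv}(\mathcal C_\#)\to\operatorname{Fun}(\Lambda,k)$ with $\operatorname{tr}_\#(E)([n])=\operatorname{tr}(E([n]))$. *Homological cleanness.* An object $E$ is acyclic for a right exact functor $F$ if the left derived functors $L_iF$ (a universal homological $\delta$-functor extending $F$) exist and $L_iF(E)=0$ for $i\ge1$. The pair $\langle\mathcal C,\operatorname{tr}\rangle$ is homologically clean if for every $n$, every object of $\operatorname{Shv}(\mathcal C^n)$ is a quotient of an object $E\in\operatorname{Shv}(\mathcal C^n)$ such that (i) $E$ is acyclic for $\operatorname{tr}:\operatorname{Shv}(\mathcal C^n)\to k\text{-Vect}$ and for $(f_!)_!:\operatorname{Shv}(\mathcal C^n)\to\operatorname{Shv}(\mathcal C^{n'})$, for all $f:[n]\to[n']$; and (ii) for all $f:[n]\to[n']$, $(f_!)_!E$ is acyclic for $\operatorname{tr}:\operatorname{Shv}(\mathcal C^{n'})\to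 k\text{-Vect}$. *Derived categories.* $\mathcal D(-)$ denotes the unbounded derived category. $\mathcal D\Lambda(\mathcal C)\subset\mathcal D(\operatorname{Shv}(\mathcal C_\#))$ consists of the complexes all of whose homology objects lie in $\operatorname{Shv}_{cart}(\mathcal C_\#)$, and $\mathcal D_{const}(\Lambda,k)\subset\mathcal D(\Lambda,k)=\mathcal D(\operatorname{Fun}(\Lambda,k))$ consists of the complexes all of whose homology objects are isomorphic to constant functors. **Lemma.** Assume that $\langle\mathcal C,\operatorname{tr}\rangle$ is homologically clean. Then the total left derived functors $$L^\bullet\operatorname{tr}_\#:\mathcal D(\operatorname{Shv}(\mathcal C_\#))\to\mathcal D(\Lambda,k),\qquad L^\bullet\operatorname{tr}:\mathcal D(\operatorname{Shv}(\mathcal C^n))\to\mathcal D(k\text{-Vect})\quad(n\ge1)$$ exist, and for every $[n]\in\Lambda$ there is an isomorphism, natural in $M_\#\in\operatorname{Shv}(\mathcal C_\#)$, $$L^\bullet\operatorname{tr}_\#(M_\#)([n])\;\cong\;L^\bullet\operatorname{tr}(M_\#([n])).$$ More generally there is such an isomorphism, natural in complexes $M_\#$ over $\operatorname{Shv}(\mathcal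 C_\#)$ and compatible with the canonical maps of both sides to $\operatorname{tr}_\#(M_\#)([n])=\operatorname{tr}(M_\#([n]))$. Moreover, for every $M_\#\in\mathcal D\Lambda(\mathcal C)$ one has $L^\bullet\operatorname{tr}_\#(M_\#)\in\mathcal D_{const}(\Lambda,k)$. -/

import Mathlib

open CategoryTheory MonoidalCategory Limits

universe w u

section Tens

/-- the concatenation of the lists `s j`, for `j` running through `l` -/
@[reducible] def concat {ι κ : Type} (s : κ → List ι) : List κ → List ι
  | [] => []
  | j :: l => s j ++ concat s l

theorem concat_eq_flatMap {ι κ : Type} (s : κ → List ι) : ∀ l, concat s l = l.flatMap s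
  | [] => rfl
  | j :: l => by simp [concat, concat_eq_flatMap s l]

theorem concat_append {ι κ : Type} (s : κ → List ι) (a b : List κ) :
    concat s (a ++ b) = concat s a ++ concat s b := by
  simp [concat_eq_flatMap]

theorem concat_concat {ι κ μ : Type} (s : κ → List ι) (t : μ → List κ) (l : List μ) :
    concat s (concat t l) = concat (fun j => concat s (t j)) l := by
  simp [concat_eq_flatMap, List.flatMap_assoc]

theorem concat_singleton {ι : Type} (l : List ι) : concat (fun i => [i]) l = l := by
  simp [concat_eq_flatMap]

variable {C : Type u} [Category.{u} C] [MonoidalCategory C] {ι κ μ : Type}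

/-- the tensor product `⨂ X i` over the list `l`, in the order of `l` -/
@[reducible] def tens (X : ι → C) : List ι → C
  | [] => 𝟙_ C
  | i :: l => X i ⊗ tens X l

/-- functoriality of `tens` -/
def tensMap {X Y : ι → C} (φ : ∀ i, X i ⟶ Y i) : ∀ l, tens X l ⟶ tens Y l
  | [] => 𝟙 (𝟙_ C)
  | i :: l => φ i ⊗ₘ tensMap φ l

theorem tensMap_nil {X Y : ι → C} (φ : ∀ i, X i ⟶ Y i) : tensMap φ [] = 𝟙 (𝟙_ C) := rfl
theorem tensMap_cons {X Y : ι → C} (φ : ∀ i, X i ⟶ Y i) (i : ι) (l : List ι) :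
    tensMap φ (i :: l) = φ i ⊗ₘ tensMap φ l := rfl

/-- the identification of `tens X l` and `tens X l'` for equal lists -/
def tensCast (X : ι → C) {l l' : List ι} (h : l = l') : tens X l ⟶ tens X l' :=
  eqToHom (congrArg (tens X) h)

@[simp] theorem tensMap_id (X : ι → C) : ∀ l, tensMap (fun i => 𝟙 (X i)) l = 𝟙 _
  | [] => rfl
  | i :: l => by simp [tensMap_cons, tensMap_id X l]

theorem tensMap_comp {X Y Z : ι → C} (φ : ∀ i, X i ⟶ Y i) (ψ : ∀ i, Y i ⟶ Z i) :
    ∀ l, tensMap (fun i => φ i ≫ ψ i) l = tensMap φ l ≫ tensMap ψ l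
  | [] => by simp [tensMap_nil]
  | i :: l => by simp [tensMap_cons, tensMap_comp φ ψ l]

@[simp] theorem tensCast_rfl (X : ι → C) {l : List ι} (h : l = l) : tensCast X h = 𝟙 _ := rfl

theorem tensCast_cons (X : ι → C) (i : ι) {l l' : List ι} (h : l = l') (h' : i :: l = i :: l') :
    tensCast X h' = X i ◁ tensCast X h := by
  subst h; simp

theorem tensCast_naturality {X Y : ι → C} (φ : ∀ i, X i ⟶ Y i) {l l' : List ι}
    (h : l = l') : tensCast X h ≫ tensMap φ l' = tensMap φ l ≫ tensCast Y h := by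
  subst h; simp

/-- the associativity isomorphism for a concatenation of two lists -/
def tensAppend (X : ι → C) : ∀ l l', tens X (l ++ l') ≅ tens X l ⊗ tens X l'
  | [], l' => (λ_ (tens X l')).symm
  | i :: l, l' => whiskerLeftIso (X i) (tensAppend X l l') ≪≫ (α_ _ _ _).symm

theorem tensAppend_nil (X : ι → C) (l' : List ι) :
    (tensAppend X [] l').hom = (λ_ (tens X l')).inv := rfl
theorem tensAppend_cons (X : ι → C) (i : ι) (l l' : List ι) :
    (tensAppend X (i :: l) l').hom = X i ◁ (tensAppend X l l').hom ≫ (α_ _ _ _).inv := rfl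

theorem tensAppend_naturality {X Y : ι → C} (φ : ∀ i, X i ⟶ Y i) : ∀ l l',
    (tensAppend X l l').hom ≫ (tensMap φ l ⊗ₘ tensMap φ l') =
      tensMap φ (l ++ l') ≫ (tensAppend Y l l').hom
  | [], l' => by simp [tensAppend_nil, tensMap_nil]
  | i :: l, l' => by
    have := tensAppend_naturality φ l l'
    simp only [tensAppend_cons, tensMap_cons, List.cons_append, Category.assoc]
    rw [← associator_inv_naturality, ← Category.assoc, ← Category.assoc]
    congr 1
    rw [← id_tensorHom, ← id_tensorHom, tensorHom_comp_tensorHom, tensorHom_comp_tensorHom, this]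
    simp

theorem tens_aux {P A D E F G : C} (a : A ⟶ D ⊗ E) (b : D ⟶ F ⊗ G)
    {A' GE : C} (c : A ⟶ A') (d : A' ⟶ F ⊗ GE) (e : GE ⟶ G ⊗ E)
    (h : a ≫ (b ▷ E) = c ≫ d ≫ (F ◁ e) ≫ (α_ F G E).inv) :
    (P ◁ a ≫ (α_ _ _ _).inv) ≫ ((P ◁ b ≫ (α_ _ _ _).inv) ▷ E) =
      P ◁ c ≫ (P ◁ d ≫ (α_ _ _ _).inv) ≫ ((P ⊗ F) ◁ e) ≫ (α_ _ _ _).inv := by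
  have h' : P ◁ a ≫ P ◁ (b ▷ E) = P ◁ c ≫ P ◁ d ≫ P ◁ (F ◁ e) ≫ P ◁ (α_ F G E).inv := by
    simp only [← whiskerLeft_comp, h]
  have : (P ◁ a ≫ (α_ _ _ _).inv) ≫ ((P ◁ b ≫ (α_ _ _ _).inv) ▷ E) =
     (P ◁ a ≫ P ◁ (b ▷ E)) ≫ (α_ _ _ _).inv ≫ (α_ _ _ _).inv ▷ E := by
    simp
  rw [this, h']
  simp

theorem tensAppend_assoc (X : ι → C) : ∀ l₁ l₂ l₃ (h : (l₁ ++ l₂) ++ l₃ = l₁ ++ (l₂ ++ l₃)),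
    (tensAppend X (l₁ ++ l₂) l₃).hom ≫ ((tensAppend X l₁ l₂).hom ▷ tens X l₃) =
      tensCast X h ≫ (tensAppend X l₁ (l₂ ++ l₃)).hom ≫
        (tens X l₁ ◁ (tensAppend X l₂ l₃).hom) ≫ (α_ _ _ _).inv
  | [], l₂, l₃, h => by
    simp [tensAppend_nil]
  | i :: l₁, l₂, l₃, h => by
    have := tensAppend_assoc X l₁ l₂ l₃ (List.append_assoc _ _ _)
    have e := tensCast_cons X i (List.append_assoc l₁ l₂ l₃) h
    simp only [List.cons_append, tensAppend_cons] at this ⊢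
    rw [e]
    exact tens_aux _ _ _ _ _ this

theorem tensAppend_cast (X : ι → C) (a : List ι) {l l' : List ι} (h : l = l')
    (h' : a ++ l = a ++ l') : tensCast X h' ≫ (tensAppend X a l').hom =
      (tensAppend X a l).hom ≫ tens X a ◁ tensCast X h := by
  subst h; simp

theorem tensAppend_right_unit (X : ι → C) : ∀ (l : List ι) (h : l ++ [] = l),
    (tensAppend X l []).hom ≫ (ρ_ (tens X l)).hom = tensCast X h
  | [], h => by
    change (λ_ (𝟙_ C)).inv ≫ (ρ_ (𝟙_ C)).hom = 𝟙 _
    rw [← unitors_equal, Iso.inv_hom_id]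
  | i :: l, h => by
    have ih := tensAppend_right_unit X l (List.append_nil l)
    have e := tensCast_cons X i (List.append_nil l) h
    rw [e, ← ih]
    simp [tensAppend_cons]

/-- the associativity isomorphism for a concatenation of lists -/
def tensFlat (X : ι → C) (s : κ → List ι) : ∀ l : List κ,
    tens X (concat s l) ≅ tens (fun j => tens X (s j)) l
  | [] => Iso.refl _
  | j :: l => tensAppend X (s j) (concat s l) ≪≫ whiskerLeftIso _ (tensFlat X s l)


theorem tensFlat_nil (X : ι → C) (s : κ → List ι) : (tensFlat X s []).hom = 𝟙 (𝟙_ C) := rfl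
theorem tensFlat_cons (X : ι → C) (s : κ → List ι) (j : κ) (l : List κ) :
    (tensFlat X s (j :: l)).hom =
      (tensAppend X (s j) (concat s l)).hom ≫ tens X (s j) ◁ (tensFlat X s l).hom := rfl

theorem tensFlat_naturality {X Y : ι → C} (φ : ∀ i, X i ⟶ Y i) (s : κ → List ι) : ∀ l : List κ,
    (tensFlat X s l).hom ≫ tensMap (fun j => tensMap φ (s j)) l =
      tensMap φ (concat s l) ≫ (tensFlat Y s l).hom
  | [] => by simp [tensFlat_nil, tensMap_nil]
  | j :: l => by
    have h₁ := tensAppend_naturality φ (s j) (concat s l)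
    have h₂ := tensFlat_naturality φ s l
    simp only [tensFlat_cons, tensMap_cons, Category.assoc]
    rw [← reassoc_of% h₁, ← id_tensorHom, ← id_tensorHom, tensorHom_comp_tensorHom,
      tensorHom_comp_tensorHom, h₂]
    simp


theorem tensFlat_aux {P A A' B Q R T Q' R' : C} (f : A ⟶ B) (g : B ⟶ Q ⊗ R) (c : A ⟶ A')
    (d : A' ⟶ Q' ⊗ R') (q : Q' ⟶ Q) (r : R' ⟶ R) (h : f ≫ g = c ≫ d ≫ (q ⊗ₘ r))
    {AA : C} (a₁ : AA ⟶ P ⊗ A) {AB : C} (a₂ : AB ⟶ T ⊗ R') (a₃ : T ⟶ P ⊗ Q') (k : AA ⟶ AB)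
    (h' : a₁ ≫ P ◁ c ≫ P ◁ d ≫ (α_ _ _ _).inv = k ≫ a₂ ≫ a₃ ▷ R') :
    (a₁ ≫ P ◁ f) ≫ P ◁ g ≫ (α_ _ _ _).inv = k ≫ a₂ ≫ ((a₃ ≫ P ◁ q) ⊗ₘ r) := by
  have e₁ : (a₁ ≫ P ◁ f) ≫ P ◁ g ≫ (α_ P Q R).inv =
      (a₁ ≫ P ◁ c ≫ P ◁ d ≫ (α_ _ _ _).inv) ≫ ((P ◁ q) ⊗ₘ r) := by
    have : P ◁ f ≫ P ◁ g = P ◁ c ≫ P ◁ d ≫ P ◁ (q ⊗ₘ r) := by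
      simp only [← whiskerLeft_comp, h]
    simp only [Category.assoc, reassoc_of% this]
    rw [← id_tensorHom P q, ← associator_inv_naturality, id_tensorHom]
  rw [e₁, h']
  rw [Category.assoc, Category.assoc, ← tensorHom_id, tensorHom_comp_tensorHom, Category.id_comp]

theorem tensFlat_append (X : ι → C) (s : κ → List ι) : ∀ (a b : List κ)
    (h : concat s (a ++ b) = concat s a ++ concat s b),
    (tensFlat X s (a ++ b)).hom ≫ (tensAppend (fun j => tens X (s j)) a b).hom =
      tensCast X h ≫ (tensAppend X (concat s a) (concat s b)).hom ≫
        ((tensFlat X s a).hom ⊗ₘ (tensFlat X s b).hom)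
  | [], b, h => by
    simp [tensAppend_nil, tensFlat_nil]
  | j :: a, b, h => by
    have ih := tensFlat_append X s a b (concat_append s a b)
    have h₁ := tensAppend_assoc X (s j) (concat s a) (concat s b) (List.append_assoc _ _ _)
    refine tensFlat_aux _ _ _ _ _ _ ih (tensAppend X (s j) (concat s (a ++ b))).hom _ _ _ ?_
    have h₂ := tensAppend_cast X (s j) (concat_append s a b)
      (congrArg (s j ++ ·) (concat_append s a b))
    rw [h₁, ← reassoc_of% h₂, ← Category.assoc (tensCast _ _) (tensCast _ _)]
    congr 1
    simp [tensCast]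

theorem tensFlat_cast (X : ι → C) (s : κ → List ι) {l l' : List κ} (h : l = l')
    (h' : concat s l = concat s l') :
    tensCast X h' ≫ (tensFlat X s l').hom =
      (tensFlat X s l).hom ≫ tensCast (fun j => tens X (s j)) h := by
  subst h; simp

theorem tensFlat_assoc (X : ι → C) (s : κ → List ι) (t : μ → List κ) : ∀ (l : List μ)
    (h : concat (fun j => concat s (t j)) l = concat s (concat t l)),
    (tensFlat X (fun j => concat s (t j)) l).hom ≫
        tensMap (fun j => (tensFlat X s (t j)).hom) l =
      tensCast X h ≫ (tensFlat X s (concat t l)).hom ≫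
        (tensFlat (fun j => tens X (s j)) t l).hom
  | [], h => by simp [tensFlat_nil, tensMap_nil]
  | j :: l, h => by
    have ih := tensFlat_assoc X s t l (concat_concat s t l).symm
    have h₁ := tensFlat_append X s (t j) (concat t l) (concat_append s _ _)
    have h₂ := tensAppend_cast X (concat s (t j)) (concat_concat s t l).symm
      (congrArg (concat s (t j) ++ ·) (concat_concat s t l).symm)
    simp only [tensFlat_cons, tensMap_cons, Category.assoc]
    rw [reassoc_of% h₁]
    have e₁ : tens X (concat s (t j)) ◁ (tensFlat X (fun j => concat s (t j)) l).hom ≫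
        ((tensFlat X s (t j)).hom ⊗ₘ tensMap (fun j => (tensFlat X s (t j)).hom) l) =
      tens X (concat s (t j)) ◁ tensCast X (concat_concat s t l).symm ≫
        ((tensFlat X s (t j)).hom ⊗ₘ ((tensFlat X s (concat t l)).hom ≫
        (tensFlat (fun j => tens X (s j)) t l).hom)) := by
      rw [← id_tensorHom, ← id_tensorHom, tensorHom_comp_tensorHom, tensorHom_comp_tensorHom, ih]
    rw [e₁, ← reassoc_of% h₂]
    have e₂ : ((tensFlat X s (t j)).hom ⊗ₘ (tensFlat X s (concat t l)).hom) ≫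
        tens (fun j => tens X (s j)) (t j) ◁ (tensFlat (fun j => tens X (s j)) t l).hom =
        ((tensFlat X s (t j)).hom ⊗ₘ ((tensFlat X s (concat t l)).hom ≫
        (tensFlat (fun j => tens X (s j)) t l).hom)) := by
      rw [← id_tensorHom, tensorHom_comp_tensorHom, Category.comp_id]
    rw [e₂]
    simp only [← Category.assoc]
    congr 2
    simp [tensCast]

theorem tensFlat_unit (X : ι → C) : ∀ (l : List ι) (h : concat (fun i => [i]) l = l),
    (tensFlat X (fun i => [i]) l).hom ≫ tensMap (fun i => (ρ_ (X i)).hom) l = tensCast X h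
  | [], h => by simp [tensFlat_nil, tensMap_nil]
  | i :: l, h => by
    have ih := tensFlat_unit X l (concat_singleton l)
    have e := tensCast_cons X i (concat_singleton l) h
    rw [e, ← ih]
    simp [tensFlat_cons, tensMap_cons, tensAppend_cons, tensAppend_nil, MonoidalCategory.tensorHom_def']

theorem tensFlat_unit' (X : ι → C) (s : κ → List ι) (j : κ) (h : concat s [j] = s j) :
    (tensFlat X s [j]).hom ≫ (ρ_ (tens X (s j))).hom = tensCast X h := by
  have := tensAppend_right_unit X (s j) (List.append_nil _)
  simpa [tensFlat_cons, tensFlat_nil] using this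

end Tens

/-- An object `[n]`, `n ≥ 1`, of Connes' cyclic category `Λ`: the circle with `n` marked points. -/
structure CyclicCat : Type where
  len : ℕ
  pos : 0 < len

namespace CyclicCat

/-- The set `V([n])` of marked points, numbered in their cyclic order. -/
abbrev V (a : CyclicCat) : Type := Fin a.len

/-- A morphism `[n] → [m]` of `Λ`: a map `V([n]) → V([m])` with a total order on each of its fibres,
such that writing the (ordered) fibres one after another in the cyclic order of `V([m])` gives
`V([n])` in its cyclic order. The map is recorded by its list of ordered fibres. (The total orders
on the fibres matter only if one fibre is the whole of `V([n])`.) -/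
@[ext]
structure Hom (a b : CyclicCat) : Type where
  fiber : b.V → List a.V
  rotated : concat fiber (List.finRange b.len) ~r List.finRange a.len

theorem isRotated_concat {ι κ : Type} (s : κ → List ι) {l l' : List κ} (h : l ~r l') :
    concat s l ~r concat s l' := by
  obtain ⟨n, rfl⟩ := h
  rw [List.rotate_eq_drop_append_take_mod, concat_append]
  conv_lhs => rw [← List.take_append_drop (n % l.length) l, concat_append]
  exact List.isRotated_append

instance : Category CyclicCat where
  Hom := Hom
  id a := ⟨fun v => [v], by rw [concat_singleton]⟩
  comp f g := ⟨fun w => concat f.fiber (g.fiber w), by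
    rw [← concat_concat]
    exact (isRotated_concat _ g.rotated).trans f.rotated⟩
  id_comp f := Hom.ext (funext fun w => concat_singleton _)
  comp_id f := Hom.ext (funext fun w => by simp [concat])
  assoc f g h := Hom.ext (funext fun w => (concat_concat _ _ _).symm)

/-- The fibre of `f` over a marked point, in its order. -/
def fiber {a b : CyclicCat} (f : a ⟶ b) : b.V → List a.V := Hom.fiber f

theorem hom_ext {a b : CyclicCat} {f g : a ⟶ b} (h : ∀ v, fiber f v = fiber g v) : f = g :=
  Hom.ext (funext h)

theorem id_fiber (a : CyclicCat) (v : a.V) : fiber (𝟙 a) v = [v] := rfl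
theorem comp_fiber {a b c : CyclicCat} (f : a ⟶ b) (g : b ⟶ c) (v : c.V) :
    fiber (f ≫ g) v = concat (fiber f) (fiber g v) := rfl

/-- The object `[1]`. -/
def one : CyclicCat := ⟨1, Nat.one_pos⟩

end CyclicCat

section Sharp

variable (C : Type u) [Category.{u} C] [MonoidalCategory C]

/-- `f_! : C^{V(a)} ⥤ C^{V(b)}`: the component of `f_! X` at `v` is the tensor product of the `X i`
over the fibre of `f` over `v`, in the order of the fibre (the unit if the fibre is empty). -/
def push {a b : CyclicCat} (f : a ⟶ b) : (a.V → C) ⥤ (b.V → C) where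
  obj X v := tens X (CyclicCat.fiber f v)
  map φ v := tensMap φ (CyclicCat.fiber f v)
  map_id X := by funext v; exact tensMap_id X _
  map_comp φ ψ := by funext v; exact tensMap_comp φ ψ _

/-- `(𝟙)_! ≅ 𝟭` -/
def pushId (a : CyclicCat) : push C (𝟙 a) ≅ 𝟭 (a.V → C) :=
  NatIso.ofComponents (fun X => Pi.isoMk fun v =>
    (show tens X [v] ≅ X v from ρ_ (X v))) (fun {X Y} φ => by
    funext v
    change (φ v ⊗ₘ 𝟙 (𝟙_ C)) ≫ (ρ_ (Y v)).hom = (ρ_ (X v)).hom ≫ φ v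
    simp)

/-- `(f ≫ g)_! ≅ g_! ∘ f_!` -/
def pushComp {a b c : CyclicCat} (f : a ⟶ b) (g : b ⟶ c) :
    push C (f ≫ g) ≅ push C f ⋙ push C g :=
  NatIso.ofComponents (fun X => Pi.isoMk fun v =>
    (tensFlat X (CyclicCat.fiber f) (CyclicCat.fiber g v)))
    (fun {X Y} φ => by
    funext v
    exact (tensFlat_naturality φ (CyclicCat.fiber f) (CyclicCat.fiber g v)).symm)

variable {C}

/-- the identification of `f_! X` and `g_! X` for `f = g` -/
def pushCast {a b : CyclicCat} {f g : a ⟶ b} (h : f = g) (X : a.V → C) :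
    (push C f).obj X ⟶ (push C g).obj X :=
  fun v => tensCast X (congrArg (fun k => CyclicCat.fiber k v) h)

@[simp] theorem pushCast_rfl {a b : CyclicCat} {f : a ⟶ b} (h : f = f) (X : a.V → C) :
    pushCast h X = 𝟙 _ := rfl

theorem pushCast_trans {a b : CyclicCat} {f g k : a ⟶ b} (h : f = g) (h' : g = k)
    (X : a.V → C) : pushCast h X ≫ pushCast h' X = pushCast (h.trans h') X := by
  subst h; simp

theorem pushComp_assoc {a b c d : CyclicCat} (f : a ⟶ b) (g : b ⟶ c) (h : c ⟶ d) (X : a.V → C) :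
    (pushComp C (f ≫ g) h).hom.app X ≫ (push C h).map ((pushComp C f g).hom.app X) =
      pushCast (Category.assoc f g h) X ≫ (pushComp C f (g ≫ h)).hom.app X ≫
        (pushComp C g h).hom.app ((push C f).obj X) := by
  funext v
  exact tensFlat_assoc X (CyclicCat.fiber f) (CyclicCat.fiber g) (CyclicCat.fiber h v)
    (concat_concat _ _ _).symm

theorem pushComp_assoc_inv {a b c d : CyclicCat} (f : a ⟶ b) (g : b ⟶ c) (h : c ⟶ d)
    (X : a.V → C) :
    (push C h).map ((pushComp C f g).inv.app X) ≫ (pushComp C (f ≫ g) h).inv.app X =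
      (pushComp C g h).inv.app ((push C f).obj X) ≫ (pushComp C f (g ≫ h)).inv.app X ≫
        pushCast (Category.assoc f g h).symm X := by
  have h₁ := pushComp_assoc f g h X
  have h₃ : pushCast (Category.assoc f g h).symm X ≫ pushCast (Category.assoc f g h) X = 𝟙 _ := by
    rw [pushCast_trans, pushCast_rfl]
  rw [← cancel_mono ((pushComp C (f ≫ g) h).hom.app X),
    ← cancel_mono ((push C h).map ((pushComp C f g).hom.app X))]
  have e₁ : (((push C h).map ((pushComp C f g).inv.app X) ≫
      (pushComp C (f ≫ g) h).inv.app X) ≫ (pushComp C (f ≫ g) h).hom.app X) ≫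
        (push C h).map ((pushComp C f g).hom.app X) = 𝟙 _ := by
    rw [Category.assoc, Category.assoc, Iso.inv_hom_id_app_assoc, ← Functor.map_comp,
      Iso.inv_hom_id_app, CategoryTheory.Functor.map_id]
  rw [e₁, Category.assoc, h₁]
  dsimp only [Functor.comp_obj]
  simp only [Category.assoc]
  rw [reassoc_of% h₃, Iso.inv_hom_id_app_assoc, Iso.inv_hom_id_app]
  rfl

theorem pushComp_id_left {a b : CyclicCat} (f : a ⟶ b) (X : a.V → C) :
    (pushComp C (𝟙 a) f).hom.app X ≫ (push C f).map ((pushId C a).hom.app X) =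
      pushCast (Category.id_comp f) X := by
  funext v
  exact tensFlat_unit X (CyclicCat.fiber f v) (concat_singleton _)

theorem pushComp_id_right {a b : CyclicCat} (f : a ⟶ b) (X : a.V → C) :
    (pushComp C f (𝟙 b)).hom.app X ≫ (pushId C b).hom.app ((push C f).obj X) =
      pushCast (Category.comp_id f) X := by
  funext v
  exact tensFlat_unit' X (CyclicCat.fiber f) v (List.append_nil _)

variable (C)

/-- `C_#`: pairs of an object `[n]` of `Λ` and a family of `n` objects of `C`; the morphisms over `f`
are the morphisms `f_! X ⟶ Y` in `C^{n'}`. -/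
structure Sharp : Type u where
  base : CyclicCat
  fib : base.V → C

namespace Sharp

variable {C}

/-- Morphisms of `C_#`. -/
structure Hom (X Y : Sharp C) : Type u where
  base : X.base ⟶ Y.base
  fib : (push C base).obj X.fib ⟶ Y.fib

theorem Hom.ext' {X Y : Sharp C} {f g : Hom X Y} (h : f.base = g.base)
    (h' : f.fib = pushCast h X.fib ≫ g.fib) : f = g := by
  obtain ⟨f, f'⟩ := f
  obtain ⟨g, g'⟩ := g
  obtain rfl : f = g := h
  simp only [pushCast_rfl, Category.id_comp] at h'
  rw [h']

instance : Category (Sharp C) where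
  Hom := Hom
  id X := ⟨𝟙 _, (pushId C X.base).hom.app X.fib⟩
  comp {X _ _} f g := ⟨f.base ≫ g.base,
    (pushComp C f.base g.base).hom.app X.fib ≫ (push C g.base).map f.fib ≫ g.fib⟩
  id_comp {X Y} f := by
    refine Hom.ext' (Category.id_comp _) ?_
    have := pushComp_id_left f.base X.fib
    simp only [reassoc_of% this]
  comp_id {X Y} f := by
    refine Hom.ext' (Category.comp_id _) ?_
    have h₁ := (pushId C Y.base).hom.naturality f.fib
    have h₂ := pushComp_id_right f.base X.fib
    dsimp only [Functor.id_obj, Functor.id_map] at h₁ h₂ ⊢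
    rw [h₁, reassoc_of% h₂]
  assoc {X Y Z W} f g h := by
    refine Hom.ext' (Category.assoc _ _ _) ?_
    have h₁ := pushComp_assoc f.base g.base h.base X.fib
    have h₂ := (pushComp C g.base h.base).hom.naturality f.fib
    dsimp only [Functor.comp_obj, Functor.comp_map] at h₁ h₂ ⊢
    simp only [Functor.map_comp, Category.assoc]
    rw [reassoc_of% h₁, reassoc_of% h₂]

end Sharp

/-- The opposite of `(C^opp)_#`, where `C^opp` is a monoidal category with the same tensor product:
a morphism from `Y` to `X` over `f : X.base ⟶ Y.base` is a morphism `Y ⟶ f_! X` in `C^{n'}`.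
So functors on `(C^opp)_#` are presheaves on this category. -/
structure SharpOp : Type u where
  base : CyclicCat
  fib : base.V → C

namespace SharpOp

variable {C}

/-- Morphisms of `((C^opp)_#)^opp`. -/
structure Hom (X Y : SharpOp C) : Type u where
  base : Y.base ⟶ X.base
  fib : X.fib ⟶ (push C base).obj Y.fib

theorem Hom.ext' {X Y : SharpOp C} {f g : Hom X Y} (h : f.base = g.base)
    (h' : f.fib ≫ pushCast h Y.fib = g.fib) : f = g := by
  obtain ⟨f, f'⟩ := f
  obtain ⟨g, g'⟩ := g
  obtain rfl : f = g := h
  simp only [pushCast_rfl, Category.comp_id] at h'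
  rw [h']

instance : Category (SharpOp C) where
  Hom := Hom
  id X := ⟨𝟙 _, (pushId C X.base).inv.app X.fib⟩
  comp {_ _ Z} f g := ⟨g.base ≫ f.base,
    f.fib ≫ (push C f.base).map g.fib ≫ (pushComp C g.base f.base).inv.app Z.fib⟩
  id_comp {X Y} f := by
    refine Hom.ext' (Category.comp_id _) ?_
    have h₁ := (pushId C X.base).inv.naturality f.fib
    have h₂ := pushComp_id_right f.base Y.fib
    dsimp only [Functor.id_obj, Functor.id_map] at h₁ h₂ ⊢
    rw [← h₂]
    simp [← reassoc_of% h₁]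
  comp_id {X Y} f := by
    refine Hom.ext' (Category.id_comp _) ?_
    have h₂ := pushComp_id_left f.base Y.fib
    dsimp only [Functor.id_obj, Functor.id_map] at h₂ ⊢
    rw [← h₂]
    simp [← Functor.map_comp]
  assoc {X Y Z W} f g h := by
    refine Hom.ext' (Category.assoc _ _ _).symm ?_
    have h₁ := pushComp_assoc_inv h.base g.base f.base W.fib
    have h₂ := (pushComp C g.base f.base).inv.naturality h.fib
    dsimp only [Functor.comp_obj, Functor.comp_map] at h₁ h₂ ⊢
    simp only [Functor.map_comp, Category.assoc]
    rw [h₁, reassoc_of% h₂]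

end SharpOp

end Sharp

section Multi

variable {k : Type u} [Field k] {C : Type u} [Category.{u} C] [Preadditive C] [Linear k C]

/-- `G : (C^opp)^V → k-Vect` is `k`-linear in each variable (the other variables being fixed). -/
structure IsMultiLinear {V : Type} (G : (V → C)ᵒᵖ ⥤ ModuleCat.{u} k) : Prop where
  map_add : ∀ {X Y : V → C} (i : V) (u v w : X ⟶ Y), w i = u i + v i →
    (∀ j, j ≠ i → u j = w j ∧ v j = w j) → G.map w.op = G.map u.op + G.map v.op
  map_smul : ∀ {X Y : V → C} (i : V) (c : k) (u w : X ⟶ Y), w i = c • u i →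
    (∀ j, j ≠ i → w j = u j) → G.map w.op = c • G.map u.op

/-- `G : (C^opp)^V → k-Vect` is polylinear and left exact in each variable: an exact sequence
`X i ⟶ Y i ⟶ Z i ⟶ 0` in one variable, with the other variables fixed (up to isomorphism), is sent
to an exact sequence `0 ⟶ G(Z) ⟶ G(Y) ⟶ G(X)`. -/
structure IsMultiSheaf {V : Type} (G : (V → C)ᵒᵖ ⥤ ModuleCat.{u} k) : Prop
    extends IsMultiLinear G where
  exact : ∀ (i : V) {X Y Z : V → C} (q : X ⟶ Y) (p : Y ⟶ Z) (w : q i ≫ p i = 0),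
    (ShortComplex.mk (q i) (p i) w).Exact → Epi (p i) →
    (∀ j, j ≠ i → IsIso (q j) ∧ IsIso (p j)) →
    Function.Injective (G.map p.op).hom ∧
      ∀ s, (G.map q.op).hom s = 0 → ∃ t, (G.map p.op).hom t = s

theorem IsMultiLinear.map_zero {V : Type} {G : (V → C)ᵒᵖ ⥤ ModuleCat.{u} k}
    (hG : IsMultiLinear G) {X Y : V → C} (i : V) (u : X ⟶ Y) (h : u i = 0) : G.map u.op = 0 := by
  rw [hG.map_smul i 0 u u (by simp [h]) (fun _ _ => rfl), zero_smul]

end Multi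

section MultiSheaf

variable {k : Type u} [Field k] {C : Type u} [Category.{u} C] [Abelian C] [Linear k C]
  {V : Type}

theorem exists_factor (i : V) {M N : V → C} (p : M ⟶ N) :
    ∃ (L : V → C) (q : M ⟶ L) (r : L ⟶ N), q ≫ r = p ∧ IsIso (r i) ∧
      ((∀ j, Epi (p j)) → ∀ j, Epi (q j)) ∧ ((∀ j, Epi (p j)) → ∀ j, Epi (r j)) ∧
      (∀ j, j ≠ i → IsIso (q j)) ∧ (∀ j, IsIso (p j) → IsIso (r j)) := by
  classical
  have : ∀ j, ∃ (L : C) (q : M j ⟶ L) (r : L ⟶ N j), q ≫ r = p j ∧ (j = i → IsIso r) ∧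
      (Epi (p j) → Epi q) ∧ (Epi (p j) → Epi r) ∧ (j ≠ i → IsIso q) ∧ (IsIso (p j) → IsIso r) := by
    intro j
    by_cases h : j = i
    · exact ⟨N j, p j, 𝟙 _, by simp, fun _ => inferInstance, fun h => h, fun _ => inferInstance,
        fun h' => (h' h).elim, fun _ => inferInstance⟩
    · exact ⟨M j, 𝟙 _, p j, by simp, fun h' => (h h').elim, fun _ => inferInstance, fun h => h,
        fun _ => inferInstance, fun h => h⟩
  choose L q r h₁ h₂ h₃ h₄ h₅ h₆ using this
  exact ⟨L, q, r, funext h₁, h₂ i rfl, fun h j => h₃ j (h j), fun h j => h₄ j (h j), h₅, h₆⟩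

theorem exists_kernel (i : V) {M N : V → C} (p : M ⟶ N) [Epi (p i)] :
    ∃ (K : V → C) (q q₀ : K ⟶ M) (w : q i ≫ p i = 0), (ShortComplex.mk (q i) (p i) w).Exact ∧
      (∀ j, j ≠ i → IsIso (q j)) ∧ q₀ i = 0 ∧ q ≫ p = q₀ ≫ p := by
  classical
  have : ∀ j, ∃ (K : C) (q q₀ : K ⟶ M j), (j = i → ∃ w : q ≫ p j = 0,
      (ShortComplex.mk q (p j) w).Exact) ∧ (j ≠ i → IsIso q) ∧ (j = i → q₀ = 0) ∧
      q ≫ p j = q₀ ≫ p j := by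
    intro j
    by_cases h : j = i
    · exact ⟨kernel (p j), kernel.ι _, 0, fun _ => ⟨by simp, ShortComplex.exact_kernel _⟩,
        fun h' => (h' h).elim, fun _ => rfl, by simp⟩
    · exact ⟨M j, 𝟙 _, 𝟙 _, fun h' => (h h').elim, fun _ => inferInstance, fun h' => (h h').elim,
        rfl⟩
  choose K q q₀ h₁ h₂ h₃ h₄ using this
  obtain ⟨w, hw⟩ := h₁ i rfl
  exact ⟨K, q, q₀, w, hw, h₂, h₃ i rfl, funext h₄⟩

variable {G : (V → C)ᵒᵖ ⥤ ModuleCat.{u} k}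

theorem IsMultiSheaf.single_injective (hG : IsMultiSheaf G) (i : V) {M N : V → C} (p : M ⟶ N)
    [Epi (p i)] (h : ∀ j, j ≠ i → IsIso (p j)) : Function.Injective (G.map p.op).hom := by
  obtain ⟨K, q, q₀, w, hw, h₁, -, -⟩ := exists_kernel i p
  exact (hG.exact i q p w hw inferInstance (fun j hj => ⟨h₁ j hj, h j hj⟩)).1

theorem IsMultiSheaf.single_descent (hG : IsMultiSheaf G) (i : V) {M N : V → C} (p : M ⟶ N)
    [Epi (p i)] (h : ∀ j, j ≠ i → IsIso (p j)) (s : G.obj (.op M))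
    (hs : ∀ {Z : V → C} (a b : Z ⟶ M), a ≫ p = b ≫ p →
      (G.map a.op).hom s = (G.map b.op).hom s) : ∃ t, (G.map p.op).hom t = s := by
  obtain ⟨K, q, q₀, w, hw, h₁, h₂, h₃⟩ := exists_kernel i p
  refine (hG.exact i q p w hw inferInstance (fun j hj => ⟨h₁ j hj, h j hj⟩)).2 s ?_
  rw [hs q q₀ h₃, hG.map_zero i q₀ h₂]
  rfl

theorem map_op_comp_apply {X Y Z : V → C} (f : X ⟶ Y) (g : Y ⟶ Z) (s : G.obj (.op Z)) :
    (G.map (f ≫ g).op).hom s = (G.map f.op).hom ((G.map g.op).hom s) := by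
  rw [op_comp, G.map_comp]; rfl

theorem isIso_pi {X Y : V → C} (f : X ⟶ Y) (h : ∀ i, IsIso (f i)) : IsIso f :=
  ⟨⟨fun i => inv (f i), funext fun i => by simp, funext fun i => by simp⟩⟩

theorem injective_of_isIso {X Y : V → C} (f : X ⟶ Y) [IsIso f] :
    Function.Injective (G.map f.op).hom := fun x y h => by
  have e : f.op ≫ (inv f).op = 𝟙 _ := by rw [← op_comp]; simp
  have e' : ∀ z, (G.map (inv f).op).hom ((G.map f.op).hom z) = z := fun z => by
    rw [← map_op_comp_apply, IsIso.inv_hom_id]; simp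
  rw [← e' x, ← e' y, h]

/-- common refinement of lifts through an epimorphism -/
theorem exists_lift {M N Z : V → C} (p : M ⟶ N) (hp : ∀ j, Epi (p j)) (a : Z ⟶ N) :
    ∃ (Z' : V → C) (e : Z' ⟶ Z) (a' : Z' ⟶ M), (∀ j, Epi (e j)) ∧ e ≫ a = a' ≫ p :=
  ⟨fun j => pullback (a j) (p j), fun _ => pullback.fst _ _, fun _ => pullback.snd _ _,
    fun _ => inferInstance, funext fun _ => pullback.condition⟩

variable [Fintype V]

theorem IsMultiSheaf.injective (hG : IsMultiSheaf G) {M N : V → C} (p : M ⟶ N)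
    (hp : ∀ j, Epi (p j)) : Function.Injective (G.map p.op).hom := by
  classical
  have key : ∀ (T : Finset V) (M N : V → C) (p : M ⟶ N), (∀ j, Epi (p j)) →
      (∀ j, j ∉ T → IsIso (p j)) → Function.Injective (G.map p.op).hom := by
    intro T
    induction T using Finset.induction_on with
    | empty =>
      intro M N p _ h
      have := isIso_pi p (fun i => h i (by simp))
      exact injective_of_isIso p
    | insert i T hi ih =>
      intro M N p hp h
      obtain ⟨L, q, r, rfl, h₁, h₂, h₃, h₄, h₅⟩ := exists_factor i p
      have := h₂ hp i
      intro x y hxy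
      rw [map_op_comp_apply, map_op_comp_apply] at hxy
      refine ih L N r (h₃ hp) (fun j hj => ?_) (hG.single_injective i q h₄ hxy)
      by_cases hj' : j = i
      · subst hj'; exact h₁
      · exact h₅ j (h j (by simp [hj, hj']))
  exact key Finset.univ M N p hp (by simp)

theorem IsMultiSheaf.descent (hG : IsMultiSheaf G) {M N : V → C} (p : M ⟶ N)
    (hp : ∀ j, Epi (p j)) (s : G.obj (.op M))
    (hs : ∀ {Z : V → C} (a b : Z ⟶ M), a ≫ p = b ≫ p →
      (G.map a.op).hom s = (G.map b.op).hom s) : ∃ t, (G.map p.op).hom t = s := by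
  classical
  have key : ∀ (T : Finset V) (M N : V → C) (p : M ⟶ N), (∀ j, Epi (p j)) →
      (∀ j, j ∉ T → IsIso (p j)) → ∀ (s : G.obj (.op M)),
      (∀ {Z : V → C} (a b : Z ⟶ M), a ≫ p = b ≫ p →
      (G.map a.op).hom s = (G.map b.op).hom s) → ∃ t, (G.map p.op).hom t = s := by
    intro T
    induction T using Finset.induction_on with
    | empty =>
      intro M N p _ h s _
      have := isIso_pi p (fun i => h i (by simp))
      exact ⟨(G.map (inv p).op).hom s, by rw [← map_op_comp_apply]; simp⟩
    | insert i T hi ih =>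
      intro M N p hp h s hs
      obtain ⟨L, q, r, rfl, h₁, h₂, h₃, h₄, h₅⟩ := exists_factor i p
      have := h₂ hp i
      obtain ⟨t, rfl⟩ := hG.single_descent i q h₄ s (fun a b hab => hs a b (by
        rw [← Category.assoc, hab, Category.assoc]))
      obtain ⟨t', rfl⟩ := ih L N r (h₃ hp) (fun j hj => by
        by_cases hj' : j = i
        · subst hj'; exact h₁
        · exact h₅ j (h j (by simp [hj, hj']))) t (fun {Z} a b hab => by
          obtain ⟨Z₁, e₁, a₁, he₁, h₁'⟩ := exists_lift q (h₂ hp) a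
          obtain ⟨Z₂, e₂, b₂, he₂, h₂'⟩ := exists_lift q (h₂ hp) (e₁ ≫ b)
          refine hG.injective e₁ he₁ (hG.injective e₂ he₂ ?_)
          rw [← map_op_comp_apply e₁ a, ← map_op_comp_apply e₁ b, h₁',
            ← map_op_comp_apply e₂ (e₁ ≫ b), h₂', map_op_comp_apply a₁ q,
            ← map_op_comp_apply e₂ a₁, map_op_comp_apply b₂ q]
          refine hs _ _ ?_
          rw [Category.assoc, ← reassoc_of% h₁', hab, ← reassoc_of% h₂'])
      exact ⟨t', by rw [map_op_comp_apply]⟩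
  exact key Finset.univ M N p hp (by simp) s hs

theorem IsMultiLinear.kill (hG : IsMultiLinear G)
    (h₁ : ∀ {M N : V → C} (p : M ⟶ N), (∀ j, Epi (p j)) → Function.Injective (G.map p.op).hom)
    (i : V) {X Y Z T : V → C} (q : X ⟶ Y) (p : Y ⟶ Z) (w : q i ≫ p i = 0)
    (hw : (ShortComplex.mk (q i) (p i) w).Exact)
    (h : ∀ j, j ≠ i → IsIso (q j) ∧ IsIso (p j)) (s : G.obj (.op Y))
    (hs : (G.map q.op).hom s = 0) (a b : T ⟶ Y) (hab : a ≫ p = b ≫ p) :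
    (G.map a.op).hom s = (G.map b.op).hom s := by
  classical
  have hd : (a i - b i) ≫ p i = 0 := by
    rw [Preadditive.sub_comp, sub_eq_zero]; exact congrFun hab i
  obtain ⟨T', e, he, d, hd'⟩ :=
    (ShortComplex.exact_iff_exact_up_to_refinements _).1 hw (a i - b i) hd
  dsimp at hd' d
  have hj : ∀ j, ∃ (T' : C) (e' : T' ⟶ T j) (d' : T' ⟶ X j), Epi e' ∧
      (j = i → d' ≫ q j = e' ≫ (a j - b j)) ∧ (j ≠ i → d' ≫ q j = e' ≫ a j ∧ a j = b j) := by
    intro j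
    by_cases hj : j = i
    · subst hj
      exact ⟨T', e, d, he, fun _ => hd'.symm, fun h => (h rfl).elim⟩
    · have := (h j hj).1
      have := (h j hj).2
      refine ⟨T j, 𝟙 _, a j ≫ inv (q j), inferInstance, fun h => (hj h).elim, fun _ => ?_⟩
      refine ⟨by simp, ?_⟩
      rw [← cancel_mono (p j)]
      exact congrFun hab j
  choose T'' e' d' h₃ h₄ h₅ using hj
  let E : T'' ⟶ T := e'
  let D : T'' ⟶ X := d'
  refine h₁ E h₃ ?_
  rw [← map_op_comp_apply, ← map_op_comp_apply,
    hG.map_add i (E ≫ b) (D ≫ q) (E ≫ a) (by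
      change e' i ≫ a i = e' i ≫ b i + d' i ≫ q i
      rw [h₄ i rfl, ← Preadditive.comp_add]; simp) (fun j hj => ⟨by
      change e' j ≫ b j = e' j ≫ a j
      rw [(h₅ j hj).2], (h₅ j hj).1⟩)]
  simp [hs]

theorem IsMultiLinear.isMultiSheaf (hG : IsMultiLinear G)
    (h₁ : ∀ {M N : V → C} (p : M ⟶ N), (∀ j, Epi (p j)) → Function.Injective (G.map p.op).hom)
    (h₂ : ∀ {M N : V → C} (p : M ⟶ N), (∀ j, Epi (p j)) → ∀ (s : G.obj (.op M)),
      (∀ {Z : V → C} (a b : Z ⟶ M), a ≫ p = b ≫ p →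
      (G.map a.op).hom s = (G.map b.op).hom s) → ∃ t, (G.map p.op).hom t = s) :
    IsMultiSheaf G where
  toIsMultiLinear := hG
  exact i X Y Z q p w hw hp h := by
    have hp' : ∀ j, Epi (p j) := fun j => by
      by_cases hj : j = i
      · subst hj; exact hp
      · have := (h j hj).2; infer_instance
    exact ⟨h₁ p hp', fun s hs => h₂ p hp' s
      (fun {T} a b hab => hG.kill h₁ i q p w hw h s hs a b hab)⟩

end MultiSheaf

section LinSite

/-- A class of coverings, together with families of linear relations between parallel morphisms,
on a small category. -/
structure LinSite (k : Type u) [Field k] (X : Type u) [Category.{u} X] where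
  cov : MorphismProperty X
  add : ∀ {x y : X}, (x ⟶ y) → (x ⟶ y) → (x ⟶ y) → Prop
  smul : ∀ {x y : X}, k → (x ⟶ y) → (x ⟶ y) → Prop
  cov_id : ∀ x : X, cov (𝟙 x)
  cov_comp : ∀ {x y z : X} (f : x ⟶ y) (g : y ⟶ z), cov f → cov g → cov (f ≫ g)
  cov_lift : ∀ {x y z : X} (p : x ⟶ y) (f : z ⟶ y), cov p →
    ∃ (z' : X) (e : z' ⟶ z) (f' : z' ⟶ x), cov e ∧ e ≫ f = f' ≫ p
  add_lift : ∀ {x y y' : X} (p : y' ⟶ y) (f g h : x ⟶ y), cov p → add f g h →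
    ∃ (x' : X) (e : x' ⟶ x) (f' g' h' : x' ⟶ y'), cov e ∧ add f' g' h' ∧
      e ≫ f = f' ≫ p ∧ e ≫ g = g' ≫ p ∧ e ≫ h = h' ≫ p
  smul_lift : ∀ {x y y' : X} (p : y' ⟶ y) (c : k) (f h : x ⟶ y), cov p → smul c f h →
    ∃ (x' : X) (e : x' ⟶ x) (f' h' : x' ⟶ y'), cov e ∧ smul c f' h' ∧
      e ≫ f = f' ≫ p ∧ e ≫ h = h' ≫ p

namespace LinSite

variable {k : Type u} [Field k] {X : Type u} [Category.{u} X] (S : LinSite k X)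

/-- The Grothendieck topology generated by the coverings. -/
def topology : GrothendieckTopology X where
  sieves x := {T | ∃ (y : X) (f : y ⟶ x), S.cov f ∧ T f}
  top_mem' x := ⟨x, 𝟙 x, S.cov_id x, trivial⟩
  pullback_stable' x y T g := by
    rintro ⟨z, f, hf, hT⟩
    obtain ⟨z', e, f', he, h⟩ := S.cov_lift f g hf
    refine ⟨z', e, he, ?_⟩
    change T (e ≫ g)
    rw [h]
    exact T.downward_closed hT f'
  transitive' x T := by
    rintro ⟨y, f, hf, hT⟩ R hR
    obtain ⟨z, g, hg, h⟩ := hR hT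
    exact ⟨z, g ≫ f, S.cov_comp g f hg hf, h⟩

/-- The linear presheaves. -/
structure IsLin (G : Xᵒᵖ ⥤ ModuleCat.{u} k) : Prop where
  map_add : ∀ {x y : X} (f g h : x ⟶ y), S.add f g h → G.map h.op = G.map f.op + G.map g.op
  map_smul : ∀ {x y : X} (c : k) (f h : x ⟶ y), S.smul c f h → G.map h.op = c • G.map f.op

/-- The sheaf condition in explicit form. -/
structure IsDescent (G : Xᵒᵖ ⥤ ModuleCat.{u} k) : Prop where
  injective : ∀ {x y : X} (p : x ⟶ y), S.cov p → Function.Injective (G.map p.op).hom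
  descent : ∀ {x y : X} (p : x ⟶ y), S.cov p → ∀ s : G.obj (.op x),
    (∀ {z : X} (a b : z ⟶ x), a ≫ p = b ≫ p → (G.map a.op).hom s = (G.map b.op).hom s) →
      ∃ t, (G.map p.op).hom t = s

variable {S} {G : Xᵒᵖ ⥤ ModuleCat.{u} k}

theorem map_comp_apply {x y z : X} (f : x ⟶ y) (g : y ⟶ z) (s : G.obj (.op z)) :
    (G.map (f ≫ g).op).hom s = (G.map f.op).hom ((G.map g.op).hom s) := by
  rw [op_comp, G.map_comp]; rfl

theorem IsDescent.isSheaf (hG : S.IsDescent G) : Presheaf.IsSheaf S.topology G := by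
  rw [Presheaf.isSheaf_iff_isSheaf_forget _ _ (forget (ModuleCat.{u} k)),
    isSheaf_iff_isSheaf_of_type]
  rintro x T ⟨y, f, hf, hT⟩ s hs
  obtain ⟨t, ht⟩ := hG.descent f hf (s f hT) (fun {z} a b hab => hs a b hT hT hab)
  refine ⟨t, fun z g hg => ?_, fun t' ht' => ?_⟩
  · obtain ⟨z', e, g', he, h⟩ := S.cov_lift f g hf
    refine hG.injective e he ?_
    have h₁ : (G.map e.op).hom (s g hg) = (G.map g'.op).hom (s f hT) := hs e g' hg hT h
    refine Eq.trans ?_ h₁.symm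
    rw [← ht]
    change (G.map e.op).hom ((G.map g.op).hom t) = _
    rw [← map_comp_apply, ← map_comp_apply, h]
  · refine hG.injective f hf ?_
    rw [ht]
    exact ht' f hT

theorem isDescent_of_isSheaf (hG : Presheaf.IsSheaf S.topology G) : S.IsDescent G := by
  rw [Presheaf.isSheaf_iff_isSheaf_forget _ _ (forget (ModuleCat.{u} k)),
    isSheaf_iff_isSheaf_of_type] at hG
  have key : ∀ {x y : X} (p : x ⟶ y), S.cov p →
      Presieve.IsSheafFor (G ⋙ forget (ModuleCat.{u} k)) (Presieve.singleton p) := by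
    intro x y p hp
    rw [Presieve.isSheafFor_iff_generate]
    refine hG _ ⟨x, p, hp, ?_⟩
    exact Sieve.le_generate (Presieve.singleton p) _ _ (Presieve.singleton_self p)
  constructor
  · intro x y p hp s t hst
    refine (key p hp).isSeparatedFor.ext ?_
    rintro z f ⟨⟩
    exact hst
  · intro x y p hp s hs
    obtain ⟨t, ht, -⟩ := Presieve.isSheafFor_singleton.1 (key p hp) s
      (fun {z} a b hab => hs a b hab)
    exact ⟨t, ht⟩

theorem IsLin.of_locallySurjective {F G : Xᵒᵖ ⥤ ModuleCat.{u} k} (hF : S.IsLin F)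
    (hG : ∀ {x y : X} (p : x ⟶ y), S.cov p → Function.Injective (G.map p.op).hom)
    (φ : F ⟶ G) [Presheaf.IsLocallySurjective S.topology φ] : S.IsLin G := by
  have nat : ∀ {x y : X} (f : x ⟶ y) (t : F.obj (.op y)),
      (G.map f.op).hom ((φ.app _).hom t) = (φ.app _).hom ((F.map f.op).hom t) := fun f t =>
    (ConcreteCategory.congr_hom (φ.naturality f.op) t).symm
  have loc : ∀ {y : X} (s : G.obj (.op y)), ∃ (y' : X) (p : y' ⟶ y) (t : F.obj (.op y')),
      S.cov p ∧ (φ.app _).hom t = (G.map p.op).hom s := by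
    intro y s
    obtain ⟨y', p, hp, t, ht⟩ := Presheaf.imageSieve_mem S.topology φ s
    exact ⟨y', p, t, hp, ht⟩
  constructor
  · intro x y f g h hfg
    ext s
    obtain ⟨y', p, t, hp, ht⟩ := loc s
    obtain ⟨x', e, f', g', h', he, hadd, h₁, h₂, h₃⟩ := S.add_lift p f g h hp hfg
    refine hG e he ?_
    change (G.map e.op).hom ((G.map h.op).hom s) =
      (G.map e.op).hom ((G.map f.op).hom s + (G.map g.op).hom s)
    rw [_root_.map_add, ← map_comp_apply, ← map_comp_apply, ← map_comp_apply, h₁, h₂, h₃,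
      map_comp_apply, map_comp_apply, map_comp_apply, ← ht, nat, nat, nat, ← _root_.map_add,
      hF.map_add _ _ _ hadd]
    rfl
  · intro x y c f h hfg
    ext s
    obtain ⟨y', p, t, hp, ht⟩ := loc s
    obtain ⟨x', e, f', h', he, hadd, h₁, h₃⟩ := S.smul_lift p c f h hp hfg
    refine hG e he ?_
    change (G.map e.op).hom ((G.map h.op).hom s) = (G.map e.op).hom (c • (G.map f.op).hom s)
    rw [_root_.map_smul, ← map_comp_apply, ← map_comp_apply, h₁, h₃,
      map_comp_apply, map_comp_apply, ← ht, nat, nat, ← _root_.map_smul,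
      hF.map_smul _ _ _ hadd]
    rfl

variable (S)

/-- The linear sheaves. -/
def linSheaf : ObjectProperty (Sheaf S.topology (ModuleCat.{u} k)) := fun F => S.IsLin F.obj

/-- The linear presheaves satisfying the explicit sheaf condition. -/
def linDescent : ObjectProperty (Xᵒᵖ ⥤ ModuleCat.{u} k) := fun F => S.IsLin F ∧ S.IsDescent F

theorem IsLin.of_mono_family {ι : Type*} {F : Xᵒᵖ ⥤ ModuleCat.{u} k}
    {G : ι → Xᵒᵖ ⥤ ModuleCat.{u} k} (hG : ∀ i, S.IsLin (G i)) (φ : ∀ i, F ⟶ G i)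
    (hφ : ∀ {x : Xᵒᵖ} (s t : F.obj x), (∀ i, ((φ i).app x).hom s = ((φ i).app x).hom t) → s = t) :
    S.IsLin F := by
  have nat : ∀ i {x y : X} (f : x ⟶ y) (t : F.obj (.op y)),
      ((φ i).app _).hom ((F.map f.op).hom t) = ((G i).map f.op).hom (((φ i).app _).hom t) :=
    fun i x y f t => ConcreteCategory.congr_hom ((φ i).naturality f.op) t
  constructor
  · intro x y f g h hfg
    ext s
    refine hφ _ _ fun i => ?_
    change _ = ((φ i).app _).hom ((F.map f.op).hom s + (F.map g.op).hom s)
    rw [_root_.map_add, nat, nat, nat, (hG i).map_add _ _ _ hfg]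
    rfl
  · intro x y c f h hfg
    ext s
    refine hφ _ _ fun i => ?_
    change _ = ((φ i).app _).hom (c • (F.map f.op).hom s)
    rw [_root_.map_smul, nat, nat, (hG i).map_smul _ _ _ hfg]
    rfl


theorem zero_of_relations (F : Xᵒᵖ ⥤ ModuleCat.{u} k) (hF : ∀ (x : Xᵒᵖ) (s : F.obj x), s = 0) :
    S.IsLin F := by
  constructor
  · intros
    ext s
    exact (hF _ _).trans (hF _ _).symm
  · intros
    ext s
    exact (hF _ _).trans (hF _ _).symm

instance : S.linSheaf.ContainsZero where
  exists_zero := by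
    obtain ⟨Z, hZ⟩ := HasZeroObject.zero (C := Sheaf S.topology (ModuleCat.{u} k))
    refine ⟨Z, hZ, ?_⟩
    have : IsZero Z.obj := (sheafToPresheaf S.topology (ModuleCat.{u} k)).map_isZero hZ
    refine zero_of_relations S _ fun x s => ?_
    have h : IsZero (Z.obj.obj x) := this.obj x
    have := ModuleCat.subsingleton_of_isZero h
    exact Subsingleton.elim _ _

instance : S.linSheaf.IsClosedUnderSubobjects where
  prop_of_mono {F G} f _ hG := by
    have : Mono ((sheafToPresheaf S.topology (ModuleCat.{u} k)).map f) := inferInstance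
    refine IsLin.of_mono_family S (ι := Unit) (fun _ => hG) (fun _ => f.hom) ?_
    intro x s t h
    have h₁ : Mono (((sheafToPresheaf S.topology (ModuleCat.{u} k)).map f).app x) := inferInstance
    exact (ModuleCat.mono_iff_injective _).1 h₁ (h ())

instance : S.linSheaf.IsClosedUnderQuotients where
  prop_of_epi {F G} f _ hF := by
    have : Sheaf.IsLocallySurjective f :=
      (Sheaf.isLocallySurjective_iff_epi' (A := ModuleCat.{u} k) f).2 inferInstance
    exact IsLin.of_locallySurjective hF (isDescent_of_isSheaf G.property).injective f.hom

instance : S.linSheaf.IsClosedUnderFiniteProducts where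
  isClosedUnderLimitsOfShape J _ := by
    refine ⟨?_⟩
    rintro F ⟨p⟩
    refine IsLin.of_mono_family S (ι := J) (fun j => p.prop_diag_obj ⟨j⟩)
      (fun j => (p.π.app ⟨j⟩).hom) ?_
    intro x s t h
    let E := sheafToPresheaf S.topology (ModuleCat.{u} k) ⋙ (evaluation _ _).obj x
    exact Concrete.isLimit_ext _ (isLimitOfPreserves E p.isLimit) s t (fun ⟨j⟩ => h j)

noncomputable instance : Abelian S.linSheaf.FullSubcategory := inferInstance

/-- Linear sheaves on the site and linear presheaves with the explicit sheaf condition. -/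
def toSheaf : S.linDescent.FullSubcategory ⥤ S.linSheaf.FullSubcategory :=
  S.linSheaf.lift (ObjectProperty.lift _ S.linDescent.ι (fun G => G.property.2.isSheaf))
    (fun G => G.property.1)

instance : S.toSheaf.Faithful where
  map_injective {F G} f g h := by
    ext1
    exact congrArg (fun q => q.hom.hom) h

instance : S.toSheaf.Full where
  map_surjective {F G} f := ⟨⟨f.hom.hom⟩, rfl⟩

instance : S.toSheaf.EssSurj where
  mem_essImage F := ⟨⟨F.obj.obj, F.property, isDescent_of_isSheaf F.obj.property⟩, ⟨Iso.refl _⟩⟩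

instance : S.toSheaf.IsEquivalence where

instance : HasFiniteProducts S.linDescent.FullSubcategory where
  out _ := Adjunction.hasLimitsOfShape_of_equivalence S.toSheaf

noncomputable instance : Abelian S.linDescent.FullSubcategory := abelianOfEquivalence S.toSheaf

end LinSite

end LinSite

section Incl

variable {C : Type u} [Category.{u} C] [MonoidalCategory C]

namespace Sharp

/-- The morphism over `f` with the given component on fibres. -/
def homMk {a b : CyclicCat} (f : a ⟶ b) {X : a.V → C} {Y : b.V → C}
    (φ : (push C f).obj X ⟶ Y) : (⟨a, X⟩ : Sharp C) ⟶ ⟨b, Y⟩ := Hom.mk f φ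

theorem homMk_comp_vert {a b : CyclicCat} (f : a ⟶ b) {X : a.V → C} {Y Z : b.V → C}
    (φ : (push C f).obj X ⟶ Y) (p : Y ⟶ Z) :
    homMk f φ ≫ homMk (𝟙 b) ((pushId C b).hom.app Y ≫ p) = homMk f (φ ≫ p) := by
  refine Hom.ext' (Category.comp_id _) ?_
  have h₁ := (pushId C b).hom.naturality φ
  have h₂ := pushComp_id_right f X
  change (pushComp C f (𝟙 b)).hom.app X ≫ (push C (𝟙 b)).map φ ≫ (pushId C b).hom.app Y ≫ p =
    pushCast _ X ≫ φ ≫ p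
  dsimp only [Functor.id_obj, Functor.id_map] at h₁ h₂
  rw [reassoc_of% h₁, reassoc_of% h₂]

variable (C) in
/-- The inclusion of the fibre over `a`. -/
def incl (a : CyclicCat) : (a.V → C) ⥤ Sharp C where
  obj X := ⟨a, X⟩
  map {X _} p := homMk (𝟙 a) ((pushId C a).hom.app X ≫ p)
  map_id X := congrArg (homMk (𝟙 a)) (Category.comp_id ((pushId C a).hom.app X))
  map_comp p q := by rw [homMk_comp_vert, Category.assoc]

/-- The morphism over `f` with the given component on fibres. -/
def mk' {a b : CyclicCat} (f : a ⟶ b) {X : a.V → C} {Y : b.V → C} (φ : (push C f).obj X ⟶ Y) :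
    (incl C a).obj X ⟶ (incl C b).obj Y := homMk f φ

theorem mk'_comp_incl {a b : CyclicCat} (f : a ⟶ b) {X : a.V → C} {Y Z : b.V → C}
    (φ : (push C f).obj X ⟶ Y) (p : Y ⟶ Z) :
    mk' f φ ≫ (incl C b).map p = mk' f (φ ≫ p) := homMk_comp_vert f φ p

theorem incl_comp_mk' {a b : CyclicCat} (f : a ⟶ b) {W X : a.V → C} {Y : b.V → C}
    (φ : (push C f).obj X ⟶ Y) (p : W ⟶ X) :
    (incl C a).map p ≫ mk' f φ = mk' f ((push C f).map p ≫ φ) := by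
  refine Hom.ext' (Category.id_comp _) ?_
  have h₂ := pushComp_id_left f W
  change (pushComp C (𝟙 a) f).hom.app W ≫ (push C f).map ((pushId C a).hom.app W ≫ p) ≫ φ =
    pushCast _ W ≫ (push C f).map p ≫ φ
  dsimp only [Functor.id_obj, Functor.id_map] at h₂ ⊢
  rw [Functor.map_comp, Category.assoc, reassoc_of% h₂]

/-- The cocartesian morphism over `f` out of `X`. -/
def cocart {a b : CyclicCat} (f : a ⟶ b) (X : a.V → C) :
    (incl C a).obj X ⟶ (incl C b).obj ((push C f).obj X) := mk' f (𝟙 _)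

theorem mk'_eq {a b : CyclicCat} (f : a ⟶ b) {X : a.V → C} {Y : b.V → C}
    (φ : (push C f).obj X ⟶ Y) : mk' f φ = cocart f X ≫ (incl C b).map φ := by
  rw [cocart, mk'_comp_incl, Category.id_comp]

theorem incl_comp_cocart {a b : CyclicCat} (f : a ⟶ b) {W X : a.V → C} (p : W ⟶ X) :
    (incl C a).map p ≫ cocart f X = cocart f W ≫ (incl C b).map ((push C f).map p) := by
  rw [cocart, incl_comp_mk', ← mk'_eq, Category.comp_id]

theorem cocart_id (a : CyclicCat) (X : a.V → C) :
    cocart (𝟙 a) X = (incl C a).map ((pushId C a).inv.app X) :=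
  congrArg (mk' (𝟙 a)) ((pushId C a).hom_inv_id_app X).symm

theorem cocart_comp {a b c : CyclicCat} (f : a ⟶ b) (g : b ⟶ c) (X : a.V → C) :
    cocart f X ≫ cocart g _ = cocart (f ≫ g) X ≫ (incl C c).map ((pushComp C f g).hom.app X) := by
  rw [← mk'_eq]
  refine Hom.ext' rfl ?_
  change (pushComp C f g).hom.app X ≫ (push C g).map (𝟙 _) ≫ 𝟙 _ = pushCast rfl X ≫ (pushComp C f g).hom.app X
  simp

end Sharp

namespace SharpOp

/-- The morphism over `f` with the given component on fibres. -/
def homMk {a b : CyclicCat} (f : a ⟶ b) {X : a.V → C} {Y : b.V → C}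
    (φ : Y ⟶ (push C f).obj X) : (⟨b, Y⟩ : SharpOp C) ⟶ ⟨a, X⟩ := Hom.mk f φ

theorem vert_comp_homMk {a b : CyclicCat} (f : a ⟶ b) {X : a.V → C} {Y Z : b.V → C}
    (φ : Y ⟶ (push C f).obj X) (p : Z ⟶ Y) :
    homMk (𝟙 b) (p ≫ (pushId C b).inv.app Y) ≫ homMk f φ = homMk f (p ≫ φ) := by
  refine Hom.ext' (Category.comp_id f) ?_
  have h₁ := (pushId C b).inv.naturality φ
  have h₂ := pushComp_id_right f X
  change ((p ≫ (pushId C b).inv.app Y) ≫ (push C (𝟙 b)).map φ ≫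
    (pushComp C f (𝟙 b)).inv.app X) ≫ pushCast _ X = p ≫ φ
  dsimp only [Functor.id_obj, Functor.id_map] at h₁ h₂ ⊢
  rw [← h₂]
  simp [← reassoc_of% h₁]

variable (C) in
/-- The inclusion of the fibre over `a`. -/
def incl (a : CyclicCat) : (a.V → C) ⥤ SharpOp C where
  obj X := ⟨a, X⟩
  map {_ Y} p := homMk (𝟙 a) (p ≫ (pushId C a).inv.app Y)
  map_id X := congrArg (homMk (𝟙 a)) (Category.id_comp ((pushId C a).inv.app X))
  map_comp p q := by rw [vert_comp_homMk, Category.assoc]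

/-- The morphism over `f` with the given component on fibres. -/
def mk' {a b : CyclicCat} (f : a ⟶ b) {X : a.V → C} {Y : b.V → C} (φ : Y ⟶ (push C f).obj X) :
    (incl C b).obj Y ⟶ (incl C a).obj X := homMk f φ

theorem incl_comp_mk' {a b : CyclicCat} (f : a ⟶ b) {X : a.V → C} {Y Z : b.V → C}
    (φ : Y ⟶ (push C f).obj X) (p : Z ⟶ Y) :
    (incl C b).map p ≫ mk' f φ = mk' f (p ≫ φ) := vert_comp_homMk f φ p

theorem mk'_comp_incl {a b : CyclicCat} (f : a ⟶ b) {X W : a.V → C} {Y : b.V → C}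
    (φ : Y ⟶ (push C f).obj X) (p : X ⟶ W) :
    mk' f φ ≫ (incl C a).map p = mk' f (φ ≫ (push C f).map p) := by
  refine Hom.ext' (Category.id_comp f) ?_
  have h₂ := pushComp_id_left f W
  change (φ ≫ (push C f).map (p ≫ (pushId C a).inv.app W) ≫
    (pushComp C (𝟙 a) f).inv.app W) ≫ pushCast _ W = φ ≫ (push C f).map p
  dsimp only [Functor.id_obj, Functor.id_map] at h₂ ⊢
  rw [← h₂]
  simp [← Functor.map_comp]

/-- The cartesian morphism over `f` into `X`. -/
def cart {a b : CyclicCat} (f : a ⟶ b) (X : a.V → C) :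
    (incl C b).obj ((push C f).obj X) ⟶ (incl C a).obj X := mk' f (𝟙 _)

theorem mk'_eq {a b : CyclicCat} (f : a ⟶ b) {X : a.V → C} {Y : b.V → C}
    (φ : Y ⟶ (push C f).obj X) : mk' f φ = (incl C b).map φ ≫ cart f X := by
  rw [cart, incl_comp_mk', Category.comp_id]

theorem cart_comp_incl {a b : CyclicCat} (f : a ⟶ b) {W X : a.V → C} (p : X ⟶ W) :
    cart f X ≫ (incl C a).map p = (incl C b).map ((push C f).map p) ≫ cart f W := by
  rw [cart, mk'_comp_incl, ← mk'_eq, Category.id_comp]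

theorem cart_id (a : CyclicCat) (X : a.V → C) :
    cart (𝟙 a) X = (incl C a).map ((pushId C a).hom.app X) :=
  congrArg (mk' (𝟙 a)) ((pushId C a).hom_inv_id_app X).symm

theorem cart_comp {a b c : CyclicCat} (f : a ⟶ b) (g : b ⟶ c) (X : a.V → C) :
    cart g _ ≫ cart f X = (incl C c).map ((pushComp C f g).inv.app X) ≫ cart (f ≫ g) X := by
  rw [← mk'_eq]
  refine Hom.ext' rfl ?_
  change (𝟙 _ ≫ (push C g).map (𝟙 _) ≫ (pushComp C f g).inv.app X) ≫ pushCast rfl X =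
    (pushComp C f g).inv.app X
  simp

end SharpOp

end Incl

section Tuples

variable (k : Type u) [Field k] (C : Type u) [Category.{u} C] [Abelian C] [Linear k C]

theorem exists_common_lift {V : Type} {X Y Y' : V → C} (i : V) (p : Y' ⟶ Y)
    (hp : ∀ j, Epi (p j)) (f g : X ⟶ Y) (h : ∀ j, j ≠ i → f j = g j) :
    ∃ (X' : V → C) (e : X' ⟶ X) (f' g' : X' ⟶ Y'), (∀ j, Epi (e j)) ∧
      (∀ j, j ≠ i → f' j = g' j) ∧ e ≫ f = f' ≫ p ∧ e ≫ g = g' ≫ p := by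
  classical
  have : ∀ j, ∃ (X' : C) (e : X' ⟶ X j) (f' g' : X' ⟶ Y' j), Epi e ∧
      (j ≠ i → f' = g') ∧ e ≫ f j = f' ≫ p j ∧ e ≫ g j = g' ≫ p j := by
    intro j
    by_cases hj : j = i
    · refine ⟨pullback (pullback.fst (f j) (p j)) (pullback.fst (g j) (p j)),
        pullback.fst _ _ ≫ pullback.fst _ _, pullback.fst _ _ ≫ pullback.snd _ _,
        pullback.snd _ _ ≫ pullback.snd _ _, inferInstance, fun h => (h hj).elim, ?_, ?_⟩
      · rw [Category.assoc, pullback.condition, Category.assoc]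
      · rw [pullback.condition, Category.assoc, pullback.condition, Category.assoc]
    · refine ⟨pullback (f j) (p j), pullback.fst _ _, pullback.snd _ _, pullback.snd _ _,
        inferInstance, fun _ => rfl, pullback.condition, ?_⟩
      rw [← h j hj, pullback.condition]
  choose X' e f' g' h₁ h₂ h₃ h₄ using this
  exact ⟨X', e, f', g', h₁, h₂, funext h₃, funext h₄⟩

variable {C} in
/-- `h` is the sum of `f` and `g` in some variable. -/
def TupleAdd {V : Type} {X Y : V → C} (f g h : X ⟶ Y) : Prop :=
  ∃ i, h i = f i + g i ∧ ∀ j, j ≠ i → f j = h j ∧ g j = h j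

variable {k C} in
/-- `h` is the `c`-multiple of `f` in some variable. -/
def TupleSmul {V : Type} {X Y : V → C} (c : k) (f h : X ⟶ Y) : Prop :=
  ∃ i, h i = c • f i ∧ ∀ j, j ≠ i → h j = f j

theorem isMultiLinear_iff {V : Type} (G : (V → C)ᵒᵖ ⥤ ModuleCat.{u} k) : IsMultiLinear G ↔
    (∀ {X Y : V → C} (f g h : X ⟶ Y), TupleAdd f g h →
      G.map h.op = G.map f.op + G.map g.op) ∧
    (∀ {X Y : V → C} (c : k) (f h : X ⟶ Y), TupleSmul c f h → G.map h.op = c • G.map f.op) :=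
  ⟨fun hG => ⟨fun f g h ⟨i, h₁, h₂⟩ => hG.map_add i f g h h₁ h₂,
    fun c f h ⟨i, h₁, h₂⟩ => hG.map_smul i c f h h₁ h₂⟩,
    fun hG => ⟨fun i f g h h₁ h₂ => hG.1 f g h ⟨i, h₁, h₂⟩,
      fun i c f h h₁ h₂ => hG.2 c f h ⟨i, h₁, h₂⟩⟩⟩

variable {C} in
theorem TupleAdd.lift {V : Type} {X Y Y' : V → C} {f g h : X ⟶ Y} (H : TupleAdd f g h)
    (p : Y' ⟶ Y) (hp : ∀ j, Epi (p j)) : ∃ (X' : V → C) (e : X' ⟶ X) (f' g' h' : X' ⟶ Y'),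
      (∀ j, Epi (e j)) ∧ TupleAdd f' g' h' ∧
      e ≫ f = f' ≫ p ∧ e ≫ g = g' ≫ p ∧ e ≫ h = h' ≫ p := by
  classical
  obtain ⟨i, h₁, h₂⟩ := H
  obtain ⟨X', e, f', g', h₃, h₄, h₅, h₆⟩ := exists_common_lift C i p hp f g
    (fun j hj => (h₂ j hj).1.trans (h₂ j hj).2.symm)
  refine ⟨X', e, f', g', fun j => if j = i then f' j + g' j else f' j, h₃,
    ⟨i, by simp, fun j hj => ⟨by simp [hj], by simp [hj, h₄ j hj]⟩⟩, h₅, h₆, funext fun j => ?_⟩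
  have e₅ : e j ≫ f j = f' j ≫ p j := congrFun h₅ j
  have e₆ : e j ≫ g j = g' j ≫ p j := congrFun h₆ j
  change e j ≫ h j = (if j = i then f' j + g' j else f' j) ≫ p j
  by_cases hj : j = i
  · subst hj
    rw [h₁, if_pos rfl, Preadditive.comp_add, Preadditive.add_comp, e₅, e₆]
  · rw [if_neg hj, ← e₅, (h₂ j hj).1]

variable {k C} in
theorem TupleSmul.lift {V : Type} {X Y Y' : V → C} {c : k} {f h : X ⟶ Y} (H : TupleSmul c f h)
    (p : Y' ⟶ Y) (hp : ∀ j, Epi (p j)) : ∃ (X' : V → C) (e : X' ⟶ X) (f' h' : X' ⟶ Y'),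
      (∀ j, Epi (e j)) ∧ TupleSmul c f' h' ∧ e ≫ f = f' ≫ p ∧ e ≫ h = h' ≫ p := by
  classical
  obtain ⟨i, h₁, h₂⟩ := H
  obtain ⟨X', e, f', h₃, h₅⟩ := exists_lift p hp f
  refine ⟨X', e, f', fun j => if j = i then c • f' j else f' j, h₃,
    ⟨i, by simp, fun j hj => by simp [hj]⟩, h₅, funext fun j => ?_⟩
  have e₅ : e j ≫ f j = f' j ≫ p j := congrFun h₅ j
  change e j ≫ h j = (if j = i then c • f' j else f' j) ≫ p j
  by_cases hj : j = i
  · subst hj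
    rw [h₁, if_pos rfl, Linear.comp_smul, Linear.smul_comp, e₅]
  · rw [if_neg hj, ← e₅, h₂ j hj]

/-- Tuples of objects, with tuples of epimorphisms as coverings. -/
def tupleSite (V : Type) : LinSite k (V → C) where
  cov _ _ p := ∀ j, Epi (p j)
  add := TupleAdd
  smul := TupleSmul
  cov_id X j := inferInstanceAs (Epi (𝟙 (X j)))
  cov_comp p q hp hq j := by
    have := hp j
    have := hq j
    exact inferInstanceAs (Epi (p j ≫ q j))
  cov_lift p f hp := exists_lift p hp f
  add_lift p f g h hp H := H.lift p hp
  smul_lift p c f h hp H := H.lift p hp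

variable {k C}

theorem tupleSite_isLin {V : Type} (G : (V → C)ᵒᵖ ⥤ ModuleCat.{u} k) :
    (tupleSite k C V).IsLin G ↔ IsMultiLinear G :=
  ⟨fun hG => (isMultiLinear_iff k C G).2 ⟨hG.map_add, hG.map_smul⟩,
    fun hG => ⟨((isMultiLinear_iff k C G).1 hG).1, ((isMultiLinear_iff k C G).1 hG).2⟩⟩

theorem tupleSite_linDescent {V : Type} [Fintype V] (G : (V → C)ᵒᵖ ⥤ ModuleCat.{u} k) :
    (tupleSite k C V).linDescent G ↔ IsMultiSheaf G :=
  ⟨fun hG => ((tupleSite_isLin G).1 hG.1).isMultiSheaf hG.2.injective hG.2.descent,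
    fun hG => ⟨(tupleSite_isLin G).2 hG.toIsMultiLinear, hG.injective, hG.descent⟩⟩

variable (k C)

/-- The polylinear functors `(C^opp)^V → k-Vect` which are left exact in each variable. -/
def multiSheaf (V : Type) : ObjectProperty ((V → C)ᵒᵖ ⥤ ModuleCat.{u} k) :=
  fun G => IsMultiSheaf G

/-- `Shv(C^V)`. -/
abbrev Shv (V : Type) : Type (u + 1) := (multiSheaf k C V).FullSubcategory

/-- `Shv(C^V)` as linear sheaves on the site of tuples. -/
def shvToLinDescent (V : Type) [Fintype V] :
    Shv k C V ⥤ (tupleSite k C V).linDescent.FullSubcategory :=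
  ObjectProperty.ιOfLE fun G hG => (tupleSite_linDescent G).2 hG

instance (V : Type) [Fintype V] : (shvToLinDescent k C V).Faithful :=
  inferInstanceAs (ObjectProperty.ιOfLE _).Faithful

instance (V : Type) [Fintype V] : (shvToLinDescent k C V).Full :=
  inferInstanceAs (ObjectProperty.ιOfLE _).Full

instance (V : Type) [Fintype V] : (shvToLinDescent k C V).EssSurj where
  mem_essImage F := ⟨⟨F.obj, (tupleSite_linDescent F.obj).1 F.property⟩, ⟨Iso.refl _⟩⟩

instance (V : Type) [Fintype V] : (shvToLinDescent k C V).IsEquivalence where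

instance (V : Type) [Fintype V] : HasFiniteProducts (Shv k C V) where
  out _ := Adjunction.hasLimitsOfShape_of_equivalence (shvToLinDescent k C V)

noncomputable instance (V : Type) [Fintype V] : Abelian (Shv k C V) :=
  abelianOfEquivalence (shvToLinDescent k C V)

end Tuples

section TensExact

variable {C : Type u} [Category.{u} C] [Abelian C] [MonoidalCategory C] [MonoidalPreadditive C]
  [∀ X : C, PreservesFiniteColimits (tensorLeft X)]
  [∀ X : C, PreservesFiniteColimits (tensorRight X)] {ι : Type}

theorem tensMap_epi {X Y : ι → C} (p : X ⟶ Y) (hp : ∀ i, Epi (p i)) :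
    ∀ l, Epi (tensMap p l)
  | [] => inferInstanceAs (Epi (𝟙 (𝟙_ C)))
  | i :: l => by
    have := hp i
    have := tensMap_epi p hp l
    have h₁ : Epi ((tensorRight (tens X l)).map (p i)) := inferInstance
    have h₂ : Epi ((tensorLeft (Y i)).map (tensMap p l)) := inferInstance
    rw [tensMap_cons, MonoidalCategory.tensorHom_def]
    exact epi_comp' h₁ h₂

theorem tensMap_isIso {X Y : ι → C} (p : X ⟶ Y) :
    ∀ l, (∀ i ∈ l, IsIso (p i)) → IsIso (tensMap p l)
  | [], _ => inferInstanceAs (IsIso (𝟙 (𝟙_ C)))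
  | i :: l, h => by
    have := h i (by simp)
    have := tensMap_isIso p l (fun j hj => h j (by simp [hj]))
    rw [tensMap_cons]
    infer_instance

theorem exact_of_isIso {X Y Z X' Y' Z' : C} {q : X ⟶ Y} {p : Y ⟶ Z} (w : q ≫ p = 0)
    (h : (ShortComplex.mk q p w).Exact) {q' : X' ⟶ Y'} {p' : Y' ⟶ Z'} (a : X ≅ X') (b : Y ≅ Y')
    (c : Z ≅ Z') (h₁ : a.hom ≫ q' = q ≫ b.hom) (h₂ : b.hom ≫ p' = p ≫ c.hom) :
    ∃ w' : q' ≫ p' = 0, (ShortComplex.mk q' p' w').Exact := by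
  have w' : q' ≫ p' = 0 := by
    rw [← cancel_epi a.hom, reassoc_of% h₁, h₂, reassoc_of% w]
    simp
  exact ⟨w', (ShortComplex.exact_iff_of_iso
    (ShortComplex.isoMk a b c h₁ h₂ : ShortComplex.mk q p w ≅ ShortComplex.mk q' p' w')).1 h⟩

theorem tensMap_exact {X Y Z : ι → C} (q : X ⟶ Y) (p : Y ⟶ Z) (i : ι) (w : q i ≫ p i = 0)
    (hw : (ShortComplex.mk (q i) (p i) w).Exact) (hp : Epi (p i))
    (h : ∀ j, j ≠ i → IsIso (q j) ∧ IsIso (p j)) : ∀ (l : List ι), i ∈ l → l.Nodup →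
    ∃ w' : tensMap q l ≫ tensMap p l = 0, (ShortComplex.mk _ _ w').Exact
  | [], hi, _ => (List.not_mem_nil hi).elim
  | j :: l, hi, hl => by
    by_cases hj : j = i
    · subst hj
      have hj' : j ∉ l := (List.nodup_cons.1 hl).1
      have hq := tensMap_isIso q l (fun m hm => (h m (fun h => hj' (h ▸ hm))).1)
      have hp' := tensMap_isIso p l (fun m hm => (h m (fun h => hj' (h ▸ hm))).2)
      have := hw.map_of_epi_of_preservesCokernel (tensorRight (tens X l)) inferInstance
        inferInstance
      refine exact_of_isIso _ this (Iso.refl _) (whiskerLeftIso _ (asIso (tensMap q l)))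
        (whiskerLeftIso _ (asIso (tensMap q l ≫ tensMap p l))) ?_ ?_
      · simp [tensMap_cons, MonoidalCategory.tensorHom_def]
      · simp [tensMap_cons, MonoidalCategory.tensorHom_def, whisker_exchange_assoc]
    · have hi' : i ∈ l := by
        rcases List.mem_cons.1 hi with h | h
        · exact (hj h.symm).elim
        · exact h
      obtain ⟨w', hw'⟩ := tensMap_exact q p i w hw hp h l hi' (List.nodup_cons.1 hl).2
      have hq := (h j hj).1
      have hp₁ := (h j hj).2
      have hp' : Epi (tensMap p l) := tensMap_epi p (fun m => by
        by_cases hm : m = i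
        · subst hm; exact hp
        · have := (h m hm).2; infer_instance) l
      have := hw'.map_of_epi_of_preservesCokernel (tensorLeft (X j)) inferInstance inferInstance
      refine exact_of_isIso _ this (Iso.refl _) (whiskerRightIso (asIso (q j)) _)
        (whiskerRightIso (asIso (q j ≫ p j)) _) ?_ ?_
      · simp [tensMap_cons, MonoidalCategory.tensorHom_def']
      · simp [tensMap_cons, MonoidalCategory.tensorHom_def', ← whisker_exchange_assoc]

end TensExact

section Fibers

theorem CyclicCat.concat_nodup {a b : CyclicCat} (f : a ⟶ b) :
    (concat (CyclicCat.fiber f) (List.finRange b.len)).Nodup :=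
  (Hom.rotated f).perm.nodup_iff.2 (List.nodup_finRange _)

theorem CyclicCat.fiber_nodup {a b : CyclicCat} (f : a ⟶ b) (v : b.V) :
    (CyclicCat.fiber f v).Nodup := by
  have := concat_nodup f
  rw [concat_eq_flatMap, List.nodup_flatMap] at this
  exact this.1 v (List.mem_finRange v)

theorem CyclicCat.exists_fiber {a b : CyclicCat} (f : a ⟶ b) (i : a.V) :
    ∃ v, i ∈ CyclicCat.fiber f v ∧ ∀ v', v' ≠ v → i ∉ CyclicCat.fiber f v' := by
  have h₁ := concat_nodup f
  have h₂ : i ∈ concat (CyclicCat.fiber f) (List.finRange b.len) :=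
    (Hom.rotated f).perm.mem_iff.2 (List.mem_finRange i)
  rw [concat_eq_flatMap] at h₁ h₂
  obtain ⟨v, -, hv⟩ := List.mem_flatMap.1 h₂
  refine ⟨v, hv, fun v' hv' hi => ?_⟩
  rw [List.nodup_flatMap] at h₁
  have hs : Std.Symm (Function.onFun List.Disjoint (CyclicCat.fiber f)) := ⟨fun _ _ h => h.symm⟩
  have := (List.pairwise_iff_coe_toFinset_pairwise (List.nodup_finRange _)).2 h₁.2
  exact this (by simp) (by simp) hv' hi hv

end Fibers

section SharpSite

variable (k : Type u) [Field k] (C : Type u) [Category.{u} C] [Abelian C] [Linear k C]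
  [MonoidalCategory C] [MonoidalPreadditive C]
  [∀ X : C, PreservesFiniteColimits (tensorLeft X)]
  [∀ X : C, PreservesFiniteColimits (tensorRight X)]

namespace SharpOp

variable {C}

/-- Componentwise epimorphisms in the fibres. -/
inductive Cov : ∀ {X Y : SharpOp C}, (X ⟶ Y) → Prop
  | mk (a : CyclicCat) {X Y : a.V → C} (p : X ⟶ Y) (hp : ∀ j, Epi (p j)) : Cov ((incl C a).map p)

/-- Additivity relations in the fibres. -/
inductive Add : ∀ {X Y : SharpOp C}, (X ⟶ Y) → (X ⟶ Y) → (X ⟶ Y) → Prop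
  | mk (a : CyclicCat) {X Y : a.V → C} (f g h : X ⟶ Y) (H : TupleAdd f g h) :
      Add ((incl C a).map f) ((incl C a).map g) ((incl C a).map h)

variable {k} in
/-- Linearity relations in the fibres. -/
inductive Smul : ∀ {X Y : SharpOp C}, k → (X ⟶ Y) → (X ⟶ Y) → Prop
  | mk (a : CyclicCat) {X Y : a.V → C} (c : k) (f h : X ⟶ Y) (H : TupleSmul c f h) :
      Smul c ((incl C a).map f) ((incl C a).map h)

theorem exists_cov {x y : SharpOp C} (p : x ⟶ y) (hp : Cov p) (a : CyclicCat) (Y : a.V → C)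
    (h : y = (incl C a).obj Y) :
    ∃ (X : a.V → C) (e : x = (incl C a).obj X) (q : X ⟶ Y), (∀ j, Epi (q j)) ∧
      p ≫ eqToHom h = eqToHom e ≫ (incl C a).map q := by
  cases hp with
  | mk b p hp =>
    obtain ⟨rfl, h'⟩ := SharpOp.mk.inj h
    cases eq_of_heq h'
    exact ⟨_, rfl, p, hp, by simp⟩

theorem Cov.elim {a : CyclicCat} {Y : a.V → C} {x : SharpOp C} {p : x ⟶ (incl C a).obj Y}
    (hp : Cov p) {P : ∀ x : SharpOp C, (x ⟶ (incl C a).obj Y) → Prop}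
    (h : ∀ (X : a.V → C) (q : X ⟶ Y), (∀ j, Epi (q j)) → P _ ((incl C a).map q)) : P x p := by
  obtain ⟨X, rfl, q, hq, e⟩ := exists_cov p hp a Y rfl
  obtain rfl : p = (incl C a).map q := by simpa using e
  exact h X q hq

theorem incl_sq {a : CyclicCat} {W X Y Z : a.V → C} {e : W ⟶ X} {f : X ⟶ Z} {f' : W ⟶ Y}
    {p : Y ⟶ Z} (h : e ≫ f = f' ≫ p) :
    (incl C a).map e ≫ (incl C a).map f = (incl C a).map f' ≫ (incl C a).map p := by
  rw [← Functor.map_comp, h, Functor.map_comp]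

theorem incl_comp {z : SharpOp C} {a : CyclicCat} {X Y : a.V → C} {Z' : z.base.V → C}
    (f : z ⟶ (incl C a).obj Y) (p : X ⟶ Y) (e : Z' ⟶ z.fib)
    (φ : Z' ⟶ (push C (Hom.base f)).obj X)
    (h : e ≫ Hom.fib f = φ ≫ (push C (Hom.base f)).map p) :
    (incl C z.base).map e ≫ f = mk' (Hom.base f) φ ≫ (incl C a).map p :=
  (incl_comp_mk' (Hom.base f) (Hom.fib f) e).trans
    ((congrArg (mk' _) h).trans (mk'_comp_incl (Hom.base f) φ p).symm)

variable (C) in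
/-- The site structure on `SharpOp C`. -/
def site : LinSite k (SharpOp C) where
  cov _ _ p := Cov p
  add := Add
  smul := Smul
  cov_id x := by
    have := Cov.mk x.base (𝟙 x.fib) (fun j => inferInstanceAs (Epi (𝟙 (x.fib j))))
    rwa [CategoryTheory.Functor.map_id] at this
  cov_comp p q hp hq := by
    cases hq with
    | mk a q hq =>
      refine hp.elim (P := fun x p => Cov (p ≫ (incl C a).map q)) fun X p hp' => ?_
      have := Cov.mk a (p ≫ q) (fun j => by
        have := hp' j
        have := hq j
        exact inferInstanceAs (Epi (p j ≫ q j)))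
      rwa [Functor.map_comp] at this
  cov_lift p f hp := by
    cases hp with
    | mk a p hp =>
      obtain ⟨Z', e, φ, he, h⟩ := exists_lift ((push C (Hom.base f)).map p)
        (fun j => tensMap_epi p hp _) (Hom.fib f)
      exact ⟨⟨_, Z'⟩, (incl C _).map e, mk' _ φ, Cov.mk _ e he, incl_comp f p e φ h⟩
  add_lift p f g h hp H := by
    cases H with
    | mk a f g h H =>
      refine hp.elim (P := fun x p => ∃ (x' : SharpOp C) (e : x' ⟶ _) (f' g' h' : x' ⟶ x),
        Cov e ∧ Add f' g' h' ∧ e ≫ (incl C a).map f = f' ≫ p ∧ e ≫ (incl C a).map g = g' ≫ p ∧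
          e ≫ (incl C a).map h = h' ≫ p) fun Y' p hp' => ?_
      obtain ⟨X', e, f', g', h', he, H', h₁, h₂, h₃⟩ := H.lift p hp'
      exact ⟨(incl C a).obj X', (incl C a).map e, (incl C a).map f', (incl C a).map g', (incl C a).map h',
        Cov.mk _ e he, Add.mk _ _ _ _ H', incl_sq h₁,
        incl_sq h₂, incl_sq h₃⟩
  smul_lift p c f h hp H := by
    cases H with
    | mk a c f h H =>
      refine hp.elim (P := fun x p => ∃ (x' : SharpOp C) (e : x' ⟶ _) (f' h' : x' ⟶ x),
        Cov e ∧ Smul c f' h' ∧ e ≫ (incl C a).map f = f' ≫ p ∧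
          e ≫ (incl C a).map h = h' ≫ p) fun Y' p hp' => ?_
      obtain ⟨X', e, f', h', he, H', h₁, h₃⟩ := H.lift p hp'
      exact ⟨(incl C a).obj X', (incl C a).map e, (incl C a).map f', (incl C a).map h',
        Cov.mk _ e he, Smul.mk _ _ _ _ H', incl_sq h₁,
        incl_sq h₃⟩

variable {k} {E : (SharpOp C)ᵒᵖ ⥤ ModuleCat.{u} k}

theorem site_isLin : (site k C).IsLin E ↔ ∀ a, IsMultiLinear ((incl C a).op ⋙ E) := by
  constructor
  · intro h a
    rw [isMultiLinear_iff]
    exact ⟨fun f g h' H => h.map_add _ _ _ (Add.mk a f g h' H),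
      fun c f h' H => h.map_smul _ _ _ (Smul.mk a c f h' H)⟩
  · intro h
    constructor
    · intro x y f g h' H
      cases H with
      | mk a f g h' H => exact ((isMultiLinear_iff _ _ _).1 (h a)).1 _ _ _ H
    · intro x y c f h' H
      cases H with
      | mk a c f h' H => exact ((isMultiLinear_iff _ _ _).1 (h a)).2 _ _ _ H

theorem site_linDescent :
    (site k C).linDescent E ↔ ∀ a, IsMultiSheaf ((incl C a).op ⋙ E) := by
  constructor
  · rintro ⟨h₁, h₂⟩ a
    rw [site_isLin] at h₁
    have sep : ∀ (b : CyclicCat) {M N : b.V → C} (p : M ⟶ N), (∀ j, Epi (p j)) →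
        Function.Injective (((incl C b).op ⋙ E).map p.op).hom :=
      fun b M N p hp => h₂.injective _ (Cov.mk b p hp)
    refine ⟨h₁ a, fun i X Y Z q p w hw hp h => ?_⟩
    have hp' : ∀ j, Epi (p j) := fun j => by
      by_cases hj : j = i
      · subst hj; exact hp
      · have := (h j hj).2; infer_instance
    refine ⟨sep a p hp', fun s hs => h₂.descent _ (Cov.mk a p hp') s ?_⟩
    suffices key : ∀ (c : CyclicCat) (T : c.V → C) (f g : a ⟶ c) (φ : T ⟶ (push C f).obj Y)
        (ψ : T ⟶ (push C g).obj Y), mk' f φ ≫ (incl C a).map p = mk' g ψ ≫ (incl C a).map p →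
        (E.map (mk' f φ).op).hom s = (E.map (mk' g ψ).op).hom s from
      fun {z} A B hAB => key z.base z.fib (Hom.base A) (Hom.base B) (Hom.fib A) (Hom.fib B) hAB
    intro c T f g φ ψ hAB
    rw [mk'_comp_incl, mk'_comp_incl] at hAB
    obtain rfl : f = g := congrArg Hom.base hAB
    have hAB' : φ ≫ (push C f).map p = ψ ≫ (push C f).map p := by
      injection hAB
    obtain ⟨v, hv, hv'⟩ := CyclicCat.exists_fiber f i
    obtain ⟨w', hw'⟩ := tensMap_exact q p i w hw hp h _ hv (CyclicCat.fiber_nodup f v)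
    rw [mk'_eq f φ, mk'_eq f ψ]
    refine (LinSite.map_comp_apply _ _ _).trans (Eq.trans ?_ (LinSite.map_comp_apply _ _ _).symm)
    refine (h₁ c).kill (sep c) v ((push C f).map q) ((push C f).map p) w' hw' (fun j hj => ⟨?_, ?_⟩)
      _ ?_ φ ψ hAB'
    · exact tensMap_isIso q _ (fun m hm => (h m (fun e => hv' j hj (e ▸ hm))).1)
    · exact tensMap_isIso p _ (fun m hm => (h m (fun e => hv' j hj (e ▸ hm))).2)
    · change (E.map ((incl C c).map ((push C f).map q)).op).hom ((E.map (cart f Y).op).hom s) = 0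
      refine (LinSite.map_comp_apply _ _ _).symm.trans ?_
      rw [← cart_comp_incl]
      refine (LinSite.map_comp_apply _ _ _).trans ?_
      exact (congrArg _ hs).trans (map_zero _)
  · intro h
    refine ⟨site_isLin.2 fun a => (h a).toIsMultiLinear, ?_, ?_⟩
    · intro x y p hp
      cases hp with
      | mk a p hp => exact (h a).injective p hp
    · intro x y p hp s hs
      cases hp with
      | mk a p hp =>
        exact (h a).descent p hp s (fun f g hfg => hs _ _ (incl_sq hfg))

end SharpOp

/-- The functors `C_#^opp → k-Vect` whose restriction to each `(C^opp)^n` is a sheaf. -/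
def sharpSheaf : ObjectProperty ((SharpOp C)ᵒᵖ ⥤ ModuleCat.{u} k) :=
  fun E => ∀ a, IsMultiSheaf ((SharpOp.incl C a).op ⋙ E)

/-- `Shv(C_#)`. -/
abbrev ShvSharp : Type (u + 1) := (sharpSheaf k C).FullSubcategory

/-- `Shv(C_#)` as linear sheaves on a site. -/
def shvSharpToLinDescent : ShvSharp k C ⥤ (SharpOp.site k C).linDescent.FullSubcategory :=
  ObjectProperty.ιOfLE fun _ hG => SharpOp.site_linDescent.2 hG

instance : (shvSharpToLinDescent k C).Faithful :=
  inferInstanceAs (ObjectProperty.ιOfLE _).Faithful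

instance : (shvSharpToLinDescent k C).Full :=
  inferInstanceAs (ObjectProperty.ιOfLE _).Full

instance : (shvSharpToLinDescent k C).EssSurj where
  mem_essImage F := ⟨⟨F.obj, SharpOp.site_linDescent.1 F.property⟩, ⟨Iso.refl _⟩⟩

instance : (shvSharpToLinDescent k C).IsEquivalence where

instance : HasFiniteProducts (ShvSharp k C) where
  out _ := Adjunction.hasLimitsOfShape_of_equivalence (shvSharpToLinDescent k C)

noncomputable instance : Abelian (ShvSharp k C) :=
  abelianOfEquivalence (shvSharpToLinDescent k C)

end SharpSite

section Reflect

variable {k : Type u} [Field k] {C : Type u} [Category.{u} C] [Abelian C] [Linear k C] {V : Type}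

theorem TupleAdd.precomp {X Y Z : V → C} {f g h : X ⟶ Y} (H : TupleAdd f g h) (e : Z ⟶ X) :
    TupleAdd (e ≫ f) (e ≫ g) (e ≫ h) := by
  obtain ⟨i, h₁, h₂⟩ := H
  refine ⟨i, ?_, fun j hj => ⟨?_, ?_⟩⟩
  · change e i ≫ h i = e i ≫ f i + e i ≫ g i
    rw [h₁, Preadditive.comp_add]
  · exact congrArg (e j ≫ ·) (h₂ j hj).1
  · exact congrArg (e j ≫ ·) (h₂ j hj).2

theorem TupleSmul.precomp {X Y Z : V → C} {c : k} {f h : X ⟶ Y} (H : TupleSmul c f h)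
    (e : Z ⟶ X) : TupleSmul c (e ≫ f) (e ≫ h) := by
  obtain ⟨i, h₁, h₂⟩ := H
  refine ⟨i, ?_, fun j hj => ?_⟩
  · change e i ≫ h i = c • (e i ≫ f i)
    rw [h₁, Linear.comp_smul]
  · exact congrArg (e j ≫ ·) (h₂ j hj)

/-- The span of the obstructions to polylinearity. -/
def linRel (G : (V → C)ᵒᵖ ⥤ ModuleCat.{u} k) (X : (V → C)ᵒᵖ) : Submodule k (G.obj X) :=
  Submodule.span k
    ({z | ∃ (Y : V → C) (f g h : X.unop ⟶ Y) (_ : TupleAdd f g h) (s : G.obj (.op Y)),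
        z = (G.map h.op).hom s - ((G.map f.op).hom s + (G.map g.op).hom s)} ∪
      {z | ∃ (Y : V → C) (c : k) (f h : X.unop ⟶ Y) (_ : TupleSmul c f h) (s : G.obj (.op Y)),
        z = (G.map h.op).hom s - c • (G.map f.op).hom s})

theorem linRel_le_comap (G : (V → C)ᵒᵖ ⥤ ModuleCat.{u} k) {X Y : (V → C)ᵒᵖ} (e : X ⟶ Y) :
    linRel G X ≤ (linRel G Y).comap (G.map e).hom := by
  have aux : ∀ {Z : V → C} (f : X.unop ⟶ Z) (s : G.obj (.op Z)),
      (G.map e).hom ((G.map f.op).hom s) = (G.map (e.unop ≫ f).op).hom s := fun f s =>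
    (LinSite.map_comp_apply e.unop f s).symm
  refine Submodule.span_le.2 ?_
  rintro z (⟨Z, f, g, h, H, s, rfl⟩ | ⟨Z, c, f, h, H, s, rfl⟩)
  · refine Submodule.subset_span (Or.inl ⟨Z, _, _, _, H.precomp e.unop, s, ?_⟩)
    rw [← aux, ← aux, ← aux, map_sub, map_add]
  · refine Submodule.subset_span (Or.inr ⟨Z, c, _, _, H.precomp e.unop, s, ?_⟩)
    rw [← aux, ← aux, map_sub, map_smul]

/-- The largest polylinear quotient of a presheaf. -/
def linearize (G : (V → C)ᵒᵖ ⥤ ModuleCat.{u} k) : (V → C)ᵒᵖ ⥤ ModuleCat.{u} k where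
  obj X := ModuleCat.of k (G.obj X ⧸ linRel G X)
  map e := ModuleCat.ofHom (Submodule.mapQ _ _ (G.map e).hom (linRel_le_comap G e))
  map_id X := by
    ext s
    change Submodule.Quotient.mk ((G.map (𝟙 X)).hom s) = Submodule.Quotient.mk s
    simp
  map_comp f g := by
    ext s
    change Submodule.Quotient.mk ((G.map (f ≫ g)).hom s) =
      Submodule.Quotient.mk ((G.map g).hom ((G.map f).hom s))
    simp

/-- The projection to the largest polylinear quotient. -/
def toLinearize (G : (V → C)ᵒᵖ ⥤ ModuleCat.{u} k) : G ⟶ linearize G where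
  app X := ModuleCat.ofHom (linRel G X).mkQ
  naturality _ _ _ := rfl

theorem linearize_isMultiLinear (G : (V → C)ᵒᵖ ⥤ ModuleCat.{u} k) :
    IsMultiLinear (linearize G) := by
  rw [isMultiLinear_iff]
  refine ⟨fun {X Y} f g h H => ?_, fun {X Y} c f h H => ?_⟩
  · refine ModuleCat.hom_ext (Submodule.linearMap_qext _ (LinearMap.ext fun s => ?_))
    exact (Submodule.Quotient.eq _).2 (Submodule.subset_span (Or.inl ⟨Y, f, g, h, H, s, rfl⟩))
  · refine ModuleCat.hom_ext (Submodule.linearMap_qext _ (LinearMap.ext fun s => ?_))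
    exact (Submodule.Quotient.eq _).2 (Submodule.subset_span (Or.inr ⟨Y, c, f, h, H, s, rfl⟩))

theorem linearize_hom_ext {G H : (V → C)ᵒᵖ ⥤ ModuleCat.{u} k} {f g : linearize G ⟶ H}
    (h : toLinearize G ≫ f = toLinearize G ≫ g) : f = g := by
  refine NatTrans.ext (funext fun X => ModuleCat.hom_ext
    (Submodule.linearMap_qext _ (LinearMap.ext fun s => ?_)))
  exact ConcreteCategory.congr_hom (congr_app h X) s

/-- The universal property of `linearize`. -/
def linearizeDesc {G H : (V → C)ᵒᵖ ⥤ ModuleCat.{u} k} (f : G ⟶ H) (hH : IsMultiLinear H) :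
    linearize G ⟶ H where
  app X := ModuleCat.ofHom (Submodule.liftQ _ (f.app X).hom (by
    have nat : ∀ {Z : V → C} (e : X.unop ⟶ Z) (s : G.obj (.op Z)),
        (f.app X).hom ((G.map e.op).hom s) = (H.map e.op).hom ((f.app _).hom s) := fun e s =>
      ConcreteCategory.congr_hom (f.naturality e.op) s
    rw [isMultiLinear_iff] at hH
    refine Submodule.span_le.2 ?_
    rintro z (⟨Z, f, g, h, T, s, rfl⟩ | ⟨Z, c, f, h, T, s, rfl⟩)
    · simp only [SetLike.mem_coe, LinearMap.mem_ker]
      rw [map_sub, map_add, nat, nat, nat, hH.1 _ _ _ T]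
      exact sub_self _
    · simp only [SetLike.mem_coe, LinearMap.mem_ker]
      rw [map_sub, map_smul, nat, nat, hH.2 _ _ _ T]
      exact sub_self _))
  naturality X Y e := by
    refine ModuleCat.hom_ext (Submodule.linearMap_qext _ (LinearMap.ext fun s => ?_))
    exact ConcreteCategory.congr_hom (f.naturality e) s

theorem toLinearize_desc {G H : (V → C)ᵒᵖ ⥤ ModuleCat.{u} k} (f : G ⟶ H) (hH : IsMultiLinear H) :
    toLinearize G ≫ linearizeDesc f hH = f := rfl

variable [Fintype V]

theorem sheafify_isMultiSheaf (G : (V → C)ᵒᵖ ⥤ ModuleCat.{u} k) (hG : IsMultiLinear G) :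
    IsMultiSheaf (sheafify (tupleSite k C V).topology G) := by
  have h := LinSite.isDescent_of_isSheaf (S := tupleSite k C V) 
    ((presheafToSheaf (tupleSite k C V).topology (ModuleCat.{u} k)).obj G).property
  have : Presheaf.IsLocallySurjective (tupleSite k C V).topology
    (toSheafify (tupleSite k C V).topology G) := Presheaf.isLocallySurjective_toSheafify' _ _
  exact (tupleSite_linDescent _).1 ⟨LinSite.IsLin.of_locallySurjective
    ((tupleSite_isLin G).2 hG) h.injective (toSheafify _ G), h⟩

/-- The polylinear sheaf associated to a presheaf. -/
noncomputable def reflectObj (G : (V → C)ᵒᵖ ⥤ ModuleCat.{u} k) : Shv k C V :=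
  ⟨sheafify (tupleSite k C V).topology (linearize G),
    sheafify_isMultiSheaf _ (linearize_isMultiLinear G)⟩

/-- The unit of `reflectObj`. -/
noncomputable def toReflect (G : (V → C)ᵒᵖ ⥤ ModuleCat.{u} k) : G ⟶ (reflectObj G).obj :=
  toLinearize G ≫ toSheafify (tupleSite k C V).topology (linearize G)

theorem toReflect_comp {G H : (V → C)ᵒᵖ ⥤ ModuleCat.{u} k} (f : (reflectObj G).obj ⟶ H) :
    toReflect G ≫ f =
      toLinearize G ≫ toSheafify (tupleSite k C V).topology (linearize G) ≫ f :=
  Category.assoc _ _ _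

theorem Shv.isSheaf (E : Shv k C V) : Presheaf.IsSheaf (tupleSite k C V).topology E.obj :=
  ((tupleSite_linDescent E.obj).2 E.property).2.isSheaf

/-- The universal property of `reflectObj`. -/
noncomputable def reflectEquiv (G : (V → C)ᵒᵖ ⥤ ModuleCat.{u} k) (E : Shv k C V) :
    (reflectObj G ⟶ E) ≃ (G ⟶ E.obj) where
  toFun f := toReflect G ≫ f.hom
  invFun f := ⟨sheafifyLift _ (linearizeDesc f E.property.toIsMultiLinear) E.isSheaf⟩
  left_inv f := by
    ext1
    refine sheafify_hom_ext _ _ _ E.isSheaf (linearize_hom_ext ?_)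
    rw [toSheafify_sheafifyLift, toLinearize_desc]
    exact toReflect_comp f.hom
  right_inv f := by
    refine (toReflect_comp _).trans ?_
    rw [toSheafify_sheafifyLift, toLinearize_desc]

variable (k C V)

/-- The functor sending a presheaf to the associated polylinear sheaf. -/
noncomputable def reflect : ((V → C)ᵒᵖ ⥤ ModuleCat.{u} k) ⥤ Shv k C V :=
  Adjunction.leftAdjointOfEquiv (G := (multiSheaf k C V).ι) (fun G E => reflectEquiv G E)
    (fun _ _ _ _ _ => by simp [reflectEquiv])

/-- `reflect` is left adjoint to the inclusion. -/
noncomputable def reflectAdj : reflect k C V ⊣ (multiSheaf k C V).ι :=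
  Adjunction.adjunctionOfEquivLeft (G := (multiSheaf k C V).ι) (fun G E => reflectEquiv G E)
    (fun _ _ _ _ _ => by simp [reflectEquiv])

end Reflect

section Push

variable {C : Type u} [Category.{u} C] [Abelian C] [MonoidalCategory C] [MonoidalPreadditive C]
  {ι : Type}

theorem tensMap_congr {X Y : ι → C} (f g : X ⟶ Y) : ∀ l : List ι, (∀ j ∈ l, f j = g j) →
    tensMap f l = tensMap g l
  | [], _ => rfl
  | j :: l, h => by
    rw [tensMap_cons, tensMap_cons, h j (by simp), tensMap_congr f g l (fun j hj => h j (by simp [hj]))]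

theorem tensMap_add {X Y : ι → C} (i : ι) (f g h : X ⟶ Y) (h₁ : h i = f i + g i)
    (h₂ : ∀ j, j ≠ i → f j = h j ∧ g j = h j) : ∀ l : List ι, i ∈ l → l.Nodup →
    tensMap h l = tensMap f l + tensMap g l
  | [], hi, _ => (List.not_mem_nil hi).elim
  | j :: l, hi, hl => by
    by_cases hj : j = i
    · subst hj
      have hj' : j ∉ l := (List.nodup_cons.1 hl).1
      simp only [tensMap_cons]
      rw [tensMap_congr f h l (fun m hm => (h₂ m (fun e => hj' (e ▸ hm))).1),
        tensMap_congr g h l (fun m hm => (h₂ m (fun e => hj' (e ▸ hm))).2), h₁,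
        MonoidalPreadditive.add_tensor]
    · have hi' : i ∈ l := by
        rcases List.mem_cons.1 hi with h | h
        · exact (hj h.symm).elim
        · exact h
      simp only [tensMap_cons]
      rw [tensMap_add i f g h h₁ h₂ l hi' (List.nodup_cons.1 hl).2, (h₂ j hj).1, (h₂ j hj).2,
        MonoidalPreadditive.tensor_add]

theorem tensMap_smul {k : Type u} [Field k] [Linear k C] [MonoidalLinear k C]
    {X Y : ι → C} (i : ι) (c : k) (f h : X ⟶ Y) (h₁ : h i = c • f i)
    (h₂ : ∀ j, j ≠ i → h j = f j) : ∀ l : List ι, i ∈ l → l.Nodup →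
    tensMap h l = c • tensMap f l
  | [], hi, _ => (List.not_mem_nil hi).elim
  | j :: l, hi, hl => by
    by_cases hj : j = i
    · subst hj
      have hj' : j ∉ l := (List.nodup_cons.1 hl).1
      simp only [tensMap_cons]
      rw [tensMap_congr h f l (fun m hm => h₂ m (fun e => hj' (e ▸ hm))), h₁,
        MonoidalCategory.tensorHom_def, MonoidalCategory.tensorHom_def,
        MonoidalLinear.smul_whiskerRight, Linear.smul_comp]
    · have hi' : i ∈ l := by
        rcases List.mem_cons.1 hi with h | h
        · exact (hj h.symm).elim
        · exact h
      simp only [tensMap_cons]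
      rw [tensMap_smul i c f h h₁ h₂ l hi' (List.nodup_cons.1 hl).2, h₂ j hj,
        MonoidalCategory.tensorHom_def, MonoidalCategory.tensorHom_def,
        MonoidalLinear.whiskerLeft_smul, Linear.comp_smul]

end Push

section Shriek

variable (k : Type u) [Field k] {C : Type u} [Category.{u} C] [Abelian C] [Linear k C]
  [MonoidalCategory C] [MonoidalPreadditive C] [MonoidalLinear k C]
  [∀ X : C, PreservesFiniteColimits (tensorLeft X)]
  [∀ X : C, PreservesFiniteColimits (tensorRight X)] {a b : CyclicCat} (f : a ⟶ b)

variable {k} in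
theorem push_isMultiSheaf {G : (b.V → C)ᵒᵖ ⥤ ModuleCat.{u} k} (hG : IsMultiSheaf G) :
    IsMultiSheaf ((push C f).op ⋙ G) where
  map_add i u v w h₁ h₂ := by
    obtain ⟨x, hx, hx'⟩ := CyclicCat.exists_fiber f i
    refine hG.map_add x ((push C f).map u) ((push C f).map v) ((push C f).map w)
      (tensMap_add i u v w h₁ h₂ _ hx (CyclicCat.fiber_nodup f x)) fun y hy => ⟨?_, ?_⟩
    · exact tensMap_congr _ _ _ fun j hj => (h₂ j fun e => hx' y hy (e ▸ hj)).1
    · exact tensMap_congr _ _ _ fun j hj => (h₂ j fun e => hx' y hy (e ▸ hj)).2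
  map_smul i c u w h₁ h₂ := by
    obtain ⟨x, hx, hx'⟩ := CyclicCat.exists_fiber f i
    refine hG.map_smul x c ((push C f).map u) ((push C f).map w)
      (tensMap_smul i c u w h₁ h₂ _ hx (CyclicCat.fiber_nodup f x)) fun y hy => ?_
    exact tensMap_congr _ _ _ fun j hj => h₂ j fun e => hx' y hy (e ▸ hj)
  exact i X Y Z q p w hw hp h := by
    obtain ⟨x, hx, hx'⟩ := CyclicCat.exists_fiber f i
    obtain ⟨w', hw'⟩ := tensMap_exact q p i w hw hp h _ hx (CyclicCat.fiber_nodup f x)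
    have hp' : ∀ j, Epi (p j) := fun j => by
      by_cases hj : j = i
      · subst hj; exact hp
      · have := (h j hj).2; infer_instance
    exact hG.exact x ((push C f).map q) ((push C f).map p) w' hw' (tensMap_epi p hp' _)
      fun y hy => ⟨tensMap_isIso q _ fun j hj => (h j fun e => hx' y hy (e ▸ hj)).1,
        tensMap_isIso p _ fun j hj => (h j fun e => hx' y hy (e ▸ hj)).2⟩

/-- The restriction functor `(f_!)^* : Shv(C^{n'}) → Shv(C^n)`. -/
def pull : Shv k C b.V ⥤ Shv k C a.V :=
  ObjectProperty.lift _ ((multiSheaf k C b.V).ι ⋙ (Functor.whiskeringLeft _ _ _).obj (push C f).op)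
    fun E => push_isMultiSheaf f E.property

/-- The functor `(f_!)_! : Shv(C^n) → Shv(C^{n'})`: the left Kan extension along `f_!`, followed by
the reflection onto the polylinear sheaves. It is the left adjoint of `(f_!)^*`, see `shriekAdj`. -/
noncomputable def shriek : Shv k C a.V ⥤ Shv k C b.V :=
  (multiSheaf k C a.V).ι ⋙ (push C f).op.lan ⋙ reflect k C b.V

/-- `(f_!)_!` is left adjoint to `(f_!)^*`. -/
noncomputable def shriekAdj : shriek (C := C) k f ⊣ pull k f :=
  Adjunction.restrictFullyFaithful (iC := (multiSheaf k C a.V).ι) (iD := 𝟭 (Shv k C b.V))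
    (((push C f).op.lanAdjunction (ModuleCat.{u} k)).comp (reflectAdj k C b.V))
    (multiSheaf k C a.V).fullyFaithfulι (Functor.FullyFaithful.id _) (Iso.refl _) (Iso.refl _)

instance : (pull (C := C) k f).Additive where

instance : (shriek (C := C) k f).Additive := (shriekAdj k f).left_adjoint_additive

end Shriek

section Eval

variable (k : Type u) [Field k] (C : Type u) [Category.{u} C] [Abelian C] [Linear k C]
  [MonoidalCategory C] [MonoidalPreadditive C]

/-- The value `E([n])` of an object `E` of `Shv(C_#)`. -/
def evalSharp (a : CyclicCat) : ShvSharp k C ⥤ Shv k C a.V :=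
  ObjectProperty.lift _
    ((sharpSheaf k C).ι ⋙ (Functor.whiskeringLeft _ _ _).obj (SharpOp.incl C a).op)
    fun E => E.property a

variable [MonoidalLinear k C] [∀ X : C, PreservesFiniteColimits (tensorLeft X)]
  [∀ X : C, PreservesFiniteColimits (tensorRight X)]

variable {k C}

/-- The transition map `E(a) ⟶ (f_!)^* E(b)`. -/
def transition (E : ShvSharp k C) {a b : CyclicCat} (f : a ⟶ b) :
    (evalSharp k C a).obj E ⟶ (pull k f).obj ((evalSharp k C b).obj E) :=
  ObjectProperty.homMk
    { app X := E.obj.map (SharpOp.cart f X.unop).op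
      naturality X Y e := by
        change E.obj.map ((SharpOp.incl C a).map e.unop).op ≫ E.obj.map (SharpOp.cart f Y.unop).op =
          E.obj.map (SharpOp.cart f X.unop).op ≫
            E.obj.map ((SharpOp.incl C b).map ((push C f).map e.unop)).op
        rw [← Functor.map_comp, ← Functor.map_comp, ← op_comp, ← op_comp,
          SharpOp.cart_comp_incl] }

/-- The transition map `(f_!)_! E(a) ⟶ E(b)`. -/
noncomputable def transition' (E : ShvSharp k C) {a b : CyclicCat} (f : a ⟶ b) :
    (shriek k f).obj ((evalSharp k C a).obj E) ⟶ (evalSharp k C b).obj E :=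
  ((shriekAdj k f).homEquiv _ _).symm (transition E f)

/-- `E` is a cocartesian section of `Shv(C)_#`. -/
def IsCocartesian (E : ShvSharp k C) : Prop :=
  ∀ ⦃a b : CyclicCat⦄ (f : a ⟶ b), IsIso (transition' E f)

end Eval

section Trace

variable (k : Type u) [Field k] (C : Type u) [Category.{u} C]

/-- The one-element tuples. -/
def CyclicCat.single : C ⥤ (CyclicCat.one.V → C) := Functor.pi' fun _ => 𝟭 C

/-- A right exact `k`-linear trace functor `C → k-Vect`: a functor `C_# → k-Vect` which inverts the
cocartesian morphisms (those `⟨f, φ⟩` for which `φ : f_! X ⟶ Y` is an isomorphism) and whose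
restriction to `C`, the fibre over `[1]`, is `k`-linear and right exact. -/
structure TraceFunctor [Abelian C] [Linear k C] [MonoidalCategory C] where
  functor : Sharp C ⥤ ModuleCat.{u} k
  map_isIso : ∀ {X Y : Sharp C} (f : X ⟶ Y), IsIso (Sharp.Hom.fib f) → IsIso (functor.map f)
  additive : (CyclicCat.single C ⋙ Sharp.incl C CyclicCat.one ⋙ functor).Additive
  linear : (CyclicCat.single C ⋙ Sharp.incl C CyclicCat.one ⋙ functor).Linear k
  rightExact :
    PreservesFiniteColimits (CyclicCat.single C ⋙ Sharp.incl C CyclicCat.one ⋙ functor)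

variable {k C}

section Coend

variable {X : Type u} [Category.{u} X]

/-- The functor `E ↦ E ⊗_X T`: the coend of `E(x) ⊗ T(y)`. -/
noncomputable def coendTensor (T : X ⥤ ModuleCat.{u} k) :
    (Xᵒᵖ ⥤ ModuleCat.{u} k) ⥤ ModuleCat.{u} k :=
  (Functor.whiskeringRight _ _ _).obj
    (curriedTensor (ModuleCat.{u} k) ⋙ (Functor.whiskeringLeft _ _ _).obj T) ⋙ coendFunctor X _

variable (E : Xᵒᵖ ⥤ ModuleCat.{u} k) (T : X ⥤ ModuleCat.{u} k)

/-- The canonical map `E(x) ⊗ T(x) ⟶ E ⊗_X T`. -/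
noncomputable def coendTensor.ι (x : X) : E.obj (.op x) ⊗ T.obj x ⟶ (coendTensor T).obj E :=
  coend.ι (E ⋙ curriedTensor (ModuleCat.{u} k) ⋙ (Functor.whiskeringLeft _ _ _).obj T) x

theorem coendTensor.condition {x y : X} (f : x ⟶ y) :
    E.map f.op ▷ T.obj x ≫ coendTensor.ι E T x = E.obj (.op y) ◁ T.map f ≫ coendTensor.ι E T y :=
  coend.condition (E ⋙ curriedTensor (ModuleCat.{u} k) ⋙ (Functor.whiskeringLeft _ _ _).obj T) f

variable {E T}

theorem coendTensor.hom_ext {M : ModuleCat.{u} k} {f g : (coendTensor T).obj E ⟶ M}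
    (h : ∀ x, coendTensor.ι E T x ≫ f = coendTensor.ι E T x ≫ g) : f = g := coend.hom_ext h

/-- Maps out of `E ⊗_X T`. -/
noncomputable def coendTensor.desc {M : ModuleCat.{u} k} (f : ∀ x, E.obj (.op x) ⊗ T.obj x ⟶ M)
    (hf : ∀ {x y : X} (g : x ⟶ y), E.map g.op ▷ T.obj x ≫ f x = E.obj (.op y) ◁ T.map g ≫ f y) :
    (coendTensor T).obj E ⟶ M := coend.desc f fun _ _ g => hf g

theorem coendTensor.ι_desc {M : ModuleCat.{u} k} (f : ∀ x, E.obj (.op x) ⊗ T.obj x ⟶ M)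
    (hf : ∀ {x y : X} (g : x ⟶ y), E.map g.op ▷ T.obj x ≫ f x = E.obj (.op y) ◁ T.map g ≫ f y)
    (x : X) : coendTensor.ι E T x ≫ coendTensor.desc f hf = f x :=
  coend.ι_desc
    (F := E ⋙ curriedTensor (ModuleCat.{u} k) ⋙ (Functor.whiskeringLeft _ _ _).obj T) f
    (fun _ _ g => hf g) x

theorem coendTensor.ι_map {E' : Xᵒᵖ ⥤ ModuleCat.{u} k} (φ : E ⟶ E') (x : X) :
    coendTensor.ι E T x ≫ (coendTensor T).map φ = φ.app _ ▷ T.obj x ≫ coendTensor.ι E' T x :=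
  coend.ι_map _ x

instance : (coendTensor T).Additive where
  map_add {E E' φ ψ} := by
    refine coendTensor.hom_ext fun x => ?_
    rw [Preadditive.comp_add, coendTensor.ι_map, coendTensor.ι_map, coendTensor.ι_map,
      NatTrans.app_add, MonoidalPreadditive.add_whiskerRight, Preadditive.add_comp]

end Coend

variable [Abelian C] [Linear k C] [MonoidalCategory C] (T : TraceFunctor k C)

/-- The canonical extension of the trace functor `C_# → k-Vect` to `Shv(C^n)`: the colimit of
`tr(⟨[n], X⟩)` over the pairs of a tuple `X` and a section of `E` over `X`, taken `k`-linearly,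
that is, `E ⊗_{C^n} tr`. -/
noncomputable def tr (a : CyclicCat) : Shv k C a.V ⥤ ModuleCat.{u} k :=
  (multiSheaf k C a.V).ι ⋙ coendTensor (Sharp.incl C a ⋙ T.functor)

instance (a : CyclicCat) : (tr T a).Additive := by
  unfold tr
  infer_instance

variable [MonoidalPreadditive C]

section TrSharp

variable (E : ShvSharp k C)

/-- The canonical map `E(a)(X) ⊗ tr(a, X) ⟶ tr(E(a))`. -/
noncomputable def trι (a : CyclicCat) (X : a.V → C) :
    E.obj.obj (.op ((SharpOp.incl C a).obj X)) ⊗ T.functor.obj ((Sharp.incl C a).obj X) ⟶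
      (tr T a).obj ((evalSharp k C a).obj E) :=
  coendTensor.ι ((SharpOp.incl C a).op ⋙ E.obj) (Sharp.incl C a ⋙ T.functor) X

theorem trι_condition {a : CyclicCat} {X Y : a.V → C} (g : X ⟶ Y) :
    (E.obj.map ((SharpOp.incl C a).map g).op ⊗ₘ 𝟙 _) ≫ trι T E a X =
      (𝟙 _ ⊗ₘ T.functor.map ((Sharp.incl C a).map g)) ≫ trι T E a Y := by
  rw [tensorHom_id, id_tensorHom]
  exact coendTensor.condition ((SharpOp.incl C a).op ⋙ E.obj) (Sharp.incl C a ⋙ T.functor) g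

theorem trι_condition' {a : CyclicCat} {X Y : a.V → C} (g : X ⟶ Y) {M N : ModuleCat.{u} k}
    (p : M ⟶ E.obj.obj (.op ((SharpOp.incl C a).obj Y)))
    (q : N ⟶ T.functor.obj ((Sharp.incl C a).obj X)) :
    (p ≫ E.obj.map ((SharpOp.incl C a).map g).op ⊗ₘ q) ≫ trι T E a X =
      (p ⊗ₘ q ≫ T.functor.map ((Sharp.incl C a).map g)) ≫ trι T E a Y := by
  have := congrArg ((p ⊗ₘ q) ≫ ·) (trι_condition T E g)
  simpa only [tensorHom_comp_tensorHom_assoc, Category.comp_id] using this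

variable {E} in
theorem tr_hom_ext {a : CyclicCat} {M : ModuleCat.{u} k}
    {f g : (tr T a).obj ((evalSharp k C a).obj E) ⟶ M}
    (h : ∀ X, trι T E a X ≫ f = trι T E a X ≫ g) : f = g := coendTensor.hom_ext h

variable {E} in
/-- Maps out of `tr(E(a))`. -/
noncomputable def trDesc {a : CyclicCat} {M : ModuleCat.{u} k} (f : ∀ X : a.V → C,
    E.obj.obj (.op ((SharpOp.incl C a).obj X)) ⊗ T.functor.obj ((Sharp.incl C a).obj X) ⟶ M)
    (hf : ∀ {X Y : a.V → C} (g : X ⟶ Y), (E.obj.map ((SharpOp.incl C a).map g).op ⊗ₘ 𝟙 _) ≫ f X =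
      (𝟙 _ ⊗ₘ T.functor.map ((Sharp.incl C a).map g)) ≫ f Y) :
    (tr T a).obj ((evalSharp k C a).obj E) ⟶ M :=
  coendTensor.desc (E := (SharpOp.incl C a).op ⋙ E.obj) (T := Sharp.incl C a ⋙ T.functor) f
    (fun g => by
      have := hf g
      rwa [tensorHom_id, id_tensorHom] at this)

theorem trι_desc {a : CyclicCat} {M : ModuleCat.{u} k} (f : ∀ X : a.V → C,
    E.obj.obj (.op ((SharpOp.incl C a).obj X)) ⊗ T.functor.obj ((Sharp.incl C a).obj X) ⟶ M)
    (hf : ∀ {X Y : a.V → C} (g : X ⟶ Y), (E.obj.map ((SharpOp.incl C a).map g).op ⊗ₘ 𝟙 _) ≫ f X =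
      (𝟙 _ ⊗ₘ T.functor.map ((Sharp.incl C a).map g)) ≫ f Y) (X : a.V → C) :
    trι T E a X ≫ trDesc T f hf = f X :=
  coendTensor.ι_desc (E := (SharpOp.incl C a).op ⋙ E.obj) (T := Sharp.incl C a ⋙ T.functor) f
    (fun g => by
      have := hf g
      rwa [tensorHom_id, id_tensorHom] at this) X

theorem trSharpMap_aux {a b : CyclicCat} (f : a ⟶ b) {X Y : a.V → C} (g : X ⟶ Y) :
    (E.obj.map ((SharpOp.incl C a).map g).op ⊗ₘ 𝟙 _) ≫
        (E.obj.map (SharpOp.cart f X).op ⊗ₘ T.functor.map (Sharp.cocart f X)) ≫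
          trι T E b ((push C f).obj X) =
      (𝟙 _ ⊗ₘ T.functor.map ((Sharp.incl C a).map g)) ≫
        (E.obj.map (SharpOp.cart f Y).op ⊗ₘ T.functor.map (Sharp.cocart f Y)) ≫
          trι T E b ((push C f).obj Y) := by
  have h₁ : E.obj.map ((SharpOp.incl C a).map g).op ≫ E.obj.map (SharpOp.cart f X).op =
      E.obj.map (SharpOp.cart f Y).op ≫
        E.obj.map ((SharpOp.incl C b).map ((push C f).map g)).op := by
    rw [← Functor.map_comp, ← Functor.map_comp, ← op_comp, ← op_comp, SharpOp.cart_comp_incl]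
  have h₂ : T.functor.map ((Sharp.incl C a).map g) ≫ T.functor.map (Sharp.cocart f Y) =
      T.functor.map (Sharp.cocart f X) ≫
        T.functor.map ((Sharp.incl C b).map ((push C f).map g)) := by
    rw [← Functor.map_comp, ← Functor.map_comp, Sharp.incl_comp_cocart]
  rw [tensorHom_comp_tensorHom_assoc, tensorHom_comp_tensorHom_assoc, Category.id_comp,
    Category.id_comp, h₁, h₂, trι_condition']

/-- The transition maps of `tr_#(E)`. -/
noncomputable def trSharpMap {a b : CyclicCat} (f : a ⟶ b) :
    (tr T a).obj ((evalSharp k C a).obj E) ⟶ (tr T b).obj ((evalSharp k C b).obj E) :=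
  trDesc T (fun X => (E.obj.map (SharpOp.cart f X).op ⊗ₘ T.functor.map (Sharp.cocart f X)) ≫
    trι T E b ((push C f).obj X)) (trSharpMap_aux T E f)

theorem trι_map {a b : CyclicCat} (f : a ⟶ b) (X : a.V → C) :
    trι T E a X ≫ trSharpMap T E f =
      (E.obj.map (SharpOp.cart f X).op ⊗ₘ T.functor.map (Sharp.cocart f X)) ≫
        trι T E b ((push C f).obj X) := trι_desc T E _ (trSharpMap_aux T E f) X

/-- The object `tr_#(E)` of `Fun(Λ, k)`. -/
noncomputable def trSharpObj : CyclicCat ⥤ ModuleCat.{u} k where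
  obj a := (tr T a).obj ((evalSharp k C a).obj E)
  map f := trSharpMap T E f
  map_id a := by
    refine tr_hom_ext T fun X => ?_
    rw [trι_map, SharpOp.cart_id, Sharp.cocart_id]
    have := trι_condition' T E ((pushId C a).hom.app X) (𝟙 _)
      (T.functor.map ((Sharp.incl C a).map ((pushId C a).inv.app X)))
    rw [Category.id_comp] at this
    refine this.trans ?_
    rw [← Functor.map_comp, ← Functor.map_comp, Iso.inv_hom_id_app]
    simp
  map_comp {a b c} f g := by
    refine tr_hom_ext T fun X => ?_
    rw [reassoc_of% trι_map T E f, trι_map, trι_map, tensorHom_comp_tensorHom_assoc,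
      ← Functor.map_comp, ← Functor.map_comp, ← op_comp, SharpOp.cart_comp, Sharp.cocart_comp,
      op_comp, Functor.map_comp, Functor.map_comp]
    refine Eq.trans ?_ (trι_condition' T E ((pushComp C f g).inv.app X) _ _).symm
    rw [Category.assoc, ← Functor.map_comp, ← Functor.map_comp, ← Functor.map_comp,
      Iso.hom_inv_id_app]
    simp

end TrSharp

/-- The functor `tr_# : Shv(C_#) → Fun(Λ, k)`. -/
noncomputable def trSharp : ShvSharp k C ⥤ CyclicCat ⥤ ModuleCat.{u} k where
  obj E := trSharpObj T E
  map {E E'} φ :=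
    { app a := (tr T a).map ((evalSharp k C a).map φ)
      naturality a b f := by
        have key : ∀ (a : CyclicCat) (X : a.V → C),
            trι T E a X ≫ (tr T a).map ((evalSharp k C a).map φ) =
              (φ.hom.app _ ⊗ₘ 𝟙 _) ≫ trι T E' a X := fun a X => by
          rw [tensorHom_id]
          exact coendTensor.ι_map _ _
        refine tr_hom_ext T fun X => ?_
        change trι T E a X ≫ trSharpMap T E f ≫ (tr T b).map ((evalSharp k C b).map φ) =
          trι T E a X ≫ (tr T a).map ((evalSharp k C a).map φ) ≫ trSharpMap T E' f
        rw [reassoc_of% key, reassoc_of% trι_map T E f, key, trι_map,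
          tensorHom_comp_tensorHom_assoc, tensorHom_comp_tensorHom_assoc, φ.hom.naturality]
        simp }
  map_id E := by
    ext a : 2
    exact (congrArg _ ((evalSharp k C a).map_id E)).trans ((tr T a).map_id _)
  map_comp φ ψ := by
    ext a : 2
    exact (congrArg _ ((evalSharp k C a).map_comp φ ψ)).trans ((tr T a).map_comp _ _)

instance (a : CyclicCat) : (evalSharp k C a).Additive where

instance : (trSharp T).Additive where
  map_add {E E' φ ψ} := by
    refine NatTrans.ext (funext fun a => ?_)
    exact (congrArg (tr T a).map ((evalSharp k C a).map_add (f := φ) (g := ψ))).trans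
      ((tr T a).map_add)

end Trace

section Derived

universe v₁ v₂ u₁ u₂

variable (A : Type u₁) [Category.{v₁} A] [Abelian A] (B : Type u₂) [Category.{v₂} B] [Abelian B]

/-- Homological `δ`-functors. -/
structure DeltaFunctor where
  H : ℕ → A ⥤ B
  additive (n : ℕ) : (H n).Additive
  δ {S : ShortComplex A} (hS : S.ShortExact) (n : ℕ) : (H (n + 1)).obj S.X₃ ⟶ (H n).obj S.X₁
  δ_naturality {S S' : ShortComplex A} (hS : S.ShortExact) (hS' : S'.ShortExact) (φ : S ⟶ S')
    (n : ℕ) : δ hS n ≫ (H n).map φ.τ₁ = (H (n + 1)).map φ.τ₃ ≫ δ hS' n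
  exact₁ {S : ShortComplex A} (hS : S.ShortExact) (n : ℕ) :
    ∃ w : δ hS n ≫ (H n).map S.f = 0, (ShortComplex.mk _ _ w).Exact
  exact₂ {S : ShortComplex A} (hS : S.ShortExact) (n : ℕ) :
    ∃ w : (H n).map S.f ≫ (H n).map S.g = 0, (ShortComplex.mk _ _ w).Exact
  exact₃ {S : ShortComplex A} (hS : S.ShortExact) (n : ℕ) :
    ∃ w : (H (n + 1)).map S.g ≫ δ hS n = 0, (ShortComplex.mk _ _ w).Exact
  epi {S : ShortComplex A} (hS : S.ShortExact) : Epi ((H 0).map S.g)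

variable {A B}

/-- Morphisms of homological `δ`-functors. -/
@[ext]
structure DeltaFunctor.Hom (S T : DeltaFunctor A B) where
  τ (n : ℕ) : S.H n ⟶ T.H n
  comm {X : ShortComplex A} (hX : X.ShortExact) (n : ℕ) :
    S.δ hX n ≫ (τ n).app X.X₁ = (τ (n + 1)).app X.X₃ ≫ T.δ hX n

/-- `T` is the sequence of left derived functors of `F`: a universal homological `δ`-functor
with `T₀ ≅ F`. -/
structure IsLeftDerived (T : DeltaFunctor A B) (F : A ⥤ B) : Prop where
  zero : Nonempty (T.H 0 ≅ F)
  universal (S : DeltaFunctor A B) (η : S.H 0 ⟶ T.H 0) : ∃! φ : S.Hom T, φ.τ 0 = η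

/-- `E` is acyclic for `F`: the higher left derived functors of `F` vanish at `E`. -/
def LeftAcyclic (F : A ⥤ B) (E : A) : Prop :=
  ∃ T : DeltaFunctor A B, IsLeftDerived T F ∧ ∀ n, IsZero ((T.H (n + 1)).obj E)

/-- The functor `C(A) → D(B)` induced by an additive functor. -/
noncomputable abbrev toDerived (F : A ⥤ B) [F.Additive] [HasDerivedCategory B] :
    CochainComplex A ℤ ⥤ DerivedCategory B :=
  F.mapHomologicalComplex (ComplexShape.up ℤ) ⋙ DerivedCategory.Q

end Derived

section Clean

variable {k : Type u} [Field k] {C : Type u} [Category.{u} C] [Abelian C] [Linear k C]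
  [MonoidalCategory C] [MonoidalPreadditive C] [MonoidalLinear k C]
  [∀ X : C, PreservesFiniteColimits (tensorLeft X)]
  [∀ X : C, PreservesFiniteColimits (tensorRight X)]

/-- The acyclicity conditions in the definition of homological cleanness. -/
structure IsAdmissible (T : TraceFunctor k C) {a : CyclicCat} (E : Shv k C a.V) : Prop where
  shriek_acyclic {b : CyclicCat} (f : a ⟶ b) : LeftAcyclic (shriek k f) E
  tr_acyclic : LeftAcyclic (tr T a) E
  tr_shriek_acyclic {b : CyclicCat} (f : a ⟶ b) : LeftAcyclic (tr T b) ((shriek k f).obj E)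

/-- `⟨C, tr⟩` is homologically clean. -/
def HomologicallyClean (T : TraceFunctor k C) : Prop :=
  ∀ (a : CyclicCat) (E : Shv k C a.V), ∃ (P : Shv k C a.V) (π : P ⟶ E), Epi π ∧ IsAdmissible T P

variable (k) in
/-- The presheaf represented by an object of `C`. -/
def represented (X : C) : (CyclicCat.one.V → C)ᵒᵖ ⥤ ModuleCat.{u} k :=
  (Pi.eval (fun _ => C) (⟨0, Nat.one_pos⟩ : CyclicCat.one.V)).op ⋙ (linearYoneda k C).obj X

/-- `Shv_cart(C_#)`: the cocartesian sections `E` such that `E([1])` is representable. -/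
def shvCart (E : ShvSharp k C) : Prop :=
  IsCocartesian E ∧
    ∃ X : C, Nonempty (((evalSharp k C CyclicCat.one).obj E).obj ≅ represented k X)

/-- `DΛ(C)`: the complexes with homology in `Shv_cart(C_#)`. -/
def DLambda [HasDerivedCategory (ShvSharp k C)] : ObjectProperty (DerivedCategory (ShvSharp k C)) :=
  fun K => ∀ n : ℤ, shvCart ((DerivedCategory.homologyFunctor _ n).obj K)

variable (k) in
/-- `D_const(Λ, k)`: the complexes whose homology objects are constant functors. -/
def DConst [HasDerivedCategory (CyclicCat ⥤ ModuleCat.{u} k)] :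
    ObjectProperty (DerivedCategory (CyclicCat ⥤ ModuleCat.{u} k)) :=
  fun K => ∀ n : ℤ, ∃ M : ModuleCat.{u} k,
    Nonempty ((DerivedCategory.homologyFunctor _ n).obj K ≅ (Functor.const CyclicCat).obj M)

end Clean

/-!
The trace functor `tr : Shv(C^n) → k-Vect` is right exact, but neither `Shv(C^n)` nor `Shv(C_#)`
need have enough projective objects, and the derived functors are computed by unbounded resolutions
adapted to `tr`.

*Adapted complexes.* Let `F : A ⥤ B` be an additive functor with a right adjoint `G`, such that all
objects of `B` are injective. The test complexes of `F` are the bounded below acyclic complexes of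
objects which are injective with respect to the monomorphisms preserved by `F`. An object `P` is
adapted to `F` if `Hom(P, c)` is exact, and a complex `L` is adapted if every morphism `L ⟶ c` is
null-homotopic, for all test complexes `c`.
* If there are enough acyclic objects for `F`, then acyclic objects are adapted
  (`LeftAcyclic.fAdapted`), by dimension shifting.
* `F` preserves quasi-isomorphisms between adapted complexes (`FGood.quasiIso_map`). The mapping
  cone of an injective resolution of `G V` is a test complex, so that morphisms from an adapted
  acyclic complex `M` to `G V` are null-homotopic; this says that `Hom(F M, V)` is exact.
* Resolutions by adapted complexes exist and can be chosen functorially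
  (`exists_functorial_resolution`). The resolution of one complex is obtained by attaching cells
  along a sequence, as in Spaltenstein's construction. Functoriality is for free: the construction
  is carried out once, for the tautological complex in the abelian category of functors from
  complexes to `A`.

The trace functor has a right adjoint with values in sheaves (`trAdj`), as `f_!` followed by the
trace functor is the trace functor and everything can be moved to `[1]`; so this applies to `tr`.

*The case of `tr_#`.* The evaluation `Shv(C_#) ⥤ Shv(C^n)` has a right adjoint, given by an
explicit Kan extension, and a left adjoint. If `P` is an admissible separator of `Shv(C^n)`, the
value at `b` of the object of `Shv(C_#)` induced from `P` is built from the direct images of `P`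
under the morphisms `[n] ⟶ b`, and condition (ii) of homological cleanness makes these values
adapted to `tr` (`homExact_evalSharp_indSharp`). Hence complexes over `Shv(C_#)` have functorial
resolutions whose values and whose direct images of values are all adapted to `tr`
(`HomologicallyClean.exists_sharp_resolution`). The same resolution computes the derived functor of
`tr_#` and, at every `[n]`, that of `tr`, which gives the comparison isomorphism.

*Constancy.* Let `L` be such a resolution, with cocartesian homology. The transition map of
`tr_#(L)` along `f` is the image under `tr` of the transition map `(f_!)_! L(a) ⟶ L(b)`
(`trSharpMap_eq`). If `f` is a degeneracy `[n] ⟶ [n + 1]`, then `(f_!)_!` is exact, being the sheaf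
associated to the external tensor product with the presheaf `Hom(-, 𝟙)` over the field `k`; so this
transition map is a quasi-isomorphism between adapted complexes, which `tr` preserves. The homology
of `tr_#(L)` therefore inverts the degeneracies, and a functor on `Λ` which does so is constant
(`CyclicCat.nonempty_iso_const`).
-/

set_option linter.unusedSectionVars false

/-! ### Attaching cells to complexes -/

section RelativeResolutions

open CochainComplex HomComplex

universe v₁ v₂ v₃ u₁ u₂ u₃

/-- The complex of functors associated to a functor to complexes: functors and complexes
commute. -/
def complexOfFunctor {J : Type u₁} [Category.{v₁} J] {A : Type u₂} [Category.{v₂} A]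
    [HasZeroMorphisms A] (G : J ⥤ CochainComplex A ℤ) : CochainComplex (J ⥤ A) ℤ where
  X i := G ⋙ HomologicalComplex.eval A _ i
  d i j := { app := fun x => (G.obj x).d i j, naturality := fun _ _ f => (G.map f).comm i j }
  shape i j h := by ext x; exact (G.obj x).shape i j h
  d_comp_d' i j k _ _ := by ext x; exact (G.obj x).d_comp_d i j k

variable {A : Type u₁} [Category.{v₁} A] [Abelian A]

/-- `Hom(P, d)` is an exact complex of abelian groups. -/
def HomExact (P : A) (d : CochainComplex A ℤ) : Prop :=
  ∀ (i j k : ℤ), i + 1 = j → j + 1 = k → ∀ x : P ⟶ d.X j, x ≫ d.d j k = 0 →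
    ∃ y : P ⟶ d.X i, y ≫ d.d i j = x

/-- Every morphism from `L` to `d` is homotopic to zero. -/
def NullHomotopic (L d : CochainComplex A ℤ) : Prop :=
  ∀ g : L ⟶ d, Nonempty (Homotopy g 0)

/-- Null-homotopies as cochains of degree `-1`, the form in which they are glued and extended
below. -/
theorem nonempty_homotopy_iff {L d : CochainComplex A ℤ} (g : L ⟶ d) :
    Nonempty (Homotopy g 0) ↔ ∃ h : Cochain L d (-1), δ (-1) 0 h = Cochain.ofHom g := by
  constructor
  · rintro ⟨h⟩
    obtain ⟨z, hz⟩ := Cochain.equivHomotopy _ _ h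
    exact ⟨z, by simpa using hz.symm⟩
  · rintro ⟨z, hz⟩
    exact ⟨(Cochain.equivHomotopy _ _).symm ⟨z, by simpa using hz.symm⟩⟩

/-- A complex with zero differential whose terms satisfy `Q`, mapping to `N` by a morphism which is
surjective on homology. -/
theorem exists_cover (Q : ObjectProperty A) (hQ : ∀ E : A, ∃ (P : A) (π : P ⟶ E), Q P ∧ Epi π)
    (N : CochainComplex A ℤ) : ∃ (Y : CochainComplex A ℤ) (v : Y ⟶ N), (∀ i j, Y.d i j = 0) ∧
      (∀ i, Q (Y.X i)) ∧ ∀ i, Epi (HomologicalComplex.homologyMap v i) := by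
  choose P π hP hπ using hQ
  let Y : CochainComplex A ℤ := { X := fun i => P (N.cycles i), d := fun _ _ => 0 }
  let v : Y ⟶ N :=
    { f := fun i => π _ ≫ N.iCycles i
      comm' := fun i j _ => by simp [Y] }
  refine ⟨Y, v, fun _ _ => rfl, fun i => hP _, fun i => ?_⟩
  let s : Y.X i ⟶ Y.cycles i := Y.liftCycles (𝟙 _) (i + 1) (by simp) (by simp [Y])
  have h : s ≫ HomologicalComplex.cyclesMap v i = π _ := by
    rw [← cancel_mono (N.iCycles i)]
    simp [s, v]
  have h' : (s ≫ Y.homologyπ i) ≫ HomologicalComplex.homologyMap v i = π _ ≫ N.homologyπ i := by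
    rw [Category.assoc, HomologicalComplex.homologyπ_naturality, reassoc_of% h]
  have : Epi (π (N.cycles i) ≫ N.homologyπ i) := epi_comp _ _
  rw [← h'] at this
  exact epi_of_epi (s ≫ Y.homologyπ i) _

/-- If `v` is surjective on homology, then the inclusion of its target into the mapping cone is
zero on homology, as its composite with `v` is homotopic to zero. -/
theorem homologyMap_inr_eq_zero {Y N : CochainComplex A ℤ} (v : Y ⟶ N)
    (hv : ∀ i, Epi (HomologicalComplex.homologyMap v i)) (i : ℤ) :
    HomologicalComplex.homologyMap (mappingCone.inr v) i = 0 := by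
  obtain ⟨h⟩ := (nonempty_homotopy_iff (v ≫ mappingCone.inr v)).2
    ⟨mappingCone.inl v, mappingCone.δ_inl v⟩
  have := hv i
  rw [← cancel_epi (HomologicalComplex.homologyMap v i), ← HomologicalComplex.homologyMap_comp,
    h.homologyMap_eq, HomologicalComplex.homologyMap_zero, comp_zero]

/-- A cocycle out of a complex with zero differential is a coboundary if its terms are relatively
projective. -/
theorem exists_δ_eq {Y d : CochainComplex A ℤ} (hY : ∀ i j, Y.d i j = 0)
    (hd : ∀ i, HomExact (Y.X i) d) (n m p : ℤ) (hnm : n + 1 = m) (hmp : m + 1 = p)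
    (z : Cochain Y d m) (hz : δ m p z = 0) : ∃ t : Cochain Y d n, δ n m t = z := by
  have key : ∀ i, ∃ y : Y.X i ⟶ d.X (i + n), y ≫ d.d (i + n) (i + m) = z.v i (i + m) rfl := by
    intro i
    refine hd i (i + n) (i + m) (i + p) (by lia) (by lia) _ ?_
    have := Cochain.congr_v hz i (i + p) rfl
    rw [δ_v m p hmp z i (i + p) rfl (i + m) (i + 1) (by lia) rfl, hY] at this
    simpa using this
  choose y hy using key
  refine ⟨Cochain.mk fun i q h => y i ≫ eqToHom (by rw [h]), ?_⟩
  ext i q hq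
  obtain rfl := hq
  rw [δ_v n m hnm _ i (i + m) rfl (i + n) (i + 1) (by lia) rfl, hY]
  simp [hy]

/-- Extension of null-homotopies along the inclusion into a mapping cone: the obstruction is a
cocycle on `Y`, which bounds by `exists_δ_eq`. -/
theorem exists_extension {Y N d : CochainComplex A ℤ} (v : Y ⟶ N) (hY : ∀ i j, Y.d i j = 0)
    (hd : ∀ i, HomExact (Y.X i) d) (g : mappingCone v ⟶ d) (h : Cochain N d (-1))
    (hh : δ (-1) 0 h = Cochain.ofHom (mappingCone.inr v ≫ g)) :
    ∃ h' : Cochain (mappingCone v) d (-1), δ (-1) 0 h' = Cochain.ofHom g ∧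
      (Cochain.ofHom (mappingCone.inr v)).comp h' (zero_add _) = h := by
  obtain ⟨t, ht⟩ := exists_δ_eq hY hd (-2) (-1) 0 rfl rfl
    ((mappingCone.inl v).comp (Cochain.ofHom g) (add_zero _) -
      (Cochain.ofHom v).comp h (zero_add _)) (by
        rw [δ_sub, δ_comp_ofHom, mappingCone.δ_inl, δ_ofHom_comp, hh]
        simp)
  refine ⟨mappingCone.descCochain v t h rfl, ?_, by simp⟩
  have e : g = mappingCone.desc v ((mappingCone.inl v).comp (Cochain.ofHom g) (add_zero _))
      (mappingCone.inr v ≫ g) (by rw [δ_comp_ofHom, mappingCone.δ_inl]; simp) := by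
    ext p
    simp [mappingCone.ext_from_iff v (p + 1) p rfl]
  conv_rhs => rw [e, mappingCone.ofHom_desc]
  rw [mappingCone.δ_descCochain _ _ _ _ _ (neg_add_cancel 1), ht, hh]
  simp [mappingCone.descCochain]

end RelativeResolutions

/-! ### Null-homotopies, shifts and sequential colimits of complexes -/

section RelativeResolutions

open CochainComplex HomComplex

universe v₁ v₂ v₃ u₁ u₂ u₃

variable {A : Type u₁} [Category.{v₁} A] [Abelian A]

theorem nullHomotopic_iff (L d : CochainComplex A ℤ) : NullHomotopic L d ↔
    ∀ g : (HomotopyCategory.quotient A (ComplexShape.up ℤ)).obj L ⟶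
      (HomotopyCategory.quotient A (ComplexShape.up ℤ)).obj d, g = 0 := by
  constructor
  · intro h g
    obtain ⟨g, rfl⟩ := (HomotopyCategory.quotient A (ComplexShape.up ℤ)).map_surjective g
    exact (HomotopyCategory.quotient_map_eq_zero_iff g).2 (h g)
  · intro h g
    exact (HomotopyCategory.quotient_map_eq_zero_iff g).1 (h _)

theorem hom_shift_eq_zero {D : Type*} [Category* D] [Preadditive D] [HasShift D ℤ]
    [∀ n : ℤ, (CategoryTheory.shiftFunctor D n).Additive] {X Y : D} (n m : ℤ) (hnm : n + m = 0)
    (h : ∀ g : X ⟶ Y⟦m⟧, g = 0) (g : X⟦n⟧ ⟶ Y) : g = 0 := by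
  let e := (shiftFunctorCompIsoId D n m hnm).app X
  have := h (e.inv ≫ g⟦m⟧')
  rw [← (CategoryTheory.shiftFunctor D m).map_eq_zero_iff, ← cancel_epi e.inv, this, comp_zero]

theorem NullHomotopic.shift {L d : CochainComplex A ℤ} (n m : ℤ) (hnm : n + m = 0)
    (h : NullHomotopic L (d⟦m⟧)) : NullHomotopic (L⟦n⟧) d := by
  rw [nullHomotopic_iff] at h ⊢
  intro g
  let eL := ((HomotopyCategory.quotient A (ComplexShape.up ℤ)).commShiftIso n).app L
  let ed := ((HomotopyCategory.quotient A (ComplexShape.up ℤ)).commShiftIso m).app d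
  have := hom_shift_eq_zero n m hnm (fun g' => by
    rw [← cancel_mono ed.inv, h (g' ≫ ed.inv), zero_comp]) (eL.inv ≫ g)
  rw [← cancel_epi eL.inv, this, comp_zero]

theorem HomExact.shift {P : A} {d : CochainComplex A ℤ} (h : HomExact P d) (n : ℤ) :
    HomExact P (d⟦n⟧) := by
  intro i j k hij hjk (x : P ⟶ d.X (j + n)) hx
  have hx' : x ≫ (n.negOnePow • d.d (j + n) (k + n)) = 0 := hx
  rw [Linear.comp_units_smul, smul_eq_zero_iff_eq] at hx'
  obtain ⟨y, hy⟩ := h (i + n) (j + n) (k + n) (by lia) (by lia) x hx'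
  refine ⟨n.negOnePow • y, ?_⟩
  change (n.negOnePow • y) ≫ (n.negOnePow • d.d (i + n) (j + n)) = x
  rw [Linear.units_smul_comp, Linear.comp_units_smul, smul_smul, Int.units_mul_self, one_smul, hy]

/-- The homology of `complexOfFunctor N` is computed argument by argument. -/
theorem evaluation_homologyMap_eq_zero (N : ℕ ⥤ CochainComplex A ℤ) (i : ℤ) {n m : ℕ} (f : n ⟶ m)
    (h : HomologicalComplex.homologyMap (N.map f) i = 0) :
    ((complexOfFunctor N).homology i).map f = 0 := by
  have := NatTrans.app_homology ((evaluation ℕ A).map f) ((complexOfFunctor N).sc i)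
  refine (this.trans ?_ : ((evaluation ℕ A).map f).app _ = 0)
  have h' : ShortComplex.homologyMap
      (((complexOfFunctor N).sc i).mapNatTrans ((evaluation ℕ A).map f)) = 0 := h
  rw [h', zero_comp, comp_zero]

variable [HasColimitsOfShape ℕ A]

/-- The colimit of a sequence of complexes, formed degreewise. -/
noncomputable def seqColimit (N : ℕ ⥤ CochainComplex A ℤ) : CochainComplex A ℤ :=
  (colim.mapHomologicalComplex _).obj (complexOfFunctor N)

/-- The structure maps of `seqColimit N`. -/
noncomputable def seqColimit.ι (N : ℕ ⥤ CochainComplex A ℤ) (n : ℕ) : N.obj n ⟶ seqColimit N where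
  f i := colimit.ι (N ⋙ HomologicalComplex.eval A _ i) n
  comm' i j _ := ι_colimMap ((complexOfFunctor N).d i j) n

theorem seqColimit.w (N : ℕ ⥤ CochainComplex A ℤ) {n m : ℕ} (f : n ⟶ m) :
    N.map f ≫ seqColimit.ι N m = seqColimit.ι N n := by
  ext i
  exact colimit.w (N ⋙ HomologicalComplex.eval A _ i) f

theorem seqColimit.hom_ext {N : ℕ ⥤ CochainComplex A ℤ} {i : ℤ} {M : A}
    {f g : (seqColimit N).X i ⟶ M}
    (h : ∀ n, (seqColimit.ι N n).f i ≫ f = (seqColimit.ι N n).f i ≫ g) : f = g :=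
  colimit.hom_ext (F := N ⋙ HomologicalComplex.eval A _ i) h

/-- Gluing of cochains on a sequential colimit. -/
theorem seqColimit.exists_cochain (N : ℕ ⥤ CochainComplex A ℤ) (d : CochainComplex A ℤ) (m : ℤ)
    (H : ∀ n, Cochain (N.obj n) d m)
    (hH : ∀ n, (Cochain.ofHom (N.map (homOfLE (Nat.le_add_right n 1)))).comp (H (n + 1))
      (zero_add _) = H n) :
    ∃ H' : Cochain (seqColimit N) d m,
      ∀ n, (Cochain.ofHom (seqColimit.ι N n)).comp H' (zero_add _) = H n := by
  let c (i j : ℤ) (h : i + m = j) : Cocone (N ⋙ HomologicalComplex.eval A _ i) :=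
    { pt := d.X j
      ι := NatTrans.ofSequence (F := N ⋙ HomologicalComplex.eval A _ i)
        (G := (Functor.const ℕ).obj (d.X j)) (fun n => (H n).v i j h) (fun n => by
          have := Cochain.congr_v (hH n) i j h
          rw [Cochain.zero_cochain_comp_v, Cochain.ofHom_v] at this
          exact this.trans (Category.comp_id _).symm) }
  let φ (i j : ℤ) (h : i + m = j) : (seqColimit N).X i ⟶ d.X j := colimit.desc _ (c i j h)
  refine ⟨Cochain.mk φ, fun n => ?_⟩
  ext i j h
  rw [Cochain.zero_cochain_comp_v, Cochain.ofHom_v, Cochain.mk_v]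
  exact colimit.ι_desc (c i j h) n

theorem seqColimit.cochain_ext {N : ℕ ⥤ CochainComplex A ℤ} {d : CochainComplex A ℤ} {m : ℤ}
    {H H' : Cochain (seqColimit N) d m}
    (h : ∀ n, (Cochain.ofHom (seqColimit.ι N n)).comp H (zero_add _) =
      (Cochain.ofHom (seqColimit.ι N n)).comp H' (zero_add _)) : H = H' := by
  ext i j hij
  refine seqColimit.hom_ext fun n => ?_
  simpa using Cochain.congr_v (h n) i j hij

theorem isZero_colimit_of_sequence (H : ℕ ⥤ A)
    (hH : ∀ n, H.map (homOfLE (Nat.le_add_right n 1)) = 0) : IsZero (colimit H) := by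
  rw [IsZero.iff_id_eq_zero]
  ext n
  rw [← colimit.w H (homOfLE (Nat.le_add_right n 1)), hH]
  simp

/-- A sequential colimit along maps which vanish on homology is acyclic. -/
theorem seqColimit.acyclic [HasExactColimitsOfShape ℕ A] (N : ℕ ⥤ CochainComplex A ℤ)
    (hN : ∀ n i, HomologicalComplex.homologyMap (N.map (homOfLE (Nat.le_add_right n 1))) i = 0) :
    (seqColimit N).Acyclic := by
  intro i
  rw [HomologicalComplex.exactAt_iff_isZero_homology]
  have : (colim : (ℕ ⥤ A) ⥤ A).PreservesHomology := inferInstance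
  refine IsZero.of_iso ?_ (((complexOfFunctor N).sc i).mapHomologyIso colim)
  exact isZero_colimit_of_sequence _ fun n => evaluation_homologyMap_eq_zero N i _ (hN n i)

end RelativeResolutions

/-! ### Resolutions relative to a class of objects -/

section RelativeResolutions

open CochainComplex HomComplex

universe v₁ v₂ v₃ u₁ u₂ u₃

variable {A : Type u₁} [Category.{v₁} A] [Abelian A]

/-- Every complex maps to an acyclic complex along which null-homotopies with values in complexes
exact relatively to `Q` extend. The acyclic complex is the colimit of a sequence of mapping cones of
morphisms `Y ⟶ N`, with `Y` a complex with zero differential and terms in `Q`, each of which kills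
the homology of the preceding term. -/
theorem exists_acyclic_extension [HasColimitsOfShape ℕ A] [HasExactColimitsOfShape ℕ A]
    (Q : ObjectProperty A) (hQ : ∀ E : A, ∃ (P : A) (π : P ⟶ E), Q P ∧ Epi π)
    (U : CochainComplex A ℤ) : ∃ (N : CochainComplex A ℤ) (i : U ⟶ N), N.Acyclic ∧
      ∀ d : CochainComplex A ℤ, (∀ P, Q P → HomExact P d) → ∀ (g : N ⟶ d) (h : Cochain U d (-1)),
        δ (-1) 0 h = Cochain.ofHom (i ≫ g) → ∃ h' : Cochain N d (-1),
          δ (-1) 0 h' = Cochain.ofHom g ∧ (Cochain.ofHom i).comp h' (zero_add _) = h := by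
  have := exists_cover Q hQ
  choose Y v hY hYQ hv using this
  let N : ℕ → CochainComplex A ℤ := fun n =>
    Nat.rec (motive := fun _ => CochainComplex A ℤ) U (fun _ M => mappingCone (v M)) n
  let incl (n : ℕ) : N n ⟶ N (n + 1) :=
    (mappingCone.inr (v (N n)) : N n ⟶ mappingCone (v (N n)))
  let F : ℕ ⥤ CochainComplex A ℤ := Functor.ofSequence incl
  have hF (n : ℕ) : F.map (homOfLE (Nat.le_add_right n 1)) = mappingCone.inr (v (N n)) :=
    Functor.ofSequence_map_homOfLE_succ _ n
  refine ⟨seqColimit F, seqColimit.ι F 0, seqColimit.acyclic F fun n i => ?_, ?_⟩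
  · rw [hF]
    exact homologyMap_inr_eq_zero _ (hv _) i
  · intro d hd g h hh
    -- the null-homotopies on the terms of the sequence are chosen inductively, each extending the
    -- preceding one on the nose, so that they glue
    let S (n : ℕ) := { h : Cochain (F.obj n) d (-1) //
      δ (-1) 0 h = Cochain.ofHom (seqColimit.ι F n ≫ g) }
    have step (n : ℕ) (s : S n) : ∃ t : S (n + 1),
        (Cochain.ofHom (F.map (homOfLE (Nat.le_add_right n 1)))).comp t.1 (zero_add _) = s.1 := by
      rw [hF]
      obtain ⟨t, ht, ht'⟩ := exists_extension (v (N n)) (hY _) (fun i => hd _ (hYQ _ i))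
        (seqColimit.ι F (n + 1) ≫ g) s.1 (by
          refine s.2.trans ?_
          rw [← seqColimit.w F (homOfLE (Nat.le_add_right n 1)), hF]
          exact congrArg _ (Category.assoc _ _ _))
      exact ⟨⟨t, ht⟩, ht'⟩
    choose next hnext using step
    let s (n : ℕ) : S n := Nat.rec ⟨h, hh⟩ (fun n => next n) n
    obtain ⟨H, hH⟩ := seqColimit.exists_cochain F d (-1) (fun n => (s n).1)
      (fun n => hnext n (s n))
    refine ⟨H, seqColimit.cochain_ext fun n => ?_, hH 0⟩
    rw [← Cochain.ofHom_comp, ← (s n).2, ← hH n, δ_ofHom_comp]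

/-- If null-homotopies extend along `i`, then morphisms out of the mapping cone of `i` are
null-homotopic: such a morphism is a morphism on `N` together with a null-homotopy on `U`. -/
theorem NullHomotopic.of_extension {U N d : CochainComplex A ℤ} (i : U ⟶ N)
    (H : ∀ (g : N ⟶ d) (h : Cochain U d (-1)),
        δ (-1) 0 h = Cochain.ofHom (i ≫ g) → ∃ h' : Cochain N d (-1),
          δ (-1) 0 h' = Cochain.ofHom g ∧ (Cochain.ofHom i).comp h' (zero_add _) = h) :
    NullHomotopic (mappingCone i) d := by
  intro g
  rw [nonempty_homotopy_iff]
  obtain ⟨h', hh', e⟩ := H (mappingCone.inr i ≫ g)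
    ((mappingCone.inl i).comp (Cochain.ofHom g) (add_zero _)) (by
      rw [δ_comp_ofHom, mappingCone.δ_inl]; simp)
  refine ⟨mappingCone.descCochain i (0 : Cochain U d (-2)) h' rfl, ?_⟩
  have e' : g = mappingCone.desc i ((mappingCone.inl i).comp (Cochain.ofHom g) (add_zero _))
      (mappingCone.inr i ≫ g) (by rw [δ_comp_ofHom, mappingCone.δ_inl]; simp) := by
    ext p
    simp [mappingCone.ext_from_iff i (p + 1) p rfl]
  conv_rhs => rw [e', mappingCone.ofHom_desc]
  rw [mappingCone.δ_descCochain _ _ _ _ _ (neg_add_cancel 1), hh', δ_zero]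
  simp [mappingCone.descCochain, e]

/-- The connecting morphism from the mapping cone of `U ⟶ N` to the shift of `U` is a
quasi-isomorphism if `N` is acyclic. -/
theorem quasiIso_triangle_mor₃ {U N : CochainComplex A ℤ} (i : U ⟶ N) (hN : N.Acyclic) :
    QuasiIso (mappingCone.triangle i).mor₃ := by
  have h : (HomotopyCategory.subcategoryAcyclic A).trW (mappingCone.triangleh i).mor₃ :=
    ObjectProperty.trW.mk' _ (Pretriangulated.rot_of_distTriang _
      (HomotopyCategory.mappingCone_triangleh_distinguished i))
      ((HomotopyCategory.quotient_obj_mem_subcategoryAcyclic_iff_acyclic N).2 hN)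
  rw [← HomotopyCategory.quasiIso_eq_trW_subcategoryAcyclic] at h
  rw [← HomologicalComplex.mem_quasiIso_iff, ← HomotopyCategory.quotient_map_mem_quasiIso_iff]
  exact (MorphismProperty.cancel_right_of_respectsIso _ _
    (((HomotopyCategory.quotient A (ComplexShape.up ℤ)).commShiftIso (1 : ℤ)).hom.app U)).1 h

/-- Resolutions relative to a class `Q` of objects: the analogue of Spaltenstein's K-projective
resolutions in which the projective objects are replaced by the objects of `Q`, and acyclic
complexes by those which are exact relatively to `Q`. -/
theorem exists_resolution [HasColimitsOfShape ℕ A] [HasExactColimitsOfShape ℕ A]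
    (Q : ObjectProperty A) (hQ : ∀ E : A, ∃ (P : A) (π : P ⟶ E), Q P ∧ Epi π)
    (U : CochainComplex A ℤ) : ∃ (R : CochainComplex A ℤ) (ρ : R ⟶ U), QuasiIso ρ ∧
      ∀ d : CochainComplex A ℤ, (∀ P, Q P → HomExact P d) → NullHomotopic R d := by
  obtain ⟨N, i, hN, H⟩ := exists_acyclic_extension Q hQ U
  have := quasiIso_triangle_mor₃ i hN
  let e := (shiftFunctorCompIsoId (CochainComplex A ℤ) (1 : ℤ) (-1) (add_neg_cancel 1)).app U
  refine ⟨(mappingCone i)⟦(-1 : ℤ)⟧, (mappingCone.triangle i).mor₃⟦(-1 : ℤ)⟧' ≫ e.hom, ?_, ?_⟩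
  · have : QuasiIso ((mappingCone.triangle i).mor₃⟦(-1 : ℤ)⟧') :=
      (CochainComplex.quasiIso_shift_iff _ _).2 this
    exact (HomologicalComplex.quasiIso A _).comp_mem _ _ this
      (inferInstanceAs (QuasiIso e.hom))
  · intro d hd
    refine NullHomotopic.shift (-1) 1 (by lia) (NullHomotopic.of_extension i ?_)
    exact H _ fun P hP => (hd P hP).shift 1

end RelativeResolutions

/-! ### Functorial relative resolutions -/

section RelativeResolutions

open CochainComplex HomComplex

universe v₁ v₂ v₃ u₁ u₂ u₃

section Adjunction

variable {A : Type u₁} [Category.{v₁} A] [Abelian A] {A' : Type u₂} [Category.{v₂} A'] [Abelian A']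
  {Φ : A ⥤ A'} {Ψ : A' ⥤ A} [Φ.Additive] [Ψ.Additive] (adj : Φ ⊣ Ψ)

include adj in
/-- Relative exactness is transported by an adjunction. -/
theorem homExact_mapHomologicalComplex_iff (P : A) (c : CochainComplex A' ℤ) :
    HomExact P ((Ψ.mapHomologicalComplex _).obj c) ↔ HomExact (Φ.obj P) c := by
  constructor
  · intro h i j k hij hjk x hx
    obtain ⟨(y : P ⟶ Ψ.obj (c.X i)), hy⟩ := h i j k hij hjk (adj.homEquiv _ _ x) (by
      change adj.homEquiv _ _ x ≫ Ψ.map (c.d j k) = 0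
      rw [← adj.homEquiv_naturality_right, hx]
      simp [Adjunction.homEquiv_unit])
    replace hy : y ≫ Ψ.map (c.d i j) = adj.homEquiv _ _ x := hy
    exact ⟨(adj.homEquiv _ _).symm y, by
      rw [← adj.homEquiv_naturality_right_symm, hy, Equiv.symm_apply_apply]⟩
  · intro h i j k hij hjk (x : P ⟶ Ψ.obj (c.X j)) (hx : x ≫ Ψ.map (c.d j k) = 0)
    obtain ⟨y, hy⟩ := h i j k hij hjk ((adj.homEquiv _ _).symm x) (by
      rw [← adj.homEquiv_naturality_right_symm, hx]
      simp [Adjunction.homEquiv_counit])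
    refine ⟨adj.homEquiv _ _ y, ?_⟩
    change adj.homEquiv _ _ y ≫ Ψ.map (c.d i j) = x
    rw [← adj.homEquiv_naturality_right, hy, Equiv.apply_symm_apply]

include adj in
/-- Null-homotopies are transported by an adjunction. -/
theorem NullHomotopic.of_adjunction {R : CochainComplex A ℤ} {c : CochainComplex A' ℤ}
    (h : NullHomotopic R ((Ψ.mapHomologicalComplex _).obj c)) :
    NullHomotopic ((Φ.mapHomologicalComplex _).obj R) c := by
  intro g
  let g' : R ⟶ (Ψ.mapHomologicalComplex _).obj c :=
    { f := fun i => adj.homEquiv _ _ (g.f i)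
      comm' := fun i j _ => (adj.homEquiv_naturality_right _ _).symm.trans
        ((congrArg _ (g.comm i j)).trans (adj.homEquiv_naturality_left _ _)) }
  let ε : (Φ.mapHomologicalComplex _).obj ((Ψ.mapHomologicalComplex _).obj c) ⟶ c :=
    { f := fun i => adj.counit.app _
      comm' := fun i j _ => (adj.counit.naturality _).symm }
  obtain ⟨H⟩ := h g'
  have e : (Φ.mapHomologicalComplex _).map g' ≫ ε = g := by
    ext i
    exact (adj.homEquiv_counit _ _ _).symm.trans (Equiv.symm_apply_apply _ _)
  refine ⟨(Homotopy.ofEq e.symm).trans (((Φ.mapHomotopy H).compRight ε).trans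
    (Homotopy.ofEq ?_))⟩
  simp

end Adjunction

section Functorial

variable {A : Type u₁} [Category.{v₁} A] [HasCoproducts.{v₁} A]
  {ι : Type v₁} (G : ι → A)

/-- The coproduct of the objects of a family `G`, indexed by the morphisms to a given object. -/
noncomputable def coproductCover : A ⥤ A where
  obj E := ∐ fun p : Σ i, G i ⟶ E => G p.1
  map {E E'} φ := Sigma.desc fun p =>
    Sigma.ι (fun p : Σ i, G i ⟶ E' => G p.1) ⟨p.1, p.2 ≫ φ⟩
  map_id E := by
    apply Sigma.hom_ext
    rintro ⟨i, f⟩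
    rw [Sigma.ι_desc]
    refine Eq.trans ?_ (Category.comp_id _).symm
    exact congrArg (β := G i ⟶ ∐ fun p : Σ i, G i ⟶ E => G p.1)
      (fun y => Sigma.ι (fun p : Σ i, G i ⟶ E => G p.1) ⟨i, y⟩) (Category.comp_id f)
  map_comp {_ _ E} f g := by
    apply Sigma.hom_ext
    rintro ⟨i, x⟩
    simp only [Sigma.ι_desc, Sigma.ι_desc_assoc]
    exact congrArg (β := G i ⟶ ∐ fun p : Σ i, G i ⟶ E => G p.1)
      (fun y => Sigma.ι (fun p : Σ i, G i ⟶ E => G p.1) ⟨i, y⟩)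
      (Category.assoc x f g).symm

/-- The canonical morphism from `coproductCover` to the identity. -/
noncomputable def coproductCoverπ : coproductCover G ⟶ 𝟭 A where
  app E := Sigma.desc fun p => p.2
  naturality E E' φ := by
    apply Sigma.hom_ext
    rintro ⟨i, f⟩
    simp [coproductCover]

/-- The hypothesis is that the morphisms from the objects `G i` to `E` are jointly epimorphic. -/
theorem epi_coproductCoverπ (E : A) (hG : ∀ {M : A} (f g : E ⟶ M),
    (∀ i (x : G i ⟶ E), x ≫ f = x ≫ g) → f = g) : Epi ((coproductCoverπ G).app E) where
  left_cancellation f g h := hG f g fun i x => by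
    have e : Sigma.ι (fun p : Σ i, G i ⟶ E => G p.1) ⟨i, x⟩ ≫ (coproductCoverπ G).app E = x :=
      Sigma.ι_desc _ _
    rw [← e]
    exact (Category.assoc _ _ _).trans
      ((congrArg (_ ≫ ·) h).trans (Category.assoc _ _ _).symm)

end Functorial

variable {A : Type u₁} [Category.{v₁} A] [Abelian A] [HasCoproducts.{v₁} A] [HasProducts.{v₁} A]
  [HasColimitsOfShape ℕ A] [HasExactColimitsOfShape ℕ A]

/-- Functorial resolutions relative to a class `Q` of objects. They are obtained by applying
`exists_resolution` to the tautological complex in the category of functors from complexes over `A`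
to `A`. -/
theorem exists_functorial_resolution {ι : Type v₁} (G : ι → A)
    (hG : ∀ {E M : A} (f g : E ⟶ M), (∀ i (x : G i ⟶ E), x ≫ f = x ≫ g) → f = g)
    (Q : ObjectProperty A) (hQ : ∀ E, Q ((coproductCover G).obj E)) :
    ∃ (R : CochainComplex A ℤ ⥤ CochainComplex A ℤ) (ρ : R ⟶ 𝟭 _), (∀ K, QuasiIso (ρ.app K)) ∧
      ∀ (K d : CochainComplex A ℤ), (∀ P, Q P → HomExact P d) → NullHomotopic (R.obj K) d := by
  let U : CochainComplex (CochainComplex A ℤ ⥤ A) ℤ := complexOfFunctor (𝟭 _)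
  obtain ⟨R, ρ, hρ, hR⟩ := exists_resolution (A := CochainComplex A ℤ ⥤ A)
    (fun E => ∀ K, Q (E.obj K))
    (fun E => ⟨E ⋙ coproductCover G, Functor.whiskerLeft E (coproductCoverπ G),
      fun K => hQ _, by
        have (K : CochainComplex A ℤ) :
            Epi ((Functor.whiskerLeft E (coproductCoverπ G)).app K) :=
          epi_coproductCoverπ G _ hG
        exact NatTrans.epi_of_epi_app _⟩) U
  let ρ' : R.asFunctor ⟶ 𝟭 _ :=
    { app := fun K =>
        { f := fun i => (ρ.f i).app K
          comm' := fun i j _ => NatTrans.congr_app (ρ.comm i j) K }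
      naturality := fun K L φ => by
        ext i
        exact (ρ.f i).naturality φ }
  refine ⟨R.asFunctor, ρ', fun K => ?_, fun K d hd => ?_⟩
  · exact (HomologicalComplex.quasiIso_iff_evaluation _).1 hρ K
  · -- evaluation at `K` has a right adjoint, which maps complexes exact relatively to `Q` to
    -- complexes exact relatively to the functors with values in `Q`
    have adj := evaluationAdjunctionLeft A K
    have : (evaluationRightAdjoint A K).Additive := adj.right_adjoint_additive
    refine NullHomotopic.of_adjunction adj (hR _ ?_)
    intro P hP
    exact (homExact_mapHomologicalComplex_iff adj _ _).2 (hd _ (hP K))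

end RelativeResolutions

/-! ### Objects and complexes adapted to a functor -/

section FunctorTests

open CochainComplex HomComplex

universe v₁ v₂ v₃ u₁ u₂ u₃

variable {A : Type u₁} [Category.{v₁} A] [Abelian A] {B : Type u₂} [Category.{v₂} B] [Abelian B]

section

variable (F : A ⥤ B)

/-- Injectivity relatively to the monomorphisms which are preserved by `F`. -/
def FInjective (J : A) : Prop :=
  ∀ ⦃K P : A⦄ (m : K ⟶ P), Mono m → Mono (F.map m) → ∀ k : K ⟶ J, ∃ p : P ⟶ J, m ≫ p = k

/-- The complexes against which the objects and complexes adapted to `F` are tested: bounded below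
acyclic complexes of `F`-injective objects. -/
structure FTest (c : CochainComplex A ℤ) : Prop where
  acyclic : c.Acyclic
  bounded : ∃ n : ℤ, ∀ i < n, IsZero (c.X i)
  injective (i : ℤ) : FInjective F (c.X i)

/-- The objects adapted to `F`: those which see the test complexes as exact. -/
def FAdapted : ObjectProperty A := fun P => ∀ c, FTest F c → HomExact P c

/-- The complexes adapted to `F`: every morphism from them to a test complex is null-homotopic.
They play the role of the K-projective complexes in the computation of the derived functor
of `F`. -/
def FGood (L : CochainComplex A ℤ) : Prop := ∀ c, FTest F c → NullHomotopic L c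

variable {F}

theorem FInjective.of_injective (J : A) [Injective J] : FInjective F J :=
  fun _ _ m _ _ k => ⟨Injective.factorThru k m, Injective.comp_factorThru k m⟩

/-- A right adjoint of `F` maps injective objects to `F`-injective objects. -/
theorem FInjective.of_adjunction {G : B ⥤ A} (adj : F ⊣ G) (V : B) [Injective V] :
    FInjective F (G.obj V) := by
  intro K P m _ _ k
  refine ⟨adj.homEquiv _ _ (Injective.factorThru ((adj.homEquiv _ _).symm k) (F.map m)), ?_⟩
  rw [← adj.homEquiv_naturality_left, Injective.comp_factorThru, Equiv.apply_symm_apply]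

/-- A direct summand of a sum of two `F`-injective objects is `F`-injective; the four morphisms are
the components of the inclusion and of the retraction. -/
theorem FInjective.of_decomposition {J J₁ J₂ : A} (h₁ : FInjective F J₁) (h₂ : FInjective F J₂)
    (a : J ⟶ J₁) (b : J ⟶ J₂) (c : J₁ ⟶ J) (d : J₂ ⟶ J) (h : a ≫ c + b ≫ d = 𝟙 J) :
    FInjective F J := by
  intro K P m hm hm' k
  obtain ⟨p, hp⟩ := h₁ m hm hm' (k ≫ a)
  obtain ⟨q, hq⟩ := h₂ m hm hm' (k ≫ b)
  refine ⟨p ≫ c + q ≫ d, ?_⟩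
  rw [Preadditive.comp_add, reassoc_of% hp, reassoc_of% hq, ← Preadditive.comp_add, h,
    Category.comp_id]

theorem acyclic_shift {c : CochainComplex A ℤ} (h : c.Acyclic) (n : ℤ) : (c⟦n⟧).Acyclic := by
  rw [← HomotopyCategory.quotient_obj_mem_subcategoryAcyclic_iff_acyclic] at h ⊢
  exact ObjectProperty.prop_of_iso _
    (((HomotopyCategory.quotient A (.up ℤ)).commShiftIso n).symm.app c)
    (ObjectProperty.le_shift (HomotopyCategory.subcategoryAcyclic A) n _ h)

theorem FTest.shift {c : CochainComplex A ℤ} (h : FTest F c) (n : ℤ) : FTest F (c⟦n⟧) where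
  acyclic := acyclic_shift h.acyclic n
  bounded := by
    obtain ⟨m, hm⟩ := h.bounded
    exact ⟨m - n, fun i hi => hm (i + n) (by lia)⟩
  injective i := h.injective (i + n)

theorem FGood.shift {L : CochainComplex A ℤ} (h : FGood F L) (n : ℤ) : FGood F (L⟦n⟧) :=
  fun _ hc => NullHomotopic.shift n (-n) (add_neg_cancel n) (h _ (hc.shift (-n)))

/-- `NullHomotopic` in the homotopy category, with the shift of that category. -/
theorem NullHomotopic.hom_shift_eq_zero {L c : CochainComplex A ℤ} {n : ℤ}
    (h : NullHomotopic L (c⟦n⟧)) (g : (HomotopyCategory.quotient A (ComplexShape.up ℤ)).obj L ⟶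
      ((HomotopyCategory.quotient A (ComplexShape.up ℤ)).obj c)⟦n⟧) : g = 0 := by
  rw [nullHomotopic_iff] at h
  let e := ((HomotopyCategory.quotient A (ComplexShape.up ℤ)).commShiftIso n).app c
  have := h (g ≫ e.inv)
  rw [← cancel_mono e.inv, zero_comp]
  exact this

theorem FGood.mappingCone {L L' : CochainComplex A ℤ} (h : FGood F L) (h' : FGood F L')
    (f : L ⟶ L') : FGood F (mappingCone f) := by
  intro c hc
  rw [nullHomotopic_iff]
  intro g
  obtain ⟨g', hg'⟩ := Pretriangulated.Triangle.yoneda_exact₃ _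
    (HomotopyCategory.mappingCone_triangleh_distinguished f) g
    ((nullHomotopic_iff _ _).1 (h' c hc) _)
  rw [hg', hom_shift_eq_zero 1 (-1) (add_neg_cancel 1)
    (fun g'' => (h _ (hc.shift (-1))).hom_shift_eq_zero g'') g']
  exact comp_zero

theorem quasiIso_iff_acyclic_mappingCone {L L' : CochainComplex A ℤ} (f : L ⟶ L') :
    QuasiIso f ↔ (CochainComplex.mappingCone f).Acyclic := by
  rw [← HomotopyCategory.quotient_obj_mem_subcategoryAcyclic_iff_acyclic,
    ← HomologicalComplex.mem_quasiIso_iff, ← HomotopyCategory.quotient_map_mem_quasiIso_iff,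
    HomotopyCategory.quasiIso_eq_trW_subcategoryAcyclic]
  exact ObjectProperty.trW_iff_of_distinguished _ _
    (HomotopyCategory.mappingCone_triangleh_distinguished f)

end

variable {F : A ⥤ B} {G : B ⥤ A} [F.Additive] (adj : F ⊣ G)

include adj in
/-- The mapping cone of an injective resolution of `G V` is a test complex: its terms are sums of
injective objects and of copies of `G V`. -/
theorem fTest_mappingCone_ι' (V : B) [Injective V] (I : InjectiveResolution (G.obj V)) :
    FTest F (mappingCone I.ι') where
  acyclic := (quasiIso_iff_acyclic_mappingCone _).1 inferInstance
  bounded := by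
    refine ⟨-1, fun i hi => ?_⟩
    rw [IsZero.iff_id_eq_zero, mappingCone.ext_from_iff _ (i + 1) i rfl]
    have h₁ : IsZero (((CochainComplex.singleFunctor A 0).obj (G.obj V)).X (i + 1)) :=
      HomologicalComplex.isZero_single_obj_X _ _ _ _ (by lia)
    have h₂ : IsZero (I.cochainComplex.X i) :=
      CochainComplex.isZero_of_isStrictlyGE _ 0 _ (by lia)
    exact ⟨h₁.eq_of_src _ _, h₂.eq_of_src _ _⟩
  injective i := by
    have h : FInjective F (((CochainComplex.singleFunctor A 0).obj (G.obj V)).X (i + 1)) := by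
      by_cases hi : i + 1 = 0
      · have hV := FInjective.of_adjunction adj V
        let e := HomologicalComplex.singleObjXIsoOfEq (.up ℤ) 0 (G.obj V) (i + 1) hi
        exact hV.of_decomposition hV e.hom 0 e.inv 0
          (by rw [comp_zero, add_zero]; exact e.hom_inv_id)
      · have : Injective (((CochainComplex.singleFunctor A 0).obj (G.obj V)).X (i + 1)) :=
          (HomologicalComplex.isZero_single_obj_X _ _ _ _ hi).injective
        exact .of_injective _
    exact h.of_decomposition (.of_injective (I.cochainComplex.X i))
      ((mappingCone.fst I.ι').1.v i (i + 1) rfl) ((mappingCone.snd I.ι').v i i (add_zero i))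
      ((mappingCone.inl I.ι').v (i + 1) i (by lia)) ((mappingCone.inr I.ι').f i)
      (mappingCone.id_X I.ι' i (i + 1) rfl)

variable [EnoughInjectives A]

include adj in
/-- Morphisms from an acyclic adapted complex to `G V` are null-homotopic. Indeed, `G V` sits in a
triangle with an injective resolution, to which acyclic complexes have no non-zero morphism, and a
test complex. -/
theorem FGood.nullHomotopic_single {M : CochainComplex A ℤ} (h : FGood F M) (hM : M.Acyclic)
    (V : B) [Injective V] :
    NullHomotopic M ((CochainComplex.singleFunctor A 0).obj (G.obj V)) := by
  obtain ⟨I⟩ := (inferInstance : HasInjectiveResolution (G.obj V)).out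
  have : I.cochainComplex.IsKInjective := isKInjective_of_injective _ 0
  rw [nullHomotopic_iff]
  intro g
  obtain ⟨g', hg'⟩ := Pretriangulated.Triangle.coyoneda_exact₂ _
    (Pretriangulated.inv_rot_of_distTriang _
      (HomotopyCategory.mappingCone_triangleh_distinguished I.ι')) g
    ((nullHomotopic_iff M I.cochainComplex).1
      (fun f => IsKInjective.nonempty_homotopy_zero f hM) _)
  rw [hg']
  have := (h _ ((fTest_mappingCone_ι' adj V I).shift (-1))).hom_shift_eq_zero g'
  exact (congrArg (· ≫ _) this).trans zero_comp

variable (hB : ∀ V : B, Injective V)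

include adj hB in
/-- The projection of `F(M⁰)` to the cokernel `V` of the incoming differential corresponds to a
morphism `M ⟶ G V`. A null-homotopy of the latter factors the projection through the outgoing
differential, which is exactness. -/
theorem FGood.exactAt_zero {M : CochainComplex A ℤ} (h : FGood F M) (hM : M.Acyclic) :
    ((F.mapHomologicalComplex _).obj M).ExactAt 0 := by
  let V := cokernel (F.map (M.d (-1) 0))
  have := hB V
  let π : F.obj (M.X 0) ⟶ V := cokernel.π (F.map (M.d (-1) 0))
  let θ : M.X 0 ⟶ G.obj V := adj.homEquiv _ _ π
  have := adj.right_adjoint_additive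
  have hθ : M.d (-1) 0 ≫ θ = 0 := by
    rw [← adj.homEquiv_naturality_left, cokernel.condition]
    simp [Adjunction.homEquiv_unit]
  let t : M ⟶ (CochainComplex.singleFunctor A 0).obj (G.obj V) :=
    HomologicalComplex.mkHomToSingle θ (by
      rintro i (hi : i + 1 = 0)
      obtain rfl : i = -1 := by lia
      exact hθ)
  obtain ⟨z, hz⟩ := (nonempty_homotopy_iff _).1 (h.nullHomotopic_single adj hM V t)
  have key : ∃ s : M.X 1 ⟶ G.obj V, θ = M.d 0 1 ≫ s := by
    have e := Cochain.congr_v hz 0 0 rfl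
    have hd : ((CochainComplex.singleFunctor A 0).obj (G.obj V)).d (-1) 0 = 0 := by
      exact HomologicalComplex.single_obj_d _ _ _ _ _
    rw [δ_v (-1) 0 rfl z 0 0 rfl (-1) 1 rfl rfl, hd, comp_zero, zero_add, Cochain.ofHom_v] at e
    have ht : t.f 0 = θ ≫ (HomologicalComplex.singleObjXSelf (.up ℤ) 0 _).inv :=
      HomologicalComplex.mkHomToSingle_f _ _
    rw [ht, Int.negOnePow_zero, one_smul] at e
    exact ⟨z.v 1 0 rfl ≫ (HomologicalComplex.singleObjXSelf (.up ℤ) 0 _).hom,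
      ((Iso.eq_comp_inv _).1 e).symm.trans (Category.assoc _ _ _)⟩
  obtain ⟨s, hs⟩ := key
  have hπ : π = F.map (M.d 0 1) ≫ (adj.homEquiv _ _).symm s := by
    rw [← adj.homEquiv_naturality_left_symm, ← hs, Equiv.symm_apply_apply]
  rw [HomologicalComplex.exactAt_iff' _ (-1) 0 1 (by simp) (by simp),
    ShortComplex.exact_iff_kernel_ι_comp_cokernel_π_zero]
  change kernel.ι (F.map (M.d 0 1)) ≫ π = 0
  rw [hπ, kernel.condition_assoc, zero_comp]

include adj hB in
/-- An additive left adjoint functor to a category in which all objects are injective maps acyclic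
adapted complexes to acyclic complexes. -/
theorem FGood.acyclic {M : CochainComplex A ℤ} (h : FGood F M) (hM : M.Acyclic) :
    ((F.mapHomologicalComplex _).obj M).Acyclic := by
  intro n
  have h₀ := (h.shift n).exactAt_zero adj hB (acyclic_shift hM n)
  rw [HomologicalComplex.exactAt_iff_isZero_homology] at h₀ ⊢
  exact h₀.of_iso ((((HomologicalComplex.homologyFunctor B (.up ℤ) 0).shiftIso n 0 n
    (add_zero n)).app _).symm ≪≫ (HomologicalComplex.homologyFunctor B (.up ℤ) 0).mapIso
      (((F.mapHomologicalComplex (.up ℤ)).commShiftIso n).symm.app M))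

include adj hB in
/-- An additive left adjoint functor to a category in which all objects are injective preserves
quasi-isomorphisms between adapted complexes. -/
theorem FGood.quasiIso_map {L L' : CochainComplex A ℤ} (h : FGood F L) (h' : FGood F L')
    (f : L ⟶ L') [hf : QuasiIso f] : QuasiIso ((F.mapHomologicalComplex (.up ℤ)).map f) := by
  rw [quasiIso_iff_acyclic_mappingCone] at hf ⊢
  exact fun i => ((h.mappingCone h' f).acyclic adj hB hf i).of_iso
    (mappingCone.mapHomologicalComplexIso f F)

end FunctorTests

/-! ### Derived functors from functorial resolutions -/

section DerivedFunctors

variable {C D H : Type*} [Category* C] [Category* D] [Category* H] {W : MorphismProperty C}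
  (L : C ⥤ D) [L.IsLocalization W] (F : C ⥤ H) {R : C ⥤ C} (ρ : R ⟶ 𝟭 C)

/-- A functorial resolution `ρ : R ⟶ 𝟭` such that `R ⋙ F` inverts the weak equivalences and `F`
inverts the resolutions of the objects `R.obj X` yields a left derived functor of `F`. -/
theorem exists_isLeftDerivedFunctor (hρ : ∀ X, W (ρ.app X)) (hR : W.IsInvertedBy (R ⋙ F))
    (hRR : ∀ X, IsIso (F.map (ρ.app (R.obj X)))) :
    ∃ (LF : D ⥤ H) (α : L ⋙ LF ⟶ F), LF.IsLeftDerivedFunctor α W ∧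
      ∀ X, IsIso (F.map (ρ.app X)) → IsIso (α.app X) := by
  let LF : D ⥤ H := Localization.lift (R ⋙ F) hR L
  let e : L ⋙ LF ≅ R ⋙ F := Localization.fac (R ⋙ F) hR L
  let α : L ⋙ LF ⟶ F := e.hom ≫ Functor.whiskerRight ρ F ≫ F.leftUnitor.hom
  have hα (X : C) : α.app X = e.hom.app X ≫ F.map (ρ.app X) := by simp [α]
  have hL (X : C) : IsIso (L.map (ρ.app X)) := Localization.inverts L W _ (hρ X)
  have lift (G : D ⥤ H) (β : L ⋙ G ⟶ F) :
      ∃ γ : G ⟶ LF, ∀ X, γ.app (L.obj X) ≫ α.app X = β.app X := by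
    let γ : L ⋙ G ⟶ R ⋙ F :=
      { app X := inv (G.map (L.map (ρ.app X))) ≫ β.app (R.obj X)
        naturality X Y f := by
          have h₁ : G.map (L.map (R.map f)) ≫ β.app (R.obj Y) =
            β.app (R.obj X) ≫ F.map (R.map f) := β.naturality (R.map f)
          have h₂ : G.map (L.map (R.map f)) ≫ G.map (L.map (ρ.app Y)) =
              G.map (L.map (ρ.app X)) ≫ G.map (L.map f) := by
            simp only [← Functor.map_comp, ρ.naturality, Functor.id_map]
          simp only [Functor.comp_map, Category.assoc, IsIso.eq_inv_comp, ← h₁]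
          rw [← reassoc_of% h₂, IsIso.hom_inv_id_assoc] }
    refine ⟨Localization.liftNatTrans L W (L ⋙ G) (L ⋙ LF) _ _ (γ ≫ e.inv), fun X => ?_⟩
    have h₃ : G.map (L.map (ρ.app X)) ≫ β.app X = β.app (R.obj X) ≫ F.map (ρ.app X) :=
      β.naturality (ρ.app X)
    rw [hα, Localization.liftNatTrans_app]
    simp [γ, ← h₃, Localization.Lifting.iso]
  have uniq (G : D ⥤ H) (γ γ' : G ⟶ LF)
      (h : ∀ X, γ.app (L.obj X) ≫ α.app X = γ'.app (L.obj X) ≫ α.app X) : γ = γ' := by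
    refine Localization.natTrans_ext L W fun X => ?_
    have h₁ : γ.app (L.obj (R.obj X)) = γ'.app (L.obj (R.obj X)) := by
      have := hRR X
      have := h (R.obj X)
      rwa [hα, ← Category.assoc, ← Category.assoc, cancel_mono, cancel_mono] at this
    rw [← cancel_epi (G.map (L.map (ρ.app X)))]
    exact (γ.naturality _).trans ((congrArg (· ≫ _) h₁).trans (γ'.naturality _).symm)
  refine ⟨LF, α, ⟨⟨⟨Limits.IsTerminal.ofUniqueHom
    (fun E => CostructuredArrow.homMk (lift E.left E.hom).choose ?_) (fun E f => ?_)⟩⟩⟩,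
    fun X h => ?_⟩
  · ext X
    exact (lift E.left E.hom).choose_spec X
  · refine CostructuredArrow.hom_ext _ _ (uniq _ _ _ fun X => ?_)
    exact (NatTrans.congr_app (CostructuredArrow.w f) X).trans
      ((lift E.left E.hom).choose_spec X).symm
  · rw [hα]
    infer_instance

/-- The comparison morphism of any left derived functor is invertible where it is so for some left
derived functor. -/
theorem isIso_app_of_isLeftDerivedFunctor {L : C ⥤ D} [L.IsLocalization W] {F : C ⥤ H}
    {LF LF' : D ⥤ H} (α : L ⋙ LF ⟶ F) (α' : L ⋙ LF' ⟶ F) [LF.IsLeftDerivedFunctor α W]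
    [LF'.IsLeftDerivedFunctor α' W] (X : C) (h : IsIso (α.app X)) : IsIso (α'.app X) := by
  have := Functor.leftDerived_fac_app LF α W LF' α' X
  rw [← this]
  have : IsIso (LF.leftDerivedLift α W LF' α') :=
    (Functor.isLeftDerivedFunctor_iff_isIso_leftDerivedLift LF α W LF' α').1 inferInstance
  infer_instance

section

variable {A : Type*} [Category* A] [Abelian A] {B : Type*} [Category* B] [Abelian B]
  [HasDerivedCategory A] [HasDerivedCategory B] (F : A ⥤ B) [F.Additive]
  {R : CochainComplex A ℤ ⥤ CochainComplex A ℤ} (ρ : R ⟶ 𝟭 _)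

theorem isIso_toDerived_map_iff {K L : CochainComplex A ℤ} (f : K ⟶ L) :
    IsIso ((toDerived F).map f) ↔ QuasiIso ((F.mapHomologicalComplex (.up ℤ)).map f) :=
  DerivedCategory.isIso_Q_map_iff_quasiIso B _

/-- Existence of the derived functor of an additive functor `F` from a functorial resolution, and
computation of any derived functor on the complexes whose resolution is preserved by `F`. -/
theorem toDerived_hasLeftDerivedFunctor (hρ : ∀ K, QuasiIso (ρ.app K))
    (hR : ∀ ⦃K L : CochainComplex A ℤ⦄ (f : K ⟶ L), QuasiIso f →
      QuasiIso ((F.mapHomologicalComplex (.up ℤ)).map (R.map f)))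
    (hRR : ∀ K, QuasiIso ((F.mapHomologicalComplex (.up ℤ)).map (ρ.app (R.obj K)))) :
    (toDerived F).HasLeftDerivedFunctor (HomologicalComplex.quasiIso A (ComplexShape.up ℤ)) ∧
      ∀ (LF : DerivedCategory A ⥤ DerivedCategory B) (α : DerivedCategory.Q ⋙ LF ⟶ toDerived F)
        [LF.IsLeftDerivedFunctor α (HomologicalComplex.quasiIso A (ComplexShape.up ℤ))]
        (K : CochainComplex A ℤ), QuasiIso ((F.mapHomologicalComplex (.up ℤ)).map (ρ.app K)) →
          IsIso (α.app K) := by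
  obtain ⟨LF, α, h, hα⟩ := exists_isLeftDerivedFunctor
    (W := HomologicalComplex.quasiIso A (ComplexShape.up ℤ)) DerivedCategory.Q (toDerived F) ρ hρ
    (fun K L f hf => (isIso_toDerived_map_iff F _).2 (hR f hf))
    (fun K => (isIso_toDerived_map_iff F _).2 (hRR K))
  exact ⟨Functor.HasLeftDerivedFunctor.mk' LF α, fun LF' α' _ K hK =>
    isIso_app_of_isLeftDerivedFunctor (W := HomologicalComplex.quasiIso A (ComplexShape.up ℤ))
      α α' K (hα K ((isIso_toDerived_map_iff F _).2 hK))⟩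

end

end DerivedFunctors

/-! ### Acyclic objects are adapted -/

section DeltaFunctors

universe v₁ v₂ v₃ u₁ u₂ u₃

variable {A : Type u₁} [Category.{v₁} A] [Abelian A] {B : Type u₂} [Category.{v₂} B] [Abelian B]
  {F : A ⥤ B}

/-- Two sequences of left derived functors of `F` vanish on the same objects, since they are
isomorphic. -/
theorem IsLeftDerived.isZero {T T' : DeltaFunctor A B} (hT : IsLeftDerived T F)
    (hT' : IsLeftDerived T' F) {n : ℕ} {E : A} (h : IsZero ((T'.H n).obj E)) :
    IsZero ((T.H n).obj E) := by
  obtain ⟨e⟩ := hT.zero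
  obtain ⟨e'⟩ := hT'.zero
  obtain ⟨φ, hφ, -⟩ := hT'.universal T (e ≪≫ e'.symm).hom
  obtain ⟨ψ, hψ, -⟩ := hT.universal T' (e' ≪≫ e.symm).hom
  let φψ : T.Hom T :=
    { τ := fun n => φ.τ n ≫ ψ.τ n
      comm := fun hX n => by
        rw [NatTrans.comp_app, NatTrans.comp_app, ← Category.assoc, φ.comm, Category.assoc, ψ.comm,
          Category.assoc] }
  let i : T.Hom T := { τ := fun n => 𝟙 _, comm := fun hX n => by simp }
  have e : φψ = i := (hT.universal T (𝟙 _)).unique (by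
    change φ.τ 0 ≫ ψ.τ 0 = _
    rw [hφ, hψ]; simp) rfl
  rw [IsZero.iff_id_eq_zero]
  have := congrArg (fun x => (x.τ n).app E) e
  change (φ.τ n).app E ≫ (ψ.τ n).app E = 𝟙 _ at this
  rw [← this, h.eq_zero_of_tgt ((φ.τ n).app E), zero_comp]

variable {T : DeltaFunctor A B} (hT : IsLeftDerived T F)

include hT in
theorem LeftAcyclic.isZero {E : A} (h : LeftAcyclic F E) (n : ℕ) :
    IsZero ((T.H (n + 1)).obj E) := by
  obtain ⟨T', hT', h'⟩ := h
  exact hT.isZero hT' (h' n)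

/-- Dimension shifting. -/
theorem DeltaFunctor.isZero_X₁ {S : ShortComplex A} (hS : S.ShortExact) (n : ℕ)
    (h₂ : IsZero ((T.H n).obj S.X₂)) (h₃ : IsZero ((T.H (n + 1)).obj S.X₃)) :
    IsZero ((T.H n).obj S.X₁) := by
  obtain ⟨w, h⟩ := T.exact₁ hS n
  exact h.isZero_of_both_zeros (h₃.eq_zero_of_src _) (h₂.eq_zero_of_tgt _)

theorem DeltaFunctor.mono_map_f {S : ShortComplex A} (hS : S.ShortExact) (n : ℕ)
    (h₃ : IsZero ((T.H (n + 1)).obj S.X₃)) : Mono ((T.H n).map S.f) := by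
  obtain ⟨w, h⟩ := T.exact₁ hS n
  exact h.mono_g (h₃.eq_zero_of_src _)

/-- A cocycle with values in a test complex, on an object `E` killed by the higher derived functors
`L_i F`, is a coboundary. One lifts the cocycle to a cover of `E` by an object of
the same kind, and extends the lift from the kernel `K` of the cover by `F`-injectivity, as
`F(K) ⟶ F(P)` is a monomorphism. -/
theorem fAdapted_of_isZero (hT : IsLeftDerived T F)
    (hA : ∀ E : A, ∃ (P : A) (π : P ⟶ E), Epi π ∧ ∀ n, IsZero ((T.H (n + 1)).obj P))
    (E : A) (hE : ∀ n, IsZero ((T.H (n + 1)).obj E)) : FAdapted F E := by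
  intro c hc
  obtain ⟨m, hm⟩ := hc.bounded
  -- induction on the distance of the degree `j` to the lower bound of `c`
  have key (n : ℕ) : ∀ (E : A), (∀ n, IsZero ((T.H (n + 1)).obj E)) → ∀ (i j k : ℤ), i + 1 = j →
      j + 1 = k → j < m + n → ∀ x : E ⟶ c.X j, x ≫ c.d j k = 0 → ∃ y, y ≫ c.d i j = x := by
    induction n with
    | zero =>
      intro E _ i j k _ _ hj x _
      exact ⟨0, (hm j (by simpa using hj)).eq_of_tgt _ _⟩
    | succ n ih =>
      intro E hE i j k hij hjk hj x hx
      obtain ⟨W, p, hp, z, hz⟩ := (HomologicalComplex.exactAt_iff_exact_up_to_refinements c i j k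
        (by simp [← hij]) (by simp [← hjk])).1 (hc.acyclic j) x hx
      -- a cover of `E` by an object without higher derived functors, along which `x` lifts
      obtain ⟨P, π, hπ, hP⟩ := hA W
      have hq : Epi (π ≫ p) := epi_comp _ _
      let S := ShortComplex.mk (kernel.ι (π ≫ p)) (π ≫ p) (by simp)
      have hS : S.ShortExact :=
        { exact := ShortComplex.exact_kernel _
          mono_f := inferInstanceAs (Mono (kernel.ι _))
          epi_g := hq }
      obtain ⟨y, hy⟩ := ih S.X₁ (fun n => T.isZero_X₁ hS _ (hP n) (hE (n + 1))) (i - 1) i j (by lia)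
        hij (by push_cast at hj; lia) (S.f ≫ π ≫ z) (by
          rw [Category.assoc, Category.assoc, ← hz, ← Category.assoc π, ← Category.assoc]
          change (S.f ≫ S.g) ≫ x = 0
          rw [S.zero, zero_comp])
      obtain ⟨e⟩ := hT.zero
      have h₀ : Mono (F.map S.f) := by
        have := T.mono_map_f hS 0 (hE 0)
        exact ((MorphismProperty.monomorphisms B).arrow_mk_iso_iff
          (((Functor.mapArrowFunctor _ _).mapIso e).app (Arrow.mk S.f))).1 this
      obtain ⟨y', hy'⟩ := hc.injective (i - 1) S.f hS.mono_f h₀ y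
      obtain ⟨t, ht⟩ := hS.exact.desc' (π ≫ z - y' ≫ c.d (i - 1) i) (by
        rw [Preadditive.comp_sub, reassoc_of% hy', hy, sub_self])
      refine ⟨t, ?_⟩
      rw [← cancel_epi S.g, reassoc_of% ht, Preadditive.sub_comp, Category.assoc, ← hz,
        Category.assoc, c.d_comp_d, comp_zero, sub_zero, ← Category.assoc]
  intro i j k hij hjk x hx
  obtain ⟨n, hn⟩ : ∃ n : ℕ, j < m + n := ⟨(j - m + 1).toNat, by lia⟩
  exact key n E hE i j k hij hjk hn x hx

/-- If there are enough acyclic objects for `F`, they are adapted to `F`. -/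
theorem LeftAcyclic.fAdapted (hA : ∀ E : A, ∃ (P : A) (π : P ⟶ E), Epi π ∧ LeftAcyclic F P) {E : A}
    (hE : LeftAcyclic F E) : FAdapted F E := by
  obtain ⟨T, hT, h⟩ := hE
  exact fAdapted_of_isZero hT (fun E => by
    obtain ⟨P, π, hπ, hP⟩ := hA E
    exact ⟨P, π, hπ, hP.isZero hT⟩) E h

end DeltaFunctors

/-! ### Categories of sheaves are Grothendieck abelian categories -/

section GrothendieckSubcategory

universe v₁ u₁

variable {A : Type u₁} [Category.{v₁} A] [Abelian A] [IsGrothendieckAbelian.{w} A]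
  (P : ObjectProperty A) [P.IsClosedUnderSubobjects] [P.IsClosedUnderQuotients] [P.ContainsZero]
  [P.IsClosedUnderFiniteProducts]

/-- A separating family of `P`: the quotients of a separator of the ambient category which
satisfy `P`. -/
theorem isSeparating_quotients :
    ObjectProperty.IsSeparating (.ofObj
      (fun s : { S : Subobject (separator A) // P (cokernel S.arrow) } =>
        (⟨_, s.2⟩ : P.FullSubcategory))) := by
  intro X Y f g h
  ext1
  refine (isSeparator_separator A).def _ _ fun z => ?_
  have hz : P (cokernel (Subobject.mk (kernel.ι z)).arrow) := by
    have hw : (Subobject.mk (kernel.ι z)).arrow ≫ z = 0 := by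
      rw [← Subobject.underlyingIso_hom_comp_eq_mk, Category.assoc, kernel.condition, comp_zero]
    have : Mono (cokernel.desc _ z hw) := by
      refine (ShortComplex.exact_iff_mono_cokernel_desc
        (ShortComplex.mk (Subobject.mk (kernel.ι z)).arrow z hw)).1 ?_
      refine (ShortComplex.exact_iff_of_iso (ShortComplex.isoMk
        (Subobject.underlyingIso (kernel.ι z)).symm (Iso.refl _) (Iso.refl _) ?_ ?_ :
        ShortComplex.mk (kernel.ι z) z (kernel.condition z) ≅
          ShortComplex.mk (Subobject.mk (kernel.ι z)).arrow z hw)).1 (ShortComplex.exact_kernel z)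
      · simp
      · simp
    exact P.prop_of_mono (cokernel.desc _ z hw) X.property
  have hw : (Subobject.mk (kernel.ι z)).arrow ≫ z = 0 := by
    rw [← Subobject.underlyingIso_hom_comp_eq_mk, Category.assoc, kernel.condition, comp_zero]
  have := congrArg (fun q => cokernel.π _ ≫ q.hom) (h _ ⟨⟨_, hz⟩⟩
    (ObjectProperty.homMk (cokernel.desc _ z hw)))
  simpa using this

/-- A full subcategory of a Grothendieck abelian category which is closed under subobjects,
quotients and colimits is a Grothendieck abelian category. -/
theorem isGrothendieckAbelian_fullSubcategory
    (hP : ∀ (J : Type w) [SmallCategory J], P.IsClosedUnderColimitsOfShape J) :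
    IsGrothendieckAbelian.{w} P.FullSubcategory := by
  have hcol : HasColimitsOfSize.{w, w} P.FullSubcategory :=
    ⟨fun J _ => have := hP J; inferInstance⟩
  have hsep : HasSeparator P.FullSubcategory := by
    let e := equivShrink.{w} { S : Subobject (separator A) // P (cokernel S.arrow) }
    have h := isSeparating_quotients P
    have h' : ObjectProperty.IsSeparating (.ofObj (fun i =>
        (⟨_, (e.symm i).2⟩ : P.FullSubcategory))) := by
      refine h.of_le ?_
      rintro _ ⟨s⟩
      have : s = e.symm (e s) := by simp
      rw [this]
      exact ⟨e s⟩
    exact ⟨_, h'.isSeparator_coproduct⟩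
  exact
    { locallySmall := ⟨fun X Y => small_map
        (β := X.obj ⟶ Y.obj) ⟨fun f => f.hom, fun f => ⟨f⟩, fun _ => rfl, fun _ => rfl⟩⟩
      hasFilteredColimitsOfSize := ⟨fun J _ _ => inferInstance⟩
      ab5OfSize := by
        refine ⟨fun J _ _ => ?_⟩
        have := hP J
        have := P.preservesKernels_ι
        have := Functor.preservesFiniteLimits_of_preservesKernels P.ι
        exact HasExactColimitsOfShape.domain_of_functor J P.ι }

end GrothendieckSubcategory

namespace LinSite

variable {k : Type u} [Field k] {X : Type u} [Category.{u} X] (S : LinSite k X)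

theorem IsLin.of_isColimit {J : Type u} [Category.{u} J] {F : J ⥤ Xᵒᵖ ⥤ ModuleCat.{u} k}
    (hF : ∀ j, S.IsLin (F.obj j)) {c : Cocone F} (hc : IsColimit c) : S.IsLin c.pt := by
  have ext : ∀ {x : Xᵒᵖ} {M : ModuleCat.{u} k} {f g : c.pt.obj x ⟶ M},
      (∀ j, (c.ι.app j).app x ≫ f = (c.ι.app j).app x ≫ g) → f = g := fun {x} _ _ _ h =>
    (isColimitOfPreserves ((evaluation _ _).obj x) hc).hom_ext h
  have nat : ∀ j {x y : X} (f : x ⟶ y),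
      (c.ι.app j).app _ ≫ c.pt.map f.op = (F.obj j).map f.op ≫ (c.ι.app j).app _ :=
    fun j _ _ f => ((c.ι.app j).naturality f.op).symm
  constructor
  · intro x y f g h H
    refine ext fun j => ?_
    rw [Preadditive.comp_add, nat, nat, nat, (hF j).map_add _ _ _ H, Preadditive.add_comp]
  · intro x y c f h H
    refine ext fun j => ?_
    rw [Linear.comp_smul, nat, nat, (hF j).map_smul _ _ _ H,
      Linear.smul_comp]

theorem IsLin.sheafify {G : Xᵒᵖ ⥤ ModuleCat.{u} k} (hG : S.IsLin G) :
    S.IsLin (CategoryTheory.sheafify S.topology G) := by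
  have h := isDescent_of_isSheaf (S := S)
    ((presheafToSheaf S.topology (ModuleCat.{u} k)).obj G).property
  have : Presheaf.IsLocallySurjective S.topology (toSheafify S.topology G) :=
    Presheaf.isLocallySurjective_toSheafify' _ _
  exact IsLin.of_locallySurjective hG h.injective (toSheafify _ G)

/-- A colimit of sheaves is the sheafification of the colimit of presheaves, and both steps preserve
linearity. -/
instance isClosedUnderColimitsOfShape_linSheaf (J : Type u) [SmallCategory J] :
    S.linSheaf.IsClosedUnderColimitsOfShape J where
  colimitsOfShape_le := by
    rintro F ⟨p⟩
    let E := colimit.cocone (p.diag ⋙ sheafToPresheaf S.topology (ModuleCat.{u} k))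
    have hE : S.IsLin E.pt := IsLin.of_isColimit S p.prop_diag_obj (colimit.isColimit _)
    have h' : S.linSheaf (Sheaf.sheafifyCocone E).pt := IsLin.sheafify S hE
    let e := p.isColimit.coconePointUniqueUpToIso
      (Sheaf.isColimitSheafifyCocone E (colimit.isColimit _))
    exact S.linSheaf.prop_of_mono e.hom h'

instance : IsGrothendieckAbelian.{u} S.linSheaf.FullSubcategory :=
  isGrothendieckAbelian_fullSubcategory _ fun _ _ => inferInstance

instance : IsGrothendieckAbelian.{u} S.linDescent.FullSubcategory :=
  IsGrothendieckAbelian.of_equivalence S.toSheaf.asEquivalence.symm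

end LinSite

instance (k : Type u) [Field k] (C : Type u) [Category.{u} C] [Abelian C] [Linear k C]
    (V : Type) [Fintype V] : IsGrothendieckAbelian.{u} (Shv k C V) :=
  IsGrothendieckAbelian.of_equivalence (shvToLinDescent k C V).asEquivalence.symm

instance (k : Type u) [Field k] (C : Type u) [Category.{u} C] [Abelian C] [Linear k C]
    [MonoidalCategory C] [MonoidalPreadditive C]
    [∀ X : C, PreservesFiniteColimits (tensorLeft X)]
    [∀ X : C, PreservesFiniteColimits (tensorRight X)] :
    IsGrothendieckAbelian.{u} (ShvSharp k C) :=
  IsGrothendieckAbelian.of_equivalence (shvSharpToLinDescent k C).asEquivalence.symm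

/-! ### The right adjoint of the evaluation functors -/

section Products

variable {k : Type u} [Field k] {X : Type u} [Category.{u} X] {ι : Type}
  {F : Xᵒᵖ ⥤ ModuleCat.{u} k} {G : ι → Xᵒᵖ ⥤ ModuleCat.{u} k}

/-- The transformations `π i : F ⟶ G i` present `F` as the product of the presheaves `G i`. -/
def IsProductFamily (π : ∀ i, F ⟶ G i) : Prop :=
  ∀ x : Xᵒᵖ, Function.Bijective fun (s : F.obj x) (i : ι) => ((π i).app x).hom s

namespace IsProductFamily

variable {π : ∀ i, F ⟶ G i} (h : IsProductFamily π)
include h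

theorem ext {x : Xᵒᵖ} {s t : F.obj x} (hst : ∀ i, ((π i).app x).hom s = ((π i).app x).hom t) :
    s = t := (h x).1 (funext hst)

theorem hom_ext {P : Xᵒᵖ ⥤ ModuleCat.{u} k} {f g : P ⟶ F} (hfg : ∀ i, f ≫ π i = g ≫ π i) :
    f = g := by
  ext x s
  exact h.ext fun i => ConcreteCategory.congr_hom (congr_app (hfg i) x) s

theorem exists_lift {P : Xᵒᵖ ⥤ ModuleCat.{u} k} (f : ∀ i, P ⟶ G i) :
    ∃ g : P ⟶ F, ∀ i, g ≫ π i = f i := by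
  choose φ hφ using fun x (s : P.obj x) => (h x).2 fun i => ((f i).app x).hom s
  have hφ' : ∀ x (s : P.obj x) i, ((π i).app x).hom (φ x s) = ((f i).app x).hom s :=
    fun x s i => congrFun (hφ x s) i
  have nat : ∀ i {x y : Xᵒᵖ} (e : x ⟶ y) (s : P.obj x),
      ((f i).app y).hom ((P.map e).hom s) = ((G i).map e).hom (((f i).app x).hom s) :=
    fun i x y e s => ConcreteCategory.congr_hom ((f i).naturality e) s
  have nat' : ∀ i {x y : Xᵒᵖ} (e : x ⟶ y) (s : F.obj x),
      ((π i).app y).hom ((F.map e).hom s) = ((G i).map e).hom (((π i).app x).hom s) :=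
    fun i x y e s => ConcreteCategory.congr_hom ((π i).naturality e) s
  refine ⟨{ app x := ModuleCat.ofHom
              { toFun := φ x
                map_add' s t := h.ext fun i => by rw [map_add, hφ', hφ', hφ', map_add]
                map_smul' c s := h.ext fun i => by
                  rw [RingHom.id_apply, map_smul, hφ', hφ', map_smul] }
            naturality x y e := by
              ext s
              refine h.ext fun i => ?_
              change ((π i).app y).hom (φ y ((P.map e).hom s)) =
                ((π i).app y).hom ((F.map e).hom (φ x s))
              rw [hφ', nat', nat, hφ'] }, fun i => ?_⟩
  ext x s
  exact hφ' x s i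

end IsProductFamily

end Products

section MultiSheafProduct

variable {k : Type u} [Field k] {C : Type u} [Category.{u} C] [Abelian C] [Linear k C]

/-- Products of sheaves are sheaves. -/
theorem IsProductFamily.isMultiSheaf {V ι : Type} {F : (V → C)ᵒᵖ ⥤ ModuleCat.{u} k}
    {G : ι → (V → C)ᵒᵖ ⥤ ModuleCat.{u} k} {π : ∀ i, F ⟶ G i} (h : IsProductFamily π)
    (hG : ∀ i, IsMultiSheaf (G i)) : IsMultiSheaf F := by
  have nat : ∀ i {x y : (V → C)ᵒᵖ} (e : x ⟶ y) (s : F.obj x),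
      ((π i).app y).hom ((F.map e).hom s) = ((G i).map e).hom (((π i).app x).hom s) :=
    fun i x y e s => ConcreteCategory.congr_hom ((π i).naturality e) s
  refine { map_add := ?_, map_smul := ?_, exact := ?_ }
  · intro X Y v f g w h₁ h₂
    ext s
    refine h.ext fun i => ?_
    change _ = ((π i).app _).hom ((F.map f.op).hom s + (F.map g.op).hom s)
    rw [map_add, nat, nat, nat, (hG i).map_add v f g w h₁ h₂]
    rfl
  · intro X Y v c f w h₁ h₂
    ext s
    refine h.ext fun i => ?_
    change _ = ((π i).app _).hom (c • (F.map f.op).hom s)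
    rw [map_smul, nat, nat, (hG i).map_smul v c f w h₁ h₂]
    rfl
  · intro v X Y Z q p w hw hp hqp
    have key := fun i => (hG i).exact v q p w hw hp hqp
    refine ⟨fun s t hst => h.ext fun i => (key i).1 ?_, fun s hs => ?_⟩
    · rw [← nat, ← nat, hst]
    · choose t ht using fun i => (key i).2 (((π i).app _).hom s) (by rw [← nat, hs, map_zero])
      obtain ⟨t', ht'⟩ := (h _).2 t
      refine ⟨t', h.ext fun i => ?_⟩
      rw [nat, ← ht]
      exact congrArg _ (congrFun ht' i)

end MultiSheafProduct

section Coinduction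

variable {k : Type u} [Field k] {C : Type u} [Category.{u} C] [MonoidalCategory C]
  {b : CyclicCat} (E : (b.V → C)ᵒᵖ ⥤ ModuleCat.{u} k)

/-- The sections over `z` of the right Kan extension of `E` along the inclusion of the fibre over
`b`: the natural families of sections of `E` indexed by the morphisms from this fibre to `z`. -/
def coindSubmodule (z : SharpOp C) :
    Submodule k (∀ (X : b.V → C), ((SharpOp.incl C b).obj X ⟶ z) → E.obj (.op X)) where
  carrier := {t | ∀ {X Y : b.V → C} (p : X ⟶ Y) (m : (SharpOp.incl C b).obj Y ⟶ z),
    t X ((SharpOp.incl C b).map p ≫ m) = (E.map p.op).hom (t Y m)}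
  add_mem' {s t} hs ht X Y p m := by
    change s X _ + t X _ = (E.map p.op).hom (s Y m + t Y m)
    rw [map_add, hs, ht]
  zero_mem' {X Y} p m := (map_zero (E.map p.op).hom).symm
  smul_mem' c t ht X Y p m := by
    change c • t X _ = (E.map p.op).hom (c • t Y m)
    rw [map_smul, ht]

/-- The right Kan extension of `E` along the inclusion of the fibre over `b`. -/
def coind : (SharpOp C)ᵒᵖ ⥤ ModuleCat.{u} k where
  obj z := ModuleCat.of k (coindSubmodule E z.unop)
  map {z w} n := ModuleCat.ofHom
    { toFun t := ⟨fun X m => t.1 X (m ≫ n.unop), fun {X Y} p m => by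
        exact (congrArg (t.1 X) (Category.assoc _ _ _)).trans (t.2 p _)⟩
      map_add' _ _ := rfl
      map_smul' _ _ := rfl }
  map_id z := by
    refine ModuleCat.hom_ext (LinearMap.ext fun t =>
      Subtype.ext (funext fun X => funext fun m => ?_))
    exact congrArg (t.1 X) (Category.comp_id m)
  map_comp n n' := by
    refine ModuleCat.hom_ext (LinearMap.ext fun t =>
      Subtype.ext (funext fun X => funext fun m => ?_))
    exact congrArg (t.1 X) (Category.assoc _ _ _).symm

/-- Evaluation of a section of `coind E` at the cartesian morphism over `g`. -/
def coindπ {a : CyclicCat} (g : a ⟶ b) :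
    (SharpOp.incl C a).op ⋙ coind E ⟶ (push C g).op ⋙ E where
  app Z := ModuleCat.ofHom
    { toFun t := t.1 _ (SharpOp.cart g Z.unop)
      map_add' _ _ := rfl
      map_smul' _ _ := rfl }
  naturality Z W e := by
    ext t
    change t.1 _ (SharpOp.cart g W.unop ≫ (SharpOp.incl C a).map e.unop) =
      (E.map ((push C g).map e.unop).op).hom (t.1 _ (SharpOp.cart g Z.unop))
    rw [SharpOp.cart_comp_incl]
    exact t.2 _ _

/-- The restriction of `coind E` to the fibre over `a` is the product of the restrictions `g^* E`,
for all morphisms `g : a ⟶ b`. -/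
theorem coindπ_isProductFamily (a : CyclicCat) :
    IsProductFamily (fun g : a ⟶ b => coindπ E g) := by
  have eta : ∀ (Z : a.V → C) (X : b.V → C)
      (m : (SharpOp.incl C b).obj X ⟶ (SharpOp.incl C a).obj Z),
      m = SharpOp.mk' (SharpOp.Hom.base m) (SharpOp.Hom.fib m) := fun Z X m => rfl
  intro ⟨Z⟩
  constructor
  · intro s t hst
    refine Subtype.ext (funext fun X => funext fun m => ?_)
    rw [eta Z X m, SharpOp.mk'_eq]
    refine (s.2 _ _).trans (Eq.trans ?_ (t.2 _ _).symm)
    exact congrArg _ (congrFun hst (SharpOp.Hom.base m))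
  · intro t
    refine ⟨⟨fun X m => (E.map (Quiver.Hom.op (SharpOp.Hom.fib m))).hom (t (SharpOp.Hom.base m)),
      fun {X Y} p m => ?_⟩, ?_⟩
    · have key : ∀ (m' : (SharpOp.incl C b).obj X ⟶ (SharpOp.incl C a).obj Z),
          m' = SharpOp.mk' (SharpOp.Hom.base m) (p ≫ SharpOp.Hom.fib m) →
          (E.map (Quiver.Hom.op (SharpOp.Hom.fib m'))).hom (t (SharpOp.Hom.base m')) =
            (E.map p.op).hom
              ((E.map (Quiver.Hom.op (SharpOp.Hom.fib m))).hom (t (SharpOp.Hom.base m))) := by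
        rintro _ rfl
        exact LinSite.map_comp_apply (G := E) p (SharpOp.Hom.fib m) _
      exact key _ (SharpOp.incl_comp_mk' (SharpOp.Hom.base m) (SharpOp.Hom.fib m) p)
    · funext g
      change (E.map (𝟙 ((push C g).obj Z)).op).hom (t g) = t g
      rw [op_id, E.map_id]
      rfl

end Coinduction

section CoindSharp

variable (k : Type u) [Field k] (C : Type u) [Category.{u} C] [Abelian C] [Linear k C]
  [MonoidalCategory C] [MonoidalPreadditive C] [MonoidalLinear k C]
  [∀ X : C, PreservesFiniteColimits (tensorLeft X)]
  [∀ X : C, PreservesFiniteColimits (tensorRight X)]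

/-- The right adjoint of the evaluation at `b`. -/
def coindSharp (b : CyclicCat) : Shv k C b.V ⥤ ShvSharp k C where
  obj E := ⟨coind E.obj, fun a =>
    (coindπ_isProductFamily E.obj a).isMultiSheaf fun g => push_isMultiSheaf g E.property⟩
  map {E E'} φ := ObjectProperty.homMk
    { app z := ModuleCat.ofHom
        { toFun t := ⟨fun X m => (φ.hom.app (.op X)).hom (t.1 X m), fun {X Y} p m => by
            refine (congrArg (φ.hom.app (.op X)).hom (t.2 p m)).trans ?_
            exact ConcreteCategory.congr_hom (φ.hom.naturality p.op) _⟩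
          map_add' s t := Subtype.ext (funext fun X => funext fun m => map_add _ _ _)
          map_smul' c t := Subtype.ext (funext fun X => funext fun m => map_smul _ _ _) }
      naturality _ _ _ := rfl }
  map_id _ := rfl
  map_comp _ _ := rfl

/-- The evaluation at `b` is left adjoint to `coindSharp k C b`. -/
def evalSharpAdj (b : CyclicCat) : evalSharp k C b ⊣ coindSharp k C b :=
  Adjunction.mkOfHomEquiv
    { homEquiv F E :=
        { toFun α := ObjectProperty.homMk
            { app z := ModuleCat.ofHom
                { toFun s := ⟨fun X m => (α.hom.app (.op X)).hom ((F.obj.map m.op).hom s),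
                    fun {X Y} p m => by
                      refine (congrArg (α.hom.app (.op X)).hom
                        (LinSite.map_comp_apply (G := F.obj) _ m s)).trans ?_
                      exact ConcreteCategory.congr_hom (α.hom.naturality p.op) _⟩
                  map_add' s t := Subtype.ext (funext fun X => funext fun m => by
                    exact map_add (F.obj.map m.op ≫ α.hom.app (.op X)).hom s t)
                  map_smul' c t := Subtype.ext (funext fun X => funext fun m => by
                    exact map_smul (F.obj.map m.op ≫ α.hom.app (.op X)).hom c t) }
              naturality z w n := by
                ext s
                refine Subtype.ext (funext fun X => funext fun m => ?_)
                exact congrArg (α.hom.app (.op X)).hom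
                  (LinSite.map_comp_apply (G := F.obj) m n.unop s).symm }
          invFun β := ObjectProperty.homMk
            { app X := ModuleCat.ofHom
                { toFun s := ((β.hom.app (.op ((SharpOp.incl C b).obj X.unop))).hom s).1 _ (𝟙 _)
                  map_add' s t := by rw [map_add]; rfl
                  map_smul' c t := by rw [map_smul]; rfl }
              naturality X Y e := by
                ext s
                have h := ConcreteCategory.congr_hom
                  (β.hom.naturality ((SharpOp.incl C b).map e.unop).op) s
                have h' := congrFun (congrFun (congrArg Subtype.val h) Y.unop) (𝟙 _)
                refine h'.trans ?_
                have h'' := ((β.hom.app (.op ((SharpOp.incl C b).obj X.unop))).hom s).2 e.unop (𝟙 _)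
                rw [Category.comp_id] at h''
                refine Eq.trans ?_ h''
                exact congrArg (((β.hom.app (.op ((SharpOp.incl C b).obj X.unop))).hom s).1 _)
                  (Category.id_comp _) }
          left_inv α := by
            ext X s
            exact congrArg (α.hom.app X).hom
              (ConcreteCategory.congr_hom (F.obj.map_id (.op ((SharpOp.incl C b).obj X.unop))) s)
          right_inv β := by
            ext z s
            refine Subtype.ext (funext fun X => funext fun m => ?_)
            have h := ConcreteCategory.congr_hom (β.hom.naturality m.op) s
            refine (congrFun (congrFun (congrArg Subtype.val h) X) (𝟙 _)).trans ?_
            exact congrArg (((β.hom.app z).hom s).1 X) (Category.id_comp m) }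
      homEquiv_naturality_left_symm _ _ := rfl
      homEquiv_naturality_right _ _ := rfl }

end CoindSharp

/-! ### The left adjoint of the evaluation functors -/

section Limits

/-- A limit of sheaves is a subsheaf of a product, where linearity can be tested. -/
instance LinSite.isClosedUnderLimitsOfShape_linSheaf {k : Type u} [Field k] {X : Type u}
    [Category.{u} X] (S : LinSite k X) (J : Type u) [SmallCategory J] :
    S.linSheaf.IsClosedUnderLimitsOfShape J where
  limitsOfShape_le := by
    rintro F ⟨p⟩
    refine LinSite.IsLin.of_mono_family S (ι := J) p.prop_diag_obj
      (fun j => (p.π.app j).hom) ?_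
    intro x s t h
    let E := sheafToPresheaf S.topology (ModuleCat.{u} k) ⋙ (evaluation _ _).obj x
    exact Concrete.isLimit_ext _ (isLimitOfPreserves E p.isLimit) s t h

instance LinSite.preservesLimits_linDescent_ι {k : Type u} [Field k] {X : Type u}
    [Category.{u} X] (S : LinSite k X) : PreservesLimits S.linDescent.ι where
  preservesLimitsOfShape {J} _ :=
    inferInstanceAs (PreservesLimitsOfShape J
      (S.toSheaf ⋙ S.linSheaf.ι ⋙ sheafToPresheaf S.topology (ModuleCat.{u} k)))

variable (k : Type u) [Field k] (C : Type u) [Category.{u} C] [Abelian C] [Linear k C]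
  [MonoidalCategory C] [MonoidalPreadditive C]
  [∀ X : C, PreservesFiniteColimits (tensorLeft X)]
  [∀ X : C, PreservesFiniteColimits (tensorRight X)]

instance preservesLimits_sharpSheaf_ι : PreservesLimits (sharpSheaf k C).ι :=
  inferInstanceAs (PreservesLimits
    (shvSharpToLinDescent k C ⋙ (SharpOp.site k C).linDescent.ι))

instance preservesLimits_evalSharp (a : CyclicCat) : PreservesLimits (evalSharp k C a) where
  preservesLimitsOfShape {J} _ :=
    have : PreservesLimitsOfShape J (evalSharp k C a ⋙ (multiSheaf k C a.V).ι) :=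
      inferInstanceAs (PreservesLimitsOfShape J ((sharpSheaf k C).ι ⋙
        (Functor.whiskeringLeft _ _ _).obj (SharpOp.incl C a).op))
    preservesLimitsOfShape_of_reflects_of_preserves _ (multiSheaf k C a.V).ι

/-- By the special adjoint functor theorem. -/
instance isRightAdjoint_evalSharp (a : CyclicCat) : (evalSharp k C a).IsRightAdjoint :=
  isRightAdjoint_of_preservesLimits_of_isCoseparating
    (isCoseparator_coseparator (ShvSharp k C)) _

/-- The left adjoint of the evaluation at `a`. -/
noncomputable def indSharp (a : CyclicCat) : Shv k C a.V ⥤ ShvSharp k C :=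
  (evalSharp k C a).leftAdjoint

/-- `indSharp k C a` is left adjoint to the evaluation at `a`. -/
noncomputable def indSharpAdj (a : CyclicCat) : indSharp k C a ⊣ evalSharp k C a :=
  Adjunction.ofIsRightAdjoint _

instance (a : CyclicCat) : (indSharp k C a).Additive := (indSharpAdj k C a).left_adjoint_additive

end Limits

/-! ### Adapted resolutions of sheaves -/

section HomExactness

universe v₁ u₁

variable {A : Type u₁} [Category.{v₁} A] [Abelian A]

theorem HomExact.of_iso {P : A} {d d' : CochainComplex A ℤ} (h : HomExact P d) (e : d ≅ d') :
    HomExact P d' := by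
  intro i j k hij hjk x hx
  obtain ⟨y, hy⟩ := h i j k hij hjk (x ≫ e.inv.f j) (by
    rw [Category.assoc, e.inv.comm, reassoc_of% hx, zero_comp])
  refine ⟨y ≫ e.hom.f i, ?_⟩
  rw [Category.assoc, e.hom.comm, reassoc_of% hy, ← HomologicalComplex.comp_f, e.inv_hom_id,
    HomologicalComplex.id_f, Category.comp_id]

theorem homExact_coproductCover [HasCoproducts.{v₁} A] {ι : Type v₁} (G : ι → A) (E : A)
    {d : CochainComplex A ℤ} (h : ∀ i, HomExact (G i) d) :
    HomExact ((coproductCover G).obj E) d := by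
  intro i j k hij hjk (x : (∐ fun p : Σ i, G i ⟶ E => G p.1) ⟶ d.X j) hx
  choose y hy using fun p : Σ i, G i ⟶ E =>
    h p.1 i j k hij hjk (Sigma.ι (fun p : Σ i, G i ⟶ E => G p.1) p ≫ x)
      ((Category.assoc _ _ _).trans ((congrArg _ hx).trans comp_zero))
  refine ⟨(Sigma.desc y : (∐ fun p : Σ i, G i ⟶ E => G p.1) ⟶ d.X i),
    Sigma.hom_ext _ _ fun p => ?_⟩
  exact (Sigma.ι_desc_assoc (f := fun p : Σ i, G i ⟶ E => G p.1) y p _).trans (hy p)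

/-- Sequential colimits in a Grothendieck abelian category are exact. The axioms are about small
categories in the ambient universe, and `ℕ` is lifted to it. -/
theorem IsGrothendieckAbelian.hasExactColimitsOfShape_nat [IsGrothendieckAbelian.{v₁} A] :
    ∃ _ : HasColimitsOfShape ℕ A, HasExactColimitsOfShape ℕ A :=
  ⟨hasColimitsOfShape_of_equivalence (ULiftHomULiftCategory.equiv.{v₁, v₁} ℕ).symm,
    HasExactColimitsOfShape.of_domain_equivalence A (ULiftHomULiftCategory.equiv.{v₁, v₁} ℕ).symm⟩

end HomExactness

section Adapted

variable {k : Type u} [Field k] {C : Type u} [Category.{u} C] [Abelian C] [Linear k C]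
  [MonoidalCategory C] [MonoidalPreadditive C] [MonoidalLinear k C]
  [∀ X : C, PreservesFiniteColimits (tensorLeft X)]
  [∀ X : C, PreservesFiniteColimits (tensorRight X)]

variable (k C) in
/-- `g^* f^* ≅ (g ≫ f)^*` -/
def pullComp {a b c : CyclicCat} (g : a ⟶ b) (f : b ⟶ c) :
    pull (C := C) k f ⋙ pull k g ≅ pull k (g ≫ f) :=
  NatIso.ofComponents (fun E => ObjectProperty.isoMk _
    (Functor.isoWhiskerRight (NatIso.op (pushComp C g f)) E.obj)) (by
    intro E E' φ
    ext X s
    exact ConcreteCategory.congr_hom (φ.hom.naturality ((pushComp C g f).hom.app X.unop).op).symm s)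

instance (b : CyclicCat) : (coindSharp k C b).Additive :=
  (evalSharpAdj k C b).right_adjoint_additive

/-- Exactness of `Hom(P, -)` on the value at `a` of the coinduced complex is tested on the factors
`g^* c` of this value. -/
theorem homExact_evalSharp_coindSharp {a b : CyclicCat} {P : Shv k C a.V}
    {c : CochainComplex (Shv k C b.V) ℤ}
    (h : ∀ g : a ⟶ b, HomExact P (((pull k g).mapHomologicalComplex _).obj c)) :
    HomExact P (((evalSharp k C a).mapHomologicalComplex _).obj
      (((coindSharp k C b).mapHomologicalComplex _).obj c)) := by
  intro i j l hij hjl x hx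
  let x' : P.obj ⟶ (SharpOp.incl C a).op ⋙ coind (c.X j).obj := x.hom
  choose y hy using fun g : a ⟶ b => h g i j l hij hjl
    (ObjectProperty.homMk (x' ≫ coindπ (c.X j).obj g)) (by
      ext1
      change (x' ≫ coindπ (c.X j).obj g) ≫ Functor.whiskerLeft (push C g).op (c.d j l).hom = 0
      have := congrArg (fun q => q.hom ≫ coindπ (c.X l).obj g) hx
      refine Eq.trans ?_ (this.trans zero_comp)
      rfl)
  obtain ⟨z, hz⟩ := (coindπ_isProductFamily (c.X i).obj a).exists_lift fun g => (y g).hom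
  refine ⟨ObjectProperty.homMk z, ?_⟩
  ext1
  refine (coindπ_isProductFamily (c.X j).obj a).hom_ext fun g => ?_
  refine Eq.trans ?_ (congrArg (fun q => q.hom) (hy g))
  refine Eq.trans ?_
    (congrArg (fun q => q ≫ Functor.whiskerLeft (push C g).op (c.d i j).hom) (hz g))
  rfl

/-- The value at `b` of the object induced from `P` behaves, with respect to `HomExact`, as the sum
of the direct images of `P` under all morphisms `g : a ⟶ b`. -/
theorem homExact_evalSharp_indSharp {a b : CyclicCat} {P : Shv k C a.V}
    {c : CochainComplex (Shv k C b.V) ℤ} (h : ∀ g : a ⟶ b, HomExact ((shriek k g).obj P) c) :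
    HomExact ((evalSharp k C b).obj ((indSharp k C a).obj P)) c := by
  rw [← homExact_mapHomologicalComplex_iff (evalSharpAdj k C b),
    ← homExact_mapHomologicalComplex_iff (indSharpAdj k C a)]
  exact homExact_evalSharp_coindSharp fun g =>
    (homExact_mapHomologicalComplex_iff (shriekAdj k g) _ _).2 (h g)

/-- The analogue of `homExact_evalSharp_indSharp` for the direct images of the values of the
induced object. -/
theorem homExact_shriek_evalSharp_indSharp {a b b' : CyclicCat} (f : b ⟶ b') {P : Shv k C a.V}
    {c : CochainComplex (Shv k C b'.V) ℤ} (h : ∀ g : a ⟶ b', HomExact ((shriek k g).obj P) c) :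
    HomExact ((shriek k f).obj ((evalSharp k C b).obj ((indSharp k C a).obj P))) c := by
  rw [← homExact_mapHomologicalComplex_iff (shriekAdj k f)]
  refine homExact_evalSharp_indSharp fun g => ?_
  rw [← homExact_mapHomologicalComplex_iff (shriekAdj k g)]
  have := (homExact_mapHomologicalComplex_iff (shriekAdj k (g ≫ f)) _ _).2 (h (g ≫ f))
  exact this.of_iso ((NatIso.mapHomologicalComplex (pullComp k C g f) _).symm.app c)

/-- The objects of `Shv(C_#)` whose values, and the direct images of whose values, are adapted to
the trace functors. -/
def SharpAdapted (T : TraceFunctor k C) : ObjectProperty (ShvSharp k C) := fun E =>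
  ∀ b : CyclicCat, FAdapted (tr T b) ((evalSharp k C b).obj E) ∧
    ∀ {b' : CyclicCat} (f : b ⟶ b'),
      FAdapted (tr T b') ((shriek k f).obj ((evalSharp k C b).obj E))

theorem HomologicallyClean.fAdapted {T : TraceFunctor k C} (hT : HomologicallyClean T)
    {a : CyclicCat} {E : Shv k C a.V} (hE : LeftAcyclic (tr T a) E) : FAdapted (tr T a) E :=
  hE.fAdapted fun E => by
    obtain ⟨P, π, hπ, hP⟩ := hT a E
    exact ⟨P, π, hπ, hP.tr_acyclic⟩

variable {T : TraceFunctor k C} (hT : HomologicallyClean T)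
include hT

/-- Some admissible object is a separator: a cover of a separator is a separator. -/
theorem HomologicallyClean.exists_separating (a : CyclicCat) :
    ∃ P : Shv k C a.V, IsAdmissible T P ∧ IsSeparator P := by
  obtain ⟨P, π, hπ, hP⟩ := hT a (separator _)
  refine ⟨P, hP, (isSeparator_def _).2 fun E M f g h => ?_⟩
  refine (isSeparator_separator (Shv k C a.V)).def _ _ fun z => ?_
  rw [← cancel_epi π, ← Category.assoc, h, Category.assoc]

/-- Complexes of sheaves have functorial resolutions adapted to the trace functor. -/
theorem HomologicallyClean.exists_resolution (a : CyclicCat) :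
    ∃ (R : CochainComplex (Shv k C a.V) ℤ ⥤ CochainComplex (Shv k C a.V) ℤ) (ρ : R ⟶ 𝟭 _),
      (∀ K, QuasiIso (ρ.app K)) ∧ ∀ K, FGood (tr T a) (R.obj K) := by
  obtain ⟨P, hP, hP'⟩ := hT.exists_separating a
  obtain ⟨_, _⟩ := IsGrothendieckAbelian.hasExactColimitsOfShape_nat (A := Shv k C a.V)
  obtain ⟨R, ρ, hρ, hR⟩ := exists_functorial_resolution (fun _ : PUnit.{u + 1} => P)
    (fun f g h => hP'.def _ _ (h ⟨⟩)) (FAdapted (tr T a)) (fun E c hc =>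
      homExact_coproductCover _ _ fun _ => hT.fAdapted hP.tr_acyclic c hc)
  exact ⟨R, ρ, hρ, fun K c hc => hR K c fun Q hQ => hQ c hc⟩

/-- Complexes over `Shv(C_#)` have functorial resolutions whose values, and the direct images of
whose values, are adapted to the trace functors. They are built from the objects induced from
admissible separators of the categories `Shv(C^n)`. -/
theorem HomologicallyClean.exists_sharp_resolution :
    ∃ (R : CochainComplex (ShvSharp k C) ℤ ⥤ CochainComplex (ShvSharp k C) ℤ) (ρ : R ⟶ 𝟭 _),
      (∀ K, QuasiIso (ρ.app K)) ∧ ∀ K (a : CyclicCat),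
        FGood (tr T a) (((evalSharp k C a).mapHomologicalComplex _).obj (R.obj K)) ∧
        ∀ {b : CyclicCat} (f : a ⟶ b), FGood (tr T b) (((shriek k f).mapHomologicalComplex _).obj
          (((evalSharp k C a).mapHomologicalComplex _).obj (R.obj K))) := by
  choose P hP hP' using hT.exists_separating
  obtain ⟨_, _⟩ := IsGrothendieckAbelian.hasExactColimitsOfShape_nat (A := ShvSharp k C)
  let G (a : ULift.{u} CyclicCat) : ShvSharp k C := (indSharp k C a.down).obj (P a.down)
  have hG (E : ShvSharp k C) : SharpAdapted T ((coproductCover G).obj E) := by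
    refine fun b => ⟨fun c hc => ?_, fun {b'} f c hc => ?_⟩
    · rw [← homExact_mapHomologicalComplex_iff (evalSharpAdj k C b)]
      refine homExact_coproductCover _ _ fun a => ?_
      rw [homExact_mapHomologicalComplex_iff (evalSharpAdj k C b)]
      exact homExact_evalSharp_indSharp fun g =>
        hT.fAdapted ((hP a.down).tr_shriek_acyclic g) c hc
    · rw [← homExact_mapHomologicalComplex_iff (shriekAdj k f),
        ← homExact_mapHomologicalComplex_iff (evalSharpAdj k C b)]
      refine homExact_coproductCover _ _ fun a => ?_
      rw [homExact_mapHomologicalComplex_iff (evalSharpAdj k C b),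
        homExact_mapHomologicalComplex_iff (shriekAdj k f)]
      exact homExact_shriek_evalSharp_indSharp f fun g =>
        hT.fAdapted ((hP a.down).tr_shriek_acyclic g) c hc
  obtain ⟨R, ρ, hρ, hR⟩ := exists_functorial_resolution G
    (fun {E M} f g h => by
      have h' : ∀ a, (evalSharp k C a).map f = (evalSharp k C a).map g := fun a =>
        (hP' a).def _ _ fun z => by
          have := h ⟨a⟩ (((indSharpAdj k C a).homEquiv _ _).symm z)
          apply ((indSharpAdj k C a).homEquiv _ _).symm.injective
          rw [Adjunction.homEquiv_naturality_right_symm, this,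
            ← Adjunction.homEquiv_naturality_right_symm]
      ext1
      refine NatTrans.ext (funext fun z => ?_)
      exact congrArg (fun q => q.hom.app (.op z.unop.fib)) (h' z.unop.base))
    (SharpAdapted T) hG
  refine ⟨R, ρ, hρ, fun K a => ⟨fun c hc => ?_, fun {b} f c hc => ?_⟩⟩
  · exact .of_adjunction (evalSharpAdj k C a) (hR _ _ fun E hE =>
        (homExact_mapHomologicalComplex_iff (evalSharpAdj k C a) _ _).2 ((hE a).1 c hc))
  · exact .of_adjunction (shriekAdj k f) (.of_adjunction (evalSharpAdj k C a) (hR _ _ fun E hE =>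
        (homExact_mapHomologicalComplex_iff (evalSharpAdj k C a) _ _).2
          ((homExact_mapHomologicalComplex_iff (shriekAdj k f) _ _).2 ((hE a).2 f c hc))))

end Adapted

/-! ### The right adjoint of the trace functor, and the trace property -/

section CoendHom

open TensorProduct

variable {k : Type u} [Field k] {X : Type u} [Category.{u} X]

/-- The functor sending `V` to the presheaf `x ↦ Hom(T x, V)`. -/
noncomputable def coendHom (T : X ⥤ ModuleCat.{u} k) :
    ModuleCat.{u} k ⥤ Xᵒᵖ ⥤ ModuleCat.{u} k :=
  linearYoneda k (ModuleCat.{u} k) ⋙ (Functor.whiskeringLeft _ _ _).obj T.op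

variable (T : X ⥤ ModuleCat.{u} k)

theorem coendTensor.condition_apply (E : Xᵒᵖ ⥤ ModuleCat.{u} k) {x y : X} (f : x ⟶ y)
    (s : E.obj (.op y)) (t : T.obj x) :
    (coendTensor.ι E T x).hom ((E.map f.op).hom s ⊗ₜ t) =
      (coendTensor.ι E T y).hom (s ⊗ₜ (T.map f).hom t) :=
  ConcreteCategory.congr_hom (coendTensor.condition E T f) (s ⊗ₜ t)

theorem coendTensor.ι_map_apply {E E' : Xᵒᵖ ⥤ ModuleCat.{u} k} (φ : E ⟶ E') (x : X)
    (s : E.obj (.op x)) (t : T.obj x) :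
    ((coendTensor T).map φ).hom ((coendTensor.ι E T x).hom (s ⊗ₜ t)) =
      (coendTensor.ι E' T x).hom ((φ.app _).hom s ⊗ₜ t) :=
  ConcreteCategory.congr_hom (coendTensor.ι_map (T := T) φ x) (s ⊗ₜ t)

/-- Maps out of `E ⊗_X T` are natural families of maps `E x → Hom(T x, V)`. -/
noncomputable def coendTensorHomEquiv (E : Xᵒᵖ ⥤ ModuleCat.{u} k) (V : ModuleCat.{u} k) :
    ((coendTensor T).obj E ⟶ V) ≃ (E ⟶ (coendHom T).obj V) where
  toFun f :=
    { app x := ModuleCat.ofHom (ModuleCat.homLinearEquiv (S := k).symm.toLinearMap ∘ₗ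
        TensorProduct.curry (coendTensor.ι E T x.unop ≫ f).hom)
      naturality x y e := by
        refine ModuleCat.hom_ext (LinearMap.ext fun s =>
          ModuleCat.hom_ext (LinearMap.ext fun t => ?_))
        exact congrArg f.hom (coendTensor.condition_apply T E e.unop s t) }
  invFun g := coendTensor.desc
    (fun x => ModuleCat.ofHom (TensorProduct.lift
      ((ModuleCat.homLinearEquiv (S := k)).toLinearMap ∘ₗ (g.app (.op x)).hom)))
    (fun {x y} e => ModuleCat.hom_ext (TensorProduct.ext' fun s t => by
      have := ConcreteCategory.congr_hom (g.naturality e.op) s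
      exact ConcreteCategory.congr_hom this t))
  left_inv f := by
    refine coendTensor.hom_ext fun x => ?_
    rw [coendTensor.ι_desc]
    exact ModuleCat.hom_ext (TensorProduct.ext' fun s t => rfl)
  right_inv g := by
    refine NatTrans.ext (funext fun x => ModuleCat.hom_ext (LinearMap.ext fun s =>
      ModuleCat.hom_ext (LinearMap.ext fun t => ?_)))
    exact ConcreteCategory.congr_hom (coendTensor.ι_desc (E := E) (T := T) _ _ x.unop) (s ⊗ₜ t)

/-- `E ↦ E ⊗_X T` is left adjoint to `V ↦ Hom(T, V)`. -/
noncomputable def coendTensorAdj : coendTensor T ⊣ coendHom T :=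
  Adjunction.mkOfHomEquiv
    { homEquiv := coendTensorHomEquiv T
      homEquiv_naturality_left_symm {E E' V} f g := by
        have h (g : (coendTensor T).obj E' ⟶ V) : coendTensorHomEquiv T E V
            ((coendTensor T).map f ≫ g) = f ≫ coendTensorHomEquiv T E' V g := by
          refine NatTrans.ext (funext fun x => ModuleCat.hom_ext (LinearMap.ext fun s =>
            ModuleCat.hom_ext (LinearMap.ext fun t => ?_)))
          exact congrArg g.hom (coendTensor.ι_map_apply T f x.unop s t)
        rw [Equiv.symm_apply_eq, h, Equiv.apply_symm_apply]
      homEquiv_naturality_right _ _ := rfl }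

end CoendHom

section TraceAdjoint

open TensorProduct

variable {k : Type u} [Field k] {C : Type u} [Category.{u} C]

namespace CyclicCat

/-- A morphism to `[1]`. -/
def toOne (a : CyclicCat) : a ⟶ one :=
  Hom.mk (fun _ => List.finRange a.len) (by
    rw [concat_eq_flatMap]
    simpa [one, List.finRange_succ] using List.IsRotated.refl _)

instance : Subsingleton one.V := inferInstanceAs (Subsingleton (Fin 1))

variable (C) in
/-- Tuples indexed by `V([1])` are determined by their only component. -/
def isoSingle : 𝟭 (one.V → C) ≅ Pi.eval (fun _ => C) (⟨0, Nat.one_pos⟩ : one.V) ⋙ single C :=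
  NatIso.ofComponents (fun X => Pi.isoMk fun v => eqToIso (congrArg X (Subsingleton.elim _ _)))
    (fun {X Y} f => funext fun v => by
      obtain rfl : v = (⟨0, Nat.one_pos⟩ : one.V) := Subsingleton.elim _ _
      change f _ ≫ 𝟙 _ = 𝟙 _ ≫ f _
      simp)

end CyclicCat

theorem IsMultiSheaf.of_iso [Abelian C] [Linear k C] {V : Type}
    {F G : (V → C)ᵒᵖ ⥤ ModuleCat.{u} k} (e : F ≅ G) (hG : IsMultiSheaf G) : IsMultiSheaf F := by
  refine IsProductFamily.isMultiSheaf (ι := Unit) (G := fun _ => G) (π := fun _ => e.hom)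
    (fun X => ⟨fun s t h => ?_, fun t => ⟨(e.inv.app X).hom (t ()), funext fun _ => ?_⟩⟩)
    (fun _ => hG)
  · have h' : (e.hom.app X).hom s = (e.hom.app X).hom t := congrFun h ()
    have := congrArg (e.inv.app X).hom h'
    rwa [← LinearMap.comp_apply, ← LinearMap.comp_apply, ← ModuleCat.hom_comp,
      Iso.hom_inv_id_app] at this
  · change (e.hom.app X).hom ((e.inv.app X).hom (t ())) = t ()
    rw [← LinearMap.comp_apply, ← ModuleCat.hom_comp, Iso.inv_hom_id_app]
    rfl

/-- A right exact functor `F` gives a left exact functor `Hom(F(-), V)`. -/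
theorem isMultiSheaf_hom [Abelian C] [Linear k C] (F : C ⥤ ModuleCat.{u} k) [F.Additive]
    [F.Linear k] [PreservesFiniteColimits F] (V : ModuleCat.{u} k) :
    IsMultiSheaf ((Pi.eval (fun _ => C) (⟨0, Nat.one_pos⟩ : CyclicCat.one.V)).op ⋙
      (coendHom F).obj V) := by
  refine { map_add := ?_, map_smul := ?_, exact := ?_ }
  · intro X Y i u v w h _
    obtain rfl : i = (⟨0, Nat.one_pos⟩ : CyclicCat.one.V) := Subsingleton.elim _ _
    refine ModuleCat.hom_ext (LinearMap.ext fun (s : F.obj (Y _) ⟶ V) => ?_)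
    change F.map (w _) ≫ s = F.map (u _) ≫ s + F.map (v _) ≫ s
    rw [h, F.map_add, Preadditive.add_comp]
  · intro X Y i c u w h _
    obtain rfl : i = (⟨0, Nat.one_pos⟩ : CyclicCat.one.V) := Subsingleton.elim _ _
    refine ModuleCat.hom_ext (LinearMap.ext fun (s : F.obj (Y _) ⟶ V) => ?_)
    change F.map (w _) ≫ s = c • F.map (u _) ≫ s
    rw [h, F.map_smul, Linear.smul_comp]
  · intro i X Y Z q p w hw hp _
    obtain rfl : i = (⟨0, Nat.one_pos⟩ : CyclicCat.one.V) := Subsingleton.elim _ _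
    have h := hw.map_of_epi_of_preservesCokernel F hp inferInstance
    have hp' : Epi (F.map (p ⟨0, Nat.one_pos⟩)) := inferInstance
    refine ⟨fun (s : F.obj (Z _) ⟶ V) (t : F.obj (Z _) ⟶ V)
        (hst : F.map (p _) ≫ s = F.map (p _) ≫ t) =>
      (cancel_epi (F.map (p _))).1 hst, fun (s : F.obj (Y _) ⟶ V) (hs : F.map (q _) ≫ s = 0) => ?_⟩
    have : Epi ((ShortComplex.mk _ _ w).map F).g := hp'
    exact ⟨h.desc s hs, h.g_desc s hs⟩

variable [Abelian C] [Linear k C] [MonoidalCategory C] [MonoidalPreadditive C] [MonoidalLinear k C]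
  [∀ X : C, PreservesFiniteColimits (tensorLeft X)]
  [∀ X : C, PreservesFiniteColimits (tensorRight X)] (T : TraceFunctor k C)

instance {a b : CyclicCat} (f : a ⟶ b) (X : a.V → C) :
    IsIso (T.functor.map (Sharp.cocart f X)) :=
  T.map_isIso _ (inferInstanceAs (IsIso (𝟙 _)))

/-- `Hom(tr(b, f_! X), V) ≅ Hom(tr(a, X), V)` -/
noncomputable def coendHomIso {a b : CyclicCat} (f : a ⟶ b) (V : ModuleCat.{u} k) :
    (push C f).op ⋙ (coendHom (Sharp.incl C b ⋙ T.functor)).obj V ≅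
      (coendHom (Sharp.incl C a ⋙ T.functor)).obj V :=
  Functor.isoWhiskerRight (NatIso.op (NatIso.ofComponents
    (fun X => asIso (T.functor.map (Sharp.cocart f X))) (fun {X Y} p => by
      change T.functor.map _ ≫ T.functor.map _ = T.functor.map _ ≫ T.functor.map _
      rw [← Functor.map_comp, ← Functor.map_comp, Sharp.incl_comp_cocart]) :
      Sharp.incl C a ⋙ T.functor ≅ push C f ⋙ Sharp.incl C b ⋙ T.functor))
    ((linearYoneda k (ModuleCat.{u} k)).obj V)

/-- The presheaf `X ↦ Hom(tr(a, X), V)` is a sheaf: by the trace property it is a restriction from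
the case `a = [1]`, where it is left exact because the trace functor is right exact. -/
theorem isMultiSheaf_coendHom (a : CyclicCat) (V : ModuleCat.{u} k) :
    IsMultiSheaf ((coendHom (Sharp.incl C a ⋙ T.functor)).obj V) := by
  refine .of_iso (coendHomIso T a.toOne V).symm (push_isMultiSheaf _ ?_)
  have := T.additive
  have := T.linear
  have := T.rightExact
  exact .of_iso (Functor.isoWhiskerRight (NatIso.op (CyclicCat.isoSingle C)).symm
    ((coendHom (Sharp.incl C CyclicCat.one ⋙ T.functor)).obj V))
    (isMultiSheaf_hom (CyclicCat.single C ⋙ Sharp.incl C CyclicCat.one ⋙ T.functor) V)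

/-- The right adjoint of the trace functor on `Shv(C^n)`. -/
noncomputable def trRight (a : CyclicCat) : ModuleCat.{u} k ⥤ Shv k C a.V :=
  ObjectProperty.lift _ (coendHom (Sharp.incl C a ⋙ T.functor)) (isMultiSheaf_coendHom T a)

/-- `tr T a` is left adjoint to `trRight T a`. -/
noncomputable def trAdj (a : CyclicCat) : tr T a ⊣ trRight T a :=
  Adjunction.restrictFullyFaithful (iC := (multiSheaf k C a.V).ι) (iD := 𝟭 _)
    (coendTensorAdj (Sharp.incl C a ⋙ T.functor))
    (multiSheaf k C a.V).fullyFaithfulι (Functor.FullyFaithful.id _) (Iso.refl _) (Iso.refl _)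

theorem trAdj_homEquiv {a : CyclicCat} (E : Shv k C a.V) (V : ModuleCat.{u} k)
    (h : (tr T a).obj E ⟶ V) : ((trAdj T a).homEquiv E V h).hom =
      coendTensorHomEquiv (Sharp.incl C a ⋙ T.functor) E.obj V h := by
  simp [trAdj, Adjunction.restrictFullyFaithful, Trans.trans]
  rfl

/-- `f^*` intertwines the right adjoints of the trace functors. -/
noncomputable def trRightIso {a b : CyclicCat} (f : a ⟶ b) :
    trRight T b ⋙ pull k f ≅ trRight T a :=
  NatIso.ofComponents (fun V => ObjectProperty.isoMk _ (coendHomIso T f V)) (by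
    intro V W g
    ext X s
    rfl)

/-- The trace property: `tr ≅ tr ∘ (f_!)_!`. -/
noncomputable def trShriekIso {a b : CyclicCat} (f : a ⟶ b) : tr T a ≅ shriek k f ⋙ tr T b :=
  (conjugateIsoEquiv ((shriekAdj k f).comp (trAdj T b)) (trAdj T a)).symm (trRightIso T f)

/-- `trShriekIso` in terms of the adjunctions which define it. -/
theorem trAdj_homEquiv_trShriekIso {a b : CyclicCat} (f : a ⟶ b) (E : Shv k C a.V)
    {V : ModuleCat.{u} k} (h : (tr T b).obj ((shriek k f).obj E) ⟶ V) :
    (trAdj T a).homEquiv E V ((trShriekIso T f).hom.app E ≫ h) =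
      (shriekAdj k f).homEquiv _ _ ((trAdj T b).homEquiv _ _ h) ≫ (trRightIso T f).hom.app V := by
  have h₁ := unit_conjugateEquiv_symm ((shriekAdj k f).comp (trAdj T b)) (trAdj T a)
    (trRightIso T f).hom E
  have h₂ := (trRightIso T f).hom.naturality h
  have h₃ : (shriekAdj k f).homEquiv _ _ ((trAdj T b).homEquiv _ _ h) =
      ((shriekAdj k f).comp (trAdj T b)).unit.app E ≫ (trRight T b ⋙ pull k f).map h := by
    rw [Adjunction.homEquiv_unit, Adjunction.homEquiv_unit]
    simp
  rw [h₃, Category.assoc, h₂, Adjunction.homEquiv_unit, Functor.map_comp]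
  exact (congrArg (· ≫ (trRight T a).map h) h₁.symm).trans (Category.assoc _ _ _)

variable (k C) in
/-- The transition maps `(f_!)_! E(a) ⟶ E(b)`, as a natural transformation. -/
noncomputable def transitionNat {a b : CyclicCat} (f : a ⟶ b) :
    evalSharp k C a ⋙ shriek k f ⟶ evalSharp k C b where
  app E := transition' E f
  naturality E E' φ := by
    change (shriek k f).map ((evalSharp k C a).map φ) ≫
      ((shriekAdj k f).homEquiv _ _).symm (transition E' f) =
      ((shriekAdj k f).homEquiv _ _).symm (transition E f) ≫ (evalSharp k C b).map φ
    rw [← Adjunction.homEquiv_naturality_left_symm, ← Adjunction.homEquiv_naturality_right_symm]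
    congr 1
    ext X s
    exact ConcreteCategory.congr_hom (φ.hom.naturality (SharpOp.cart f X.unop).op).symm s

open TensorProduct in
/-- The transition maps of `tr_#(E)` are, up to the trace property, the images under the trace
functor of the transition maps `(f_!)_! E(a) ⟶ E(b)`. -/
theorem trSharpMap_eq {a b : CyclicCat} (f : a ⟶ b) (E : ShvSharp k C) :
    trSharpMap T E f = (trShriekIso T f).hom.app ((evalSharp k C a).obj E) ≫
      (tr T b).map ((transitionNat k C f).app E) := by
  apply ((trAdj T a).homEquiv _ _).injective
  rw [trAdj_homEquiv_trShriekIso, ← Category.comp_id ((tr T b).map _),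
    Adjunction.homEquiv_naturality_left]
  change _ =
    (shriekAdj k f).homEquiv _ _ (((shriekAdj k f).homEquiv _ _).symm (transition E f) ≫ _) ≫ _
  rw [Adjunction.homEquiv_naturality_right, Equiv.apply_symm_apply]
  ext1
  rw [trAdj_homEquiv]
  refine NatTrans.ext (funext fun X => ModuleCat.hom_ext (LinearMap.ext fun s =>
    ModuleCat.hom_ext (LinearMap.ext fun t => ?_)))
  have h₁ : ((trAdj T b).homEquiv ((evalSharp k C b).obj E) _ (𝟙 _)).hom = _ :=
    trAdj_homEquiv T _ _ _
  have h₂ := congrArg (fun (q : ((evalSharp k C b).obj E).obj ⟶ _) =>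
    (ModuleCat.Hom.hom ((q.app (.op ((push C f).obj X.unop))).hom
      ((E.obj.map (SharpOp.cart f X.unop).op).hom s)) : T.functor.obj _ →ₗ[k] _)
      ((T.functor.map (Sharp.cocart f X.unop)).hom t)) h₁
  refine Eq.trans ?_ h₂.symm
  exact ConcreteCategory.congr_hom (trι_map T E f X.unop) (s ⊗ₜ t)

end TraceAdjoint

/-! ### Direct images under degeneracies -/

namespace CyclicCat

/-- The object `[n + 1]`. -/
@[reducible] def succ (a : CyclicCat) : CyclicCat := ⟨a.len + 1, Nat.succ_pos _⟩

/-- The injection `[n] ⟶ [n + 1]` which misses the first marked point. -/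
def degen (a : CyclicCat) : a ⟶ a.succ :=
  Hom.mk (Fin.cases [] fun i => [i]) (by
    have h : concat (Fin.cases [] fun i => [i]) (List.finRange (a.len + 1)) =
        List.finRange a.len := by
      rw [concat_eq_flatMap, List.finRange_succ, List.flatMap_cons, List.flatMap_map]
      simp
    rw [h])

end CyclicCat

section Degeneracy

open TensorProduct

variable {k : Type u} [Field k] {C : Type u} [Category.{u} C] [Abelian C] [Linear k C]
  [MonoidalCategory C] [MonoidalPreadditive C] [MonoidalLinear k C] (a : CyclicCat)

variable (C) in
/-- Forgetting the first component of a tuple. -/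
def tailFunctor : (a.succ.V → C) ⥤ (a.V → C) where
  obj Y i := Y i.succ
  map f i := f i.succ

variable {a} in
/-- The morphism `Y ⟶ (degen a)_! X` with given components. -/
def toPushDegen {Y : a.succ.V → C} {X : a.V → C} (u : Y 0 ⟶ 𝟙_ C)
    (q : (tailFunctor C a).obj Y ⟶ X) : Y ⟶ (push C a.degen).obj X :=
  fun v => Fin.cases (motive := fun v => Y v ⟶ (push C a.degen).obj X v) u
    (fun i => q i ≫ (ρ_ (X i)).inv) v

variable {a} in
/-- The projection of `(degen a)_! X` to `X`. -/
def pushDegenTail (X : a.V → C) : (tailFunctor C a).obj ((push C a.degen).obj X) ⟶ X :=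
  fun i => (ρ_ (X i)).hom

theorem toPushDegen_tail {Y : a.succ.V → C} {X : a.V → C} (u : Y 0 ⟶ 𝟙_ C)
    (q : (tailFunctor C a).obj Y ⟶ X) :
    (tailFunctor C a).map (toPushDegen u q) ≫ pushDegenTail X = q := by
  funext i
  change (q i ≫ (ρ_ (X i)).inv) ≫ (ρ_ (X i)).hom = q i
  simp

theorem toPushDegen_comp_push {Y : a.succ.V → C} {X X' : a.V → C} (u : Y 0 ⟶ 𝟙_ C)
    (q : (tailFunctor C a).obj Y ⟶ X) (p : X ⟶ X') :
    toPushDegen u q ≫ (push C a.degen).map p = toPushDegen u (q ≫ p) := by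
  funext v
  refine Fin.cases ?_ (fun i => ?_) v
  · exact Category.comp_id u
  · change (q i ≫ (ρ_ (X i)).inv) ≫ (p i ⊗ₘ 𝟙 (𝟙_ C)) = (q i ≫ p i) ≫ (ρ_ (X' i)).inv
    simp

theorem comp_toPushDegen {Y Z : a.succ.V → C} {X : a.V → C} (e : Z ⟶ Y) (u : Y 0 ⟶ 𝟙_ C)
    (q : (tailFunctor C a).obj Y ⟶ X) :
    e ≫ toPushDegen u q = toPushDegen (e 0 ≫ u) ((tailFunctor C a).map e ≫ q) := by
  funext v
  refine Fin.cases rfl (fun i => ?_) v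
  exact (Category.assoc (e i.succ) (q i) _).symm

theorem toPushDegen_pushDegenTail (X : a.V → C) :
    toPushDegen (𝟙 (𝟙_ C)) (pushDegenTail X) = 𝟙 ((push C a.degen).obj X) := by
  funext v
  refine Fin.cases rfl (fun i => ?_) v
  exact (ρ_ (X i)).hom_inv_id

variable (k C) in
/-- The presheaf `Y ↦ Hom(Y 0, 𝟙)`. -/
def homUnit : (a.succ.V → C)ᵒᵖ ⥤ ModuleCat.{u} k :=
  (Pi.eval (fun _ => C) (0 : a.succ.V)).op ⋙ (linearYoneda k C).obj (𝟙_ C)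

variable (k C) in
/-- The functor sending `E` to the presheaf `Y ↦ E(Y 1, …, Y n) ⊗ Hom(Y 0, 𝟙)`. -/
noncomputable def degenPresheaf :
    ((a.V → C)ᵒᵖ ⥤ ModuleCat.{u} k) ⥤ (a.succ.V → C)ᵒᵖ ⥤ ModuleCat.{u} k :=
  (Functor.whiskeringLeft _ _ _).obj (tailFunctor C a).op ⋙ tensorRight (homUnit k C a)

/-- Tensor products over a field are exact. -/
instance : (degenPresheaf k C a).PreservesMonomorphisms where
  preserves {E E'} m hm := by
    have : ∀ Y, Mono (((degenPresheaf k C a).map m).app Y) := fun Y => by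
      rw [ModuleCat.mono_iff_injective]
      refine Module.Flat.rTensor_preserves_injective_linearMap
        (M := (homUnit k C a).obj Y) (m.app ((tailFunctor C a).op.obj Y)).hom ?_
      rw [← ModuleCat.mono_iff_injective]
      infer_instance
    exact NatTrans.mono_of_mono_app _

theorem degenPresheaf_map_tmul (E : (a.V → C)ᵒᵖ ⥤ ModuleCat.{u} k) {Y Z : a.succ.V → C} (e : Z ⟶ Y)
    (s : E.obj (.op ((tailFunctor C a).obj Y))) (u : Y 0 ⟶ 𝟙_ C) :
    (((degenPresheaf k C a).obj E).map e.op).hom (s ⊗ₜ u) =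
      ((E.map ((tailFunctor C a).map e).op).hom s ⊗ₜ (e 0 ≫ u : Z 0 ⟶ 𝟙_ C) :
        TensorProduct k (E.obj (.op ((tailFunctor C a).obj Z))) (Z 0 ⟶ 𝟙_ C)) := rfl

/-- The linearity in the first variable comes from `homUnit`, in the other ones from `E`. -/
theorem degenPresheaf_isMultiLinear (E : (a.V → C)ᵒᵖ ⥤ ModuleCat.{u} k) (hE : IsMultiLinear E) :
    IsMultiLinear ((degenPresheaf k C a).obj E) where
  map_add {X Y} i u v w h h' := by
    refine ModuleCat.hom_ext (TensorProduct.ext' fun s (t : Y 0 ⟶ 𝟙_ C) => ?_)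
    refine (degenPresheaf_map_tmul a E w s t).trans ?_
    refine Eq.trans ?_ (congrArg₂ (· + ·) (degenPresheaf_map_tmul a E u s t)
      (degenPresheaf_map_tmul a E v s t)).symm
    induction i using Fin.cases with
    | zero =>
      have e₁ : (tailFunctor C a).map u = (tailFunctor C a).map w :=
        funext fun i => (h' i.succ (Fin.succ_ne_zero i)).1
      have e₂ : (tailFunctor C a).map v = (tailFunctor C a).map w :=
        funext fun i => (h' i.succ (Fin.succ_ne_zero i)).2
      rw [e₁, e₂, h, Preadditive.add_comp, TensorProduct.tmul_add]
      rfl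
    | succ i =>
      have e := hE.map_add i ((tailFunctor C a).map u) ((tailFunctor C a).map v)
        ((tailFunctor C a).map w) h (fun j hj => h' j.succ (fun e => hj (Fin.succ_injective _ e)))
      have h₀ := h' 0 (Fin.succ_ne_zero i).symm
      rw [h₀.1, h₀.2, e]
      exact TensorProduct.add_tmul _ _ _
  map_smul {X Y} i c u w h h' := by
    refine ModuleCat.hom_ext (TensorProduct.ext' fun s (t : Y 0 ⟶ 𝟙_ C) => ?_)
    refine (degenPresheaf_map_tmul a E w s t).trans ?_
    refine Eq.trans ?_ (congrArg (c • ·) (degenPresheaf_map_tmul a E u s t)).symm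
    induction i using Fin.cases with
    | zero =>
      have e₁ : (tailFunctor C a).map w = (tailFunctor C a).map u :=
        funext fun i => h' i.succ (Fin.succ_ne_zero i)
      rw [e₁, h, Linear.smul_comp, TensorProduct.tmul_smul]
      rfl
    | succ i =>
      have e := hE.map_smul i c ((tailFunctor C a).map u) ((tailFunctor C a).map w) h
        (fun j hj => h' j.succ (fun e => hj (Fin.succ_injective _ e)))
      have h₀ := h' 0 (Fin.succ_ne_zero i).symm
      rw [h₀, e]
      exact (TensorProduct.smul_tmul' _ _ _).symm

theorem pushDegenTail_naturality {X X' : a.V → C} (e : X ⟶ X') :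
    (tailFunctor C a).map ((push C a.degen).map e) ≫ pushDegenTail X' = pushDegenTail X ≫ e := by
  funext i
  change (e i ⊗ₘ 𝟙 (𝟙_ C)) ≫ (ρ_ (X' i)).hom = (ρ_ (X i)).hom ≫ e i
  simp

/-- The pure tensors in `degenPresheaf`. -/
noncomputable def degenMk (E : (a.V → C)ᵒᵖ ⥤ ModuleCat.{u} k) (Y : a.succ.V → C) :
    E.obj (.op ((tailFunctor C a).obj Y)) →ₗ[k] (Y 0 ⟶ 𝟙_ C) →ₗ[k]
      ((degenPresheaf k C a).obj E).obj (.op Y) :=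
  TensorProduct.mk k (E.obj (.op ((tailFunctor C a).obj Y))) (Y 0 ⟶ 𝟙_ C)

theorem app_degenMk {E : (a.V → C)ᵒᵖ ⥤ ModuleCat.{u} k} {G : (a.succ.V → C)ᵒᵖ ⥤ ModuleCat.{u} k}
    (ψ : (degenPresheaf k C a).obj E ⟶ G) {Y Z : a.succ.V → C} (e : Z ⟶ Y)
    (s : E.obj (.op ((tailFunctor C a).obj Y))) (u : Y 0 ⟶ 𝟙_ C) :
    (G.map e.op).hom ((ψ.app (.op Y)).hom (degenMk a E Y s u)) =
      (ψ.app (.op Z)).hom (degenMk a E Z ((E.map ((tailFunctor C a).map e).op).hom s)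
        (e 0 ≫ u)) :=
  (ConcreteCategory.congr_hom (ψ.naturality e.op) (degenMk a E Y s u)).symm

/-- Maps out of `degenPresheaf` into a polylinear presheaf: `degenPresheaf` is left adjoint to the
restriction along `(degen a)_! : (X 1, …, X n) ↦ (𝟙, X 1, …, X n)`. A map out of the tensor product
is determined by its values at `id : 𝟙 ⟶ 𝟙`. -/
noncomputable def degenEquiv (E : (a.V → C)ᵒᵖ ⥤ ModuleCat.{u} k)
    (G : (a.succ.V → C)ᵒᵖ ⥤ ModuleCat.{u} k) (hG : IsMultiLinear G) :
    ((degenPresheaf k C a).obj E ⟶ G) ≃ (E ⟶ (push C a.degen).op ⋙ G) where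
  toFun ψ :=
    { app X := ModuleCat.ofHom ((ψ.app (.op ((push C a.degen).obj X.unop))).hom ∘ₗ
        (degenMk a E _).flip (𝟙 (𝟙_ C)) ∘ₗ (E.map (pushDegenTail X.unop).op).hom)
      naturality X X' e := by
        refine ModuleCat.hom_ext (LinearMap.ext fun s => ?_)
        have h := app_degenMk a ψ ((push C a.degen).map e.unop)
          ((E.map (pushDegenTail X.unop).op).hom s) (𝟙 (𝟙_ C))
        refine Eq.trans ?_ h.symm
        rw [← LinSite.map_comp_apply (G := E), pushDegenTail_naturality,
          LinSite.map_comp_apply (G := E)]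
        exact congrArg (fun t => (ψ.app (.op ((push C a.degen).obj X'.unop))).hom
          (degenMk a E ((push C a.degen).obj X'.unop)
            ((E.map (pushDegenTail X'.unop).op).hom ((E.map e).hom s)) t))
          (Category.id_comp (𝟙 (𝟙_ C))).symm }
  invFun φ :=
    { app Y := ModuleCat.ofHom (TensorProduct.lift (LinearMap.mk₂ k
        (fun s (u : Y.unop 0 ⟶ 𝟙_ C) => (G.map (toPushDegen u (𝟙 _)).op).hom ((φ.app _).hom s))
        (fun s s' u => by rw [map_add, map_add])
        (fun c s u => by rw [map_smul, map_smul])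
        (fun s u u' => by
          rw [hG.map_add 0 (toPushDegen u (𝟙 _)) (toPushDegen u' (𝟙 _)) (toPushDegen (u + u') (𝟙 _))
            rfl (fun j => Fin.cases (fun h => (h rfl).elim) (fun i _ => ⟨rfl, rfl⟩) j)]
          rfl)
        (fun c s u => by
          rw [hG.map_smul 0 c (toPushDegen u (𝟙 _)) (toPushDegen (c • u) (𝟙 _))
            rfl (fun j => Fin.cases (fun h => (h rfl).elim) (fun i _ => rfl) j)]
          rfl)))
      naturality Y Y' e := by
        refine ModuleCat.hom_ext (TensorProduct.ext' fun s (u : Y.unop 0 ⟶ 𝟙_ C) => ?_)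
        have nat := ConcreteCategory.congr_hom (φ.naturality ((tailFunctor C a).map e.unop).op) s
        change (G.map (toPushDegen (e.unop 0 ≫ u) (𝟙 _)).op).hom
            ((φ.app _).hom ((E.map ((tailFunctor C a).map e.unop).op).hom s)) =
          (G.map e).hom ((G.map (toPushDegen u (𝟙 _)).op).hom ((φ.app _).hom s))
        refine (congrArg _ nat).trans ?_
        refine (LinSite.map_comp_apply (G := G) (toPushDegen (e.unop 0 ≫ u) (𝟙 _))
          ((push C a.degen).map ((tailFunctor C a).map e.unop)) _).symm.trans ?_
        refine Eq.trans ?_ (LinSite.map_comp_apply (G := G) e.unop (toPushDegen u (𝟙 _)) _)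
        rw [toPushDegen_comp_push, comp_toPushDegen, Category.comp_id, Category.id_comp]
        rfl }
  left_inv ψ := by
    refine NatTrans.ext (funext fun Y => ModuleCat.hom_ext (TensorProduct.ext' fun s
      (u : Y.unop 0 ⟶ 𝟙_ C) => ?_))
    refine (app_degenMk a ψ (toPushDegen u (𝟙 _)) _ _).trans ?_
    rw [← LinSite.map_comp_apply (G := E), toPushDegen_tail, op_id, E.map_id]
    exact congrArg (fun t => (ψ.app Y).hom (degenMk a E Y.unop s t)) (Category.comp_id u)
  right_inv φ := by
    refine NatTrans.ext (funext fun X => ModuleCat.hom_ext (LinearMap.ext fun s => ?_))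
    have nat := ConcreteCategory.congr_hom (φ.naturality (pushDegenTail X.unop).op) s
    change (G.map (toPushDegen (𝟙 (𝟙_ C)) (𝟙 _)).op).hom
      ((φ.app _).hom ((E.map (pushDegenTail X.unop).op).hom s)) = (φ.app X).hom s
    refine (congrArg _ nat).trans ?_
    refine (LinSite.map_comp_apply (G := G) (toPushDegen (𝟙 (𝟙_ C)) (𝟙 _))
      ((push C a.degen).map (pushDegenTail X.unop)) _).symm.trans ?_
    have key : toPushDegen (Y := (push C a.degen).obj X.unop) (𝟙 (𝟙_ C)) (𝟙 _) ≫
        (push C a.degen).map (pushDegenTail X.unop) = 𝟙 _ :=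
      (toPushDegen_comp_push _ _ _ _).trans ((congrArg
        (toPushDegen (Y := (push C a.degen).obj X.unop) (𝟙 (𝟙_ C))) (Category.id_comp _)).trans
          (toPushDegen_pushDegenTail a X.unop))
    refine (congrArg (fun q => (G.map (Quiver.Hom.op q)).hom ((φ.app X).hom s)) key).trans ?_
    rw [op_id, G.map_id]
    rfl

variable [∀ X : C, PreservesFiniteColimits (tensorLeft X)]
  [∀ X : C, PreservesFiniteColimits (tensorRight X)]

variable (k C) in
/-- An explicit form of the direct image under `degen a`: the sheaf associated to
`degenPresheaf`. -/
noncomputable def degenSheaf : Shv k C a.V ⥤ Shv k C a.succ.V where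
  obj E := ⟨sheafify (tupleSite k C a.succ.V).topology ((degenPresheaf k C a).obj E.obj),
    sheafify_isMultiSheaf _ (degenPresheaf_isMultiLinear a E.obj E.property.toIsMultiLinear)⟩
  map f := ObjectProperty.homMk
    (sheafifyMap (tupleSite k C a.succ.V).topology ((degenPresheaf k C a).map f.hom))
  map_id E := by
    ext1
    exact (congrArg (sheafifyMap _) ((degenPresheaf k C a).map_id _)).trans (sheafifyMap_id _ _)
  map_comp f g := by
    ext1
    exact (congrArg (sheafifyMap _) ((degenPresheaf k C a).map_comp _ _)).trans
      (sheafifyMap_comp _ _ _)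

/-- `degenSheaf` is left adjoint to the restriction functor. -/
noncomputable def degenSheafAdj : degenSheaf k C a ⊣ pull k a.degen :=
  Adjunction.mkOfHomEquiv
    { homEquiv E G :=
        { toFun f := ObjectProperty.homMk (degenEquiv a E.obj G.obj G.property.toIsMultiLinear
            (toSheafify _ _ ≫ f.hom))
          invFun g := ObjectProperty.homMk (sheafifyLift _
            ((degenEquiv a E.obj G.obj G.property.toIsMultiLinear).symm g.hom) G.isSheaf)
          left_inv f := by
            ext1
            refine sheafify_hom_ext _ _ _ G.isSheaf ?_
            exact (toSheafify_sheafifyLift _ _ _).trans (Equiv.symm_apply_apply _ _)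
          right_inv g := by
            ext1
            refine (congrArg _ (toSheafify_sheafifyLift _ _ _)).trans (Equiv.apply_symm_apply _ _) }
      homEquiv_naturality_left_symm {E E' G} f g := by
        ext1
        refine sheafify_hom_ext _ _ _ G.isSheaf ?_
        refine (toSheafify_sheafifyLift _ _ _).trans ?_
        refine Eq.trans ?_ ((Category.assoc _ _ _).trans rfl)
        refine Eq.trans ?_ (congrArg (· ≫ _) (toSheafify_naturality _ _))
        refine Eq.trans ?_ (Category.assoc _ _ _).symm
        refine Eq.trans ?_ (congrArg (_ ≫ ·) (toSheafify_sheafifyLift _ _ _).symm)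
        refine NatTrans.ext (funext fun Y => ModuleCat.hom_ext (TensorProduct.ext' fun s
          (u : Y.unop 0 ⟶ 𝟙_ C) => ?_))
        rfl
      homEquiv_naturality_right {E G G'} f g := by
        ext1
        refine NatTrans.ext (funext fun X => ModuleCat.hom_ext (LinearMap.ext fun s => ?_))
        rfl }

instance : (degenSheaf k C a).PreservesMonomorphisms where
  preserves {E E'} m hm := by
    have := (reflectAdj k C a.V).rightAdjoint_preservesLimits
    have h₁ : Mono ((multiSheaf k C a.V).ι.map m) := inferInstance
    have h₂ : Mono ((degenPresheaf k C a).map m.hom) :=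
      inferInstanceAs (Mono ((degenPresheaf k C a).map ((multiSheaf k C a.V).ι.map m)))
    have h₃ : Mono ((presheafToSheaf (tupleSite k C a.succ.V).topology (ModuleCat.{u} k) ⋙
      sheafToPresheaf _ _).map ((degenPresheaf k C a).map m.hom)) := inferInstance
    exact (multiSheaf k C a.succ.V).ι.mono_of_mono_map h₃

/-- The direct image under a degeneracy is exact, unlike a general direct image. -/
instance : (shriek (C := C) k a.degen).PreservesMonomorphisms :=
  Functor.PreservesMonomorphisms.of_iso
    ((degenSheafAdj a).leftAdjointUniq (shriekAdj k a.degen))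

end Degeneracy

/-! ### Functors on the cyclic category which invert degeneracies -/

section CyclicConstant

namespace CyclicCat

/-- The object `[1]` has no non-trivial endomorphism, since its cyclic group of rotations is
trivial. -/
theorem hom_one_eq_id (f : one ⟶ one) : f = 𝟙 one := by
  have h : concat (Hom.fiber f) [(0 : Fin 1)] = [(0 : Fin 1)] :=
    List.isRotated_singleton_iff.1 (Hom.rotated f)
  refine hom_ext fun v => ?_
  obtain rfl : v = (0 : Fin 1) := Subsingleton.elim _ _
  exact (List.append_nil _).symm.trans h

variable {D : Type*} [Category* D] (N : CyclicCat ⥤ D)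

/-- `[n]` receives a composite of `n - 1` degeneracies from `[1]`. -/
theorem exists_isIso_map (hN : ∀ a : CyclicCat, IsIso (N.map a.degen)) (a : CyclicCat) :
    ∃ f : one ⟶ a, IsIso (N.map f) := by
  obtain ⟨n, hn⟩ := a
  induction n, hn using Nat.le_induction with
  | base => exact ⟨𝟙 one, (N.map_id one).symm ▸ inferInstanceAs (IsIso (𝟙 _))⟩
  | succ n hn ih =>
    obtain ⟨f, hf⟩ := ih
    have := hN ⟨n, hn⟩
    exact ⟨f ≫ degen ⟨n, hn⟩, by rw [N.map_comp]; infer_instance⟩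

/-- A functor on the cyclic category which inverts the degeneracies is constant: a morphism to
`[1]` is a retraction of every morphism from `[1]`, since `[1]` has no non-trivial endomorphism. -/
theorem nonempty_iso_const (hN : ∀ a : CyclicCat, IsIso (N.map a.degen)) :
    Nonempty (N ≅ (Functor.const CyclicCat).obj (N.obj one)) := by
  choose f hf using exists_isIso_map N hN
  have h (a : CyclicCat) (g : a ⟶ one) : N.map g = inv (N.map (f a)) := by
    refine IsIso.eq_inv_of_hom_inv_id ?_
    rw [← N.map_comp, hom_one_eq_id (f a ≫ g), N.map_id]
  have (a : CyclicCat) : IsIso (N.map a.toOne) := by rw [h]; infer_instance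
  exact ⟨NatIso.ofComponents (fun a => asIso (N.map a.toOne)) fun {a b} g => by
    change N.map g ≫ N.map b.toOne = N.map a.toOne ≫ 𝟙 _
    rw [← N.map_comp, h, h, Category.comp_id]⟩

end CyclicCat

end CyclicConstant

/-! ### Complexes and transformations of functors -/

section ExactFunctors

variable {A B : Type*} [Category* A] [Category* B] [Abelian A] [Abelian B] {F G : A ⥤ B}
  [F.Additive] [G.Additive] [F.PreservesHomology] [G.PreservesHomology]

/-- Exact functors commute with homology, and so do the transformations between them. -/
theorem quasiIsoAt_mapHomologicalComplex_app_iff (τ : F ⟶ G) (K : CochainComplex A ℤ) (n : ℤ) :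
    QuasiIsoAt ((NatTrans.mapHomologicalComplex τ (.up ℤ)).app K) n ↔
      IsIso (τ.app (K.homology n)) := by
  have h : IsIso (τ.app (K.sc n).homology) ↔
      IsIso (ShortComplex.homologyMap ((K.sc n).mapNatTrans τ)) := by
    rw [NatTrans.app_homology τ (K.sc n), isIso_comp_left_iff, isIso_comp_right_iff]
  exact (quasiIsoAt_iff_isIso_homologyMap _ _).trans h.symm

end ExactFunctors

section DerivedComparison

variable {C D : Type*} [Category* C] [Category* D] {F₁ F₂ G : C ⥤ D} {R : C ⥤ C} (ρ : R ⟶ 𝟭 C)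

/-- Two functors over `G` which invert a resolution `ρ : R ⟶ 𝟭` and map isomorphically to `G` on
the resolved objects are isomorphic over `G`. -/
theorem exists_iso_of_isIso_resolution (γ : F₁ ⟶ G) (δ : F₂ ⟶ G)
    (h₁ : ∀ X, IsIso (F₁.map (ρ.app X)))
    (h₂ : ∀ X, IsIso (F₂.map (ρ.app X))) (hγ : ∀ X, IsIso (γ.app (R.obj X)))
    (hδ : ∀ X, IsIso (δ.app (R.obj X))) : ∃ e : F₁ ≅ F₂, ∀ X, e.hom.app X ≫ δ.app X = γ.app X := by
  have t (X : C) : (inv (F₁.map (ρ.app X)) ≫ γ.app (R.obj X) ≫ inv (δ.app (R.obj X)) ≫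
      F₂.map (ρ.app X)) ≫ δ.app X = γ.app X := by
    have e₁ := γ.naturality (ρ.app X)
    have e₂ := δ.naturality (ρ.app X)
    simp only [Category.assoc, Functor.id_obj] at e₁ e₂ ⊢
    rw [e₂, IsIso.inv_hom_id_assoc, ← e₁, IsIso.inv_hom_id_assoc]
  refine ⟨NatIso.ofComponents (fun X => (asIso (F₁.map (ρ.app X))).symm ≪≫
    asIso (γ.app (R.obj X)) ≪≫ (asIso (δ.app (R.obj X))).symm ≪≫ asIso (F₂.map (ρ.app X)))
    (fun {X Y} f => ?_), t⟩
  have e₁ : F₁.map (R.map f) ≫ F₁.map (ρ.app Y) = F₁.map (ρ.app X) ≫ F₁.map f := by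
    simp only [← Functor.map_comp, ρ.naturality, Functor.id_map]
  have e₂ : F₂.map (R.map f) ≫ F₂.map (ρ.app Y) = F₂.map (ρ.app X) ≫ F₂.map f := by
    simp only [← Functor.map_comp, ρ.naturality, Functor.id_map]
  have e₃ := γ.naturality (R.map f)
  have e₄ := δ.naturality (R.map f)
  simp only [Iso.trans_hom, Iso.symm_hom, asIso_inv, asIso_hom, Category.assoc,
    Functor.id_obj] at e₁ e₂ ⊢
  rw [← cancel_epi (F₁.map (ρ.app X)), ← reassoc_of% e₁, IsIso.hom_inv_id_assoc,
    IsIso.hom_inv_id_assoc, ← e₂, reassoc_of% e₃]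
  congr 1
  rw [← cancel_epi (δ.app (R.obj X)), ← reassoc_of% e₄, IsIso.hom_inv_id_assoc,
    IsIso.hom_inv_id_assoc]

end DerivedComparison

section TransitionComplexes

variable {S A B M D : Type*} [Category* S] [Category* A] [Category* B] [Category* M] [Category* D]
  [Abelian S] [Abelian A] [Abelian B] [Abelian M] [Abelian D] {e₁ : S ⥤ A} {e₂ : S ⥤ B} {s : A ⥤ B}
  {t₁ : A ⥤ M} {t₂ : B ⥤ M} {E₁ E₂ : D ⥤ M} {t : S ⥤ D}
  [e₁.Additive] [e₂.Additive] [s.Additive] [t₁.Additive] [t₂.Additive] [E₁.Additive] [E₂.Additive]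
  [t.Additive]

/-- A levelwise factorisation of a transformation of complexes into an isomorphism and the image
of a transformation of complexes under a functor `t₂` reduces quasi-isomorphy to the latter. -/
theorem quasiIso_mapHomologicalComplex_of_factorisation (i₁ : t ⋙ E₁ ≅ e₁ ⋙ t₁)
    (i₂ : t ⋙ E₂ ≅ e₂ ⋙ t₂) (τ : E₁ ⟶ E₂) (σ : t₁ ≅ s ⋙ t₂) (θ : e₁ ⋙ s ⟶ e₂)
    (w : ∀ X, τ.app (t.obj X) ≫ i₂.hom.app X =
      i₁.hom.app X ≫ σ.hom.app (e₁.obj X) ≫ t₂.map (θ.app X)) (L : CochainComplex S ℤ)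
    (h : QuasiIso ((t₂.mapHomologicalComplex (.up ℤ)).map
      ((NatTrans.mapHomologicalComplex θ (.up ℤ)).app L))) :
    QuasiIso ((NatTrans.mapHomologicalComplex τ (.up ℤ)).app
      ((t.mapHomologicalComplex (.up ℤ)).obj L)) := by
  let j₁ := (NatIso.mapHomologicalComplex (i₁ ≪≫ Functor.isoWhiskerLeft e₁ σ) (.up ℤ)).app L
  let j₂ := (NatIso.mapHomologicalComplex i₂ (.up ℤ)).app L
  refine (quasiIso_iff_of_arrow_mk_iso _ _ (Arrow.isoMk j₁ j₂ ?_)).2 h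
  refine HomologicalComplex.hom_ext _ _ fun i => ?_
  exact (Category.assoc _ _ _).trans (w (L.X i)).symm

end TransitionComplexes

/-! ### The derived trace functors -/

section TraceDerived

variable {k : Type u} [Field k] {C : Type u} [Category.{u} C] [Abelian C] [Linear k C]
  [MonoidalCategory C] [MonoidalPreadditive C] [MonoidalLinear k C]
  [∀ X : C, PreservesFiniteColimits (tensorLeft X)]
  [∀ X : C, PreservesFiniteColimits (tensorRight X)]

instance (a : CyclicCat) : PreservesFiniteLimits (evalSharp k C a) :=
  have := (indSharpAdj k C a).rightAdjoint_preservesLimits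
  inferInstance

instance (a : CyclicCat) : PreservesFiniteColimits (evalSharp k C a) :=
  have := (evalSharpAdj k C a).leftAdjoint_preservesColimits
  inferInstance

theorem injective_moduleCat (V : ModuleCat.{u} k) : Injective V :=
  have := Module.injective_of_isSemisimpleRing k V
  Module.injective_object_of_injective_module k V

theorem IsCocartesian.of_iso {E E' : ShvSharp k C} (e : E ≅ E') (h : IsCocartesian E') :
    IsCocartesian E := fun _ _ f =>
  (NatTrans.isIso_app_iff_of_iso (transitionNat k C f) e).2 (h f)

variable (T : TraceFunctor k C)

/-- The case of the trace functors in `FGood.quasiIso_map`. -/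
theorem FGood.quasiIso_tr {a : CyclicCat} {L L' : CochainComplex (Shv k C a.V) ℤ}
    (h : FGood (tr T a) L) (h' : FGood (tr T a) L') (f : L ⟶ L') (hf : QuasiIso f) :
    QuasiIso (((tr T a).mapHomologicalComplex (.up ℤ)).map f) :=
  h.quasiIso_map (trAdj T a) injective_moduleCat h' f

/-- Quasi-isomorphisms of complexes of functors on `Λ` are detected by the evaluations. -/
theorem quasiIso_trSharp_iff {K L : CochainComplex (ShvSharp k C) ℤ} (f : K ⟶ L) :
    QuasiIso (((trSharp T).mapHomologicalComplex (.up ℤ)).map f) ↔ ∀ a : CyclicCat,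
      QuasiIso (((tr T a).mapHomologicalComplex (.up ℤ)).map
        (((evalSharp k C a).mapHomologicalComplex (.up ℤ)).map f)) :=
  HomologicalComplex.quasiIso_iff_evaluation _

theorem quasiIso_map_of_resolution {A : Type*} [Category* A] [Abelian A]
    {R : CochainComplex A ℤ ⥤ CochainComplex A ℤ} {ρ : R ⟶ 𝟭 _} (hρ : ∀ K, QuasiIso (ρ.app K))
    {K L : CochainComplex A ℤ} (f : K ⟶ L) [QuasiIso f] : QuasiIso (R.map f) := by
  have := hρ K
  have := hρ L
  have h : QuasiIso (R.map f ≫ ρ.app L) := by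
    rw [ρ.naturality]
    exact quasiIso_comp _ f
  exact quasiIso_of_comp_right _ (ρ.app L)

section

variable [∀ a : CyclicCat, HasDerivedCategory.{w} (Shv k C a.V)]
    [HasDerivedCategory.{w} (ModuleCat.{u} k)]

/-- The left derived functor of the trace functor exists and is computed by adapted complexes. -/
theorem HomologicallyClean.tr_hasLeftDerivedFunctor {T : TraceFunctor k C}
    (hT : HomologicallyClean T) (a : CyclicCat) :
    (toDerived (tr T a)).HasLeftDerivedFunctor
        (HomologicalComplex.quasiIso (Shv k C a.V) (ComplexShape.up ℤ)) ∧
      ∀ (LF : DerivedCategory (Shv k C a.V) ⥤ DerivedCategory (ModuleCat.{u} k))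
        (α : DerivedCategory.Q ⋙ LF ⟶ toDerived (tr T a))
        [LF.IsLeftDerivedFunctor α (HomologicalComplex.quasiIso (Shv k C a.V) (ComplexShape.up ℤ))]
        (K : CochainComplex (Shv k C a.V) ℤ), FGood (tr T a) K → IsIso (α.app K) := by
  obtain ⟨R, ρ, hρ, hR⟩ := hT.exists_resolution a
  obtain ⟨h₁, h₂⟩ := toDerived_hasLeftDerivedFunctor (tr T a) ρ hρ
    (fun K L f _ => (hR K).quasiIso_tr T (hR L) _ (quasiIso_map_of_resolution hρ f))
    (fun K => (hR _).quasiIso_tr T (hR K) _ (hρ _))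
  exact ⟨h₁, fun LF α _ K hK => h₂ LF α K ((hR K).quasiIso_tr T hK _ (hρ K))⟩

end

section

variable [HasDerivedCategory.{w} (ShvSharp k C)]
    [HasDerivedCategory.{w} (CyclicCat ⥤ ModuleCat.{u} k)]
  {R : CochainComplex (ShvSharp k C) ℤ ⥤ CochainComplex (ShvSharp k C) ℤ} {ρ : R ⟶ 𝟭 _}

/-- The left derived functor of `tr_#` exists and is computed by any functorial resolution whose
values are adapted to the trace functors. -/
theorem trSharp_hasLeftDerivedFunctor (hρ : ∀ K, QuasiIso (ρ.app K))
    (hR : ∀ K (a : CyclicCat),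
      FGood (tr T a) (((evalSharp k C a).mapHomologicalComplex _).obj (R.obj K))) :
    (toDerived (trSharp T)).HasLeftDerivedFunctor
        (HomologicalComplex.quasiIso (ShvSharp k C) (ComplexShape.up ℤ)) ∧
      ∀ (LF : DerivedCategory (ShvSharp k C) ⥤ DerivedCategory (CyclicCat ⥤ ModuleCat.{u} k))
        (α : DerivedCategory.Q ⋙ LF ⟶ toDerived (trSharp T))
        [LF.IsLeftDerivedFunctor α (HomologicalComplex.quasiIso (ShvSharp k C) (ComplexShape.up ℤ))]
        (K : CochainComplex (ShvSharp k C) ℤ), IsIso (α.app (R.obj K)) := by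
  have h {K L} (f : R.obj K ⟶ R.obj L) (hf : QuasiIso f) :
      QuasiIso (((trSharp T).mapHomologicalComplex (.up ℤ)).map f) := by
    rw [quasiIso_trSharp_iff]
    exact fun a => (hR K a).quasiIso_tr T (hR L a) _ inferInstance
  obtain ⟨h₁, h₂⟩ := toDerived_hasLeftDerivedFunctor (trSharp T) ρ hρ
    (fun K L f _ => h _ (quasiIso_map_of_resolution hρ f)) (fun K => h _ (hρ _))
  exact ⟨h₁, fun LF α _ K => h₂ LF α _ (h _ (hρ _))⟩

end

section

variable {T} {L : CochainComplex (ShvSharp k C) ℤ} (hL : ∀ n, IsCocartesian (L.homology n))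

include hL in
/-- If a complex over `Shv(C_#)` has cocartesian homology, then its transition map along `f` is a
quasi-isomorphism, provided that the direct image under `f` is exact. -/
theorem quasiIso_transitionNat {a b : CyclicCat} (f : a ⟶ b)
    [(shriek (C := C) k f).PreservesMonomorphisms] :
    QuasiIso ((NatTrans.mapHomologicalComplex (transitionNat k C f) (.up ℤ)).app L) := by
  have : PreservesColimitsOfSize.{0, 0} (shriek (C := C) k f) :=
    (shriekAdj k f).leftAdjoint_preservesColimits
  have : (shriek (C := C) k f).PreservesHomology :=
    (shriek (C := C) k f).preservesHomology_of_preservesMonos_and_cokernels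
  have : PreservesFiniteLimits (shriek (C := C) k f) :=
    (shriek (C := C) k f).preservesFiniteLimits_of_preservesHomology
  have : (evalSharp k C a ⋙ shriek k f).PreservesHomology :=
    { preservesKernels _ _ _ := inferInstance
      preservesCokernels _ _ _ := inferInstance }
  exact ⟨fun n => (quasiIsoAt_mapHomologicalComplex_app_iff (transitionNat k C f) L n).2 (hL n f)⟩

variable (h : ∀ a : CyclicCat,
  FGood (tr T a) (((evalSharp k C a).mapHomologicalComplex _).obj L) ∧
    ∀ {b : CyclicCat} (f : a ⟶ b), FGood (tr T b) (((shriek k f).mapHomologicalComplex _).obj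
      (((evalSharp k C a).mapHomologicalComplex _).obj L))) (n : ℤ)

include hL h in
/-- Let `L` be a complex with cocartesian homology and adapted values and direct images. Then the
homology of `tr_# L` inverts the morphisms `f` with exact direct image. -/
theorem isIso_homology_trSharp_map {a b : CyclicCat} (f : a ⟶ b)
    [(shriek (C := C) k f).PreservesMonomorphisms] :
    IsIso (((((trSharp T).mapHomologicalComplex (.up ℤ)).obj L).homology n).map f) := by
  have h₁ := ((h a).2 f).quasiIso_tr T (h b).1 _ (quasiIso_transitionNat hL f)
  have h₂ := quasiIso_mapHomologicalComplex_of_factorisation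
    (t := trSharp T) (E₁ := (evaluation CyclicCat (ModuleCat.{u} k)).obj a)
    (E₂ := (evaluation CyclicCat (ModuleCat.{u} k)).obj b) (Iso.refl (evalSharp k C a ⋙ tr T a))
    (Iso.refl (evalSharp k C b ⋙ tr T b))
    ((evaluation CyclicCat (ModuleCat.{u} k)).map f) (trShriekIso T f) (transitionNat k C f)
    (fun E => (Category.comp_id (trSharpMap T E f)).trans ((trSharpMap_eq T f E).trans
      (Category.id_comp _).symm)) L h₁
  exact (quasiIsoAt_mapHomologicalComplex_app_iff
    ((evaluation CyclicCat (ModuleCat.{u} k)).map f) _ n).1 inferInstance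

include hL h in
theorem homology_trSharp_iso_const : ∃ M : ModuleCat.{u} k,
    Nonempty ((((trSharp T).mapHomologicalComplex (.up ℤ)).obj L).homology n ≅
      (Functor.const CyclicCat).obj M) :=
  ⟨_, CyclicCat.nonempty_iso_const _ fun a => isIso_homology_trSharp_map hL h n a.degen⟩

end

end TraceDerived

/-! ### The comparison isomorphism -/

section Main

variable {k : Type u} [Field k] {C : Type u} [Category.{u} C] [Abelian C] [Linear k C]
    [MonoidalCategory C] [MonoidalPreadditive C] [MonoidalLinear k C]
    [∀ X : C, PreservesFiniteColimits (tensorLeft X)]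
    [∀ X : C, PreservesFiniteColimits (tensorRight X)]
    [HasDerivedCategory.{w} (ShvSharp k C)]
    [HasDerivedCategory.{w} (CyclicCat ⥤ ModuleCat.{u} k)]
    [HasDerivedCategory.{w} (ModuleCat.{u} k)]
    (T : TraceFunctor k C)

/-- The canonical map from the value at `[n]` of a left derived functor of `tr_#` to
`tr(M_#([n]))`. -/
noncomputable def derivedTrSharpEval
    {LtrSharp : DerivedCategory (ShvSharp k C) ⥤ DerivedCategory (CyclicCat ⥤ ModuleCat.{u} k)}
    (α : DerivedCategory.Q ⋙ LtrSharp ⟶ toDerived (trSharp T)) (a : CyclicCat) :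
    DerivedCategory.Q ⋙ LtrSharp ⋙
        ((evaluation CyclicCat (ModuleCat.{u} k)).obj a).mapDerivedCategory ⟶
      (evalSharp k C a).mapHomologicalComplex (ComplexShape.up ℤ) ⋙ toDerived (tr T a) :=
  Functor.whiskerRight α ((evaluation CyclicCat (ModuleCat.{u} k)).obj a).mapDerivedCategory ≫
    Functor.whiskerLeft ((trSharp T).mapHomologicalComplex (ComplexShape.up ℤ))
      ((evaluation CyclicCat (ModuleCat.{u} k)).obj a).mapDerivedCategoryFactors.hom

end Main

theorem mainTheorem4 {k : Type u} [Field k] {C : Type u} [Category.{u} C] [Abelian C] [Linear k C]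
    [MonoidalCategory C] [MonoidalPreadditive C] [MonoidalLinear k C]
    [∀ X : C, PreservesFiniteColimits (tensorLeft X)]
    [∀ X : C, PreservesFiniteColimits (tensorRight X)]
    [HasDerivedCategory.{w} (ShvSharp k C)]
    [∀ a : CyclicCat, HasDerivedCategory.{w} (Shv k C a.V)]
    [HasDerivedCategory.{w} (CyclicCat ⥤ ModuleCat.{u} k)]
    [HasDerivedCategory.{w} (ModuleCat.{u} k)]
    (T : TraceFunctor k C) (hT : HomologicallyClean T) :
    (toDerived (trSharp T)).HasLeftDerivedFunctor
        (HomologicalComplex.quasiIso (ShvSharp k C) (ComplexShape.up ℤ)) ∧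
      (∀ a : CyclicCat, (toDerived (tr T a)).HasLeftDerivedFunctor
        (HomologicalComplex.quasiIso (Shv k C a.V) (ComplexShape.up ℤ))) ∧
      ∀ (LtrSharp : DerivedCategory (ShvSharp k C) ⥤ DerivedCategory (CyclicCat ⥤ ModuleCat.{u} k))
        (α : DerivedCategory.Q ⋙ LtrSharp ⟶ toDerived (trSharp T))
        [LtrSharp.IsLeftDerivedFunctor α
          (HomologicalComplex.quasiIso (ShvSharp k C) (ComplexShape.up ℤ))]
        (Ltr : ∀ a : CyclicCat, DerivedCategory (Shv k C a.V) ⥤ DerivedCategory (ModuleCat.{u} k))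
        (β : ∀ a : CyclicCat, DerivedCategory.Q ⋙ Ltr a ⟶ toDerived (tr T a))
        [∀ a : CyclicCat, (Ltr a).IsLeftDerivedFunctor (β a)
          (HomologicalComplex.quasiIso (Shv k C a.V) (ComplexShape.up ℤ))],
        (∀ a : CyclicCat, Nonempty
          (DerivedCategory.singleFunctor (ShvSharp k C) 0 ⋙ LtrSharp ⋙
              ((evaluation CyclicCat (ModuleCat.{u} k)).obj a).mapDerivedCategory ≅
            evalSharp k C a ⋙ DerivedCategory.singleFunctor (Shv k C a.V) 0 ⋙ Ltr a)) ∧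
        (∀ a : CyclicCat, ∃ e : DerivedCategory.Q ⋙ LtrSharp ⋙
              ((evaluation CyclicCat (ModuleCat.{u} k)).obj a).mapDerivedCategory ≅
            (evalSharp k C a).mapHomologicalComplex (ComplexShape.up ℤ) ⋙
              DerivedCategory.Q ⋙ Ltr a,
          ∀ K, e.hom.app K ≫
              (β a).app (((evalSharp k C a).mapHomologicalComplex (ComplexShape.up ℤ)).obj K) =
            ((evaluation CyclicCat (ModuleCat.{u} k)).obj a).mapDerivedCategory.map (α.app K) ≫
              ((evaluation CyclicCat (ModuleCat.{u} k)).obj a).mapDerivedCategoryFactors.hom.app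
                (((trSharp T).mapHomologicalComplex (ComplexShape.up ℤ)).obj K)) ∧
        ∀ K, DLambda K → DConst k (LtrSharp.obj K) := by
  obtain ⟨R, ρ, hρ, hR⟩ := hT.exists_sharp_resolution
  obtain ⟨h₁, h₁'⟩ := trSharp_hasLeftDerivedFunctor T hρ fun K a => (hR K a).1
  refine ⟨h₁, fun a => (hT.tr_hasLeftDerivedFunctor a).1, fun LtrSharp α _ Ltr β _ => ?_⟩
  have hα (K) : IsIso (α.app (R.obj K)) := h₁' LtrSharp α K
  -- both sides are computed by the resolution `R`: its values are adapted to the trace functors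
  have comparison (a : CyclicCat) : ∃ e : DerivedCategory.Q ⋙ LtrSharp ⋙
              ((evaluation CyclicCat (ModuleCat.{u} k)).obj a).mapDerivedCategory ≅
            (evalSharp k C a).mapHomologicalComplex (ComplexShape.up ℤ) ⋙
              DerivedCategory.Q ⋙ Ltr a,
          ∀ K, e.hom.app K ≫
              (β a).app (((evalSharp k C a).mapHomologicalComplex (ComplexShape.up ℤ)).obj K) =
            ((evaluation CyclicCat (ModuleCat.{u} k)).obj a).mapDerivedCategory.map (α.app K) ≫
              ((evaluation CyclicCat (ModuleCat.{u} k)).obj a).mapDerivedCategoryFactors.hom.app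
                (((trSharp T).mapHomologicalComplex (ComplexShape.up ℤ)).obj K) := by
    have hQ (K) : IsIso (DerivedCategory.Q.map (ρ.app K)) :=
      (DerivedCategory.isIso_Q_map_iff_quasiIso _ _).2 (hρ K)
    have hQ' (K) : IsIso (DerivedCategory.Q.map
        (((evalSharp k C a).mapHomologicalComplex (ComplexShape.up ℤ)).map (ρ.app K))) :=
      (DerivedCategory.isIso_Q_map_iff_quasiIso _ _).2 (have := hρ K; inferInstance)
    refine exists_iso_of_isIso_resolution ρ (derivedTrSharpEval T α a)
      (Functor.whiskerLeft _ (β a)) (fun K => ?_) (fun K => ?_) (fun K => ?_) (fun K => ?_)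
    · exact inferInstanceAs (IsIso ((LtrSharp ⋙ _).map (DerivedCategory.Q.map (ρ.app K))))
    · exact inferInstanceAs (IsIso ((Ltr a).map (DerivedCategory.Q.map
        (((evalSharp k C a).mapHomologicalComplex (ComplexShape.up ℤ)).map (ρ.app K)))))
    · exact inferInstanceAs (IsIso (
        ((evaluation CyclicCat (ModuleCat.{u} k)).obj a).mapDerivedCategory.map
            (α.app (R.obj K)) ≫
          ((evaluation CyclicCat (ModuleCat.{u} k)).obj a).mapDerivedCategoryFactors.hom.app
            (((trSharp T).mapHomologicalComplex (ComplexShape.up ℤ)).obj (R.obj K))))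
    · exact (hT.tr_hasLeftDerivedFunctor a).2 (Ltr a) (β a) _ (hR K a).1
  refine ⟨fun a => ?_, comparison, fun K hK n => ?_⟩
  · obtain ⟨e, -⟩ := comparison a
    exact ⟨Functor.isoWhiskerRight (DerivedCategory.singleFunctorIsoCompQ (ShvSharp k C) 0)
        (LtrSharp ⋙ ((evaluation CyclicCat (ModuleCat.{u} k)).obj a).mapDerivedCategory) ≪≫
      Functor.isoWhiskerLeft (HomologicalComplex.single (ShvSharp k C) (ComplexShape.up ℤ) 0) e ≪≫
      Functor.isoWhiskerRight (HomologicalComplex.singleMapHomologicalComplex (evalSharp k C a)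
        (ComplexShape.up ℤ) 0) (DerivedCategory.Q ⋙ Ltr a) ≪≫
      Functor.isoWhiskerLeft (evalSharp k C a) (Functor.isoWhiskerRight
        (DerivedCategory.singleFunctorIsoCompQ (Shv k C a.V) 0).symm (Ltr a))⟩
  · -- only the cocartesian property of the homology is needed
    let K' := DerivedCategory.Q.objPreimage K
    have i : DerivedCategory.Q.obj (R.obj K') ≅ K :=
      have : IsIso (DerivedCategory.Q.map (ρ.app K')) :=
        (DerivedCategory.isIso_Q_map_iff_quasiIso _ _).2 (hρ K')
      asIso (DerivedCategory.Q.map (ρ.app K')) ≪≫ DerivedCategory.Q.objObjPreimageIso K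
    have hL (m : ℤ) : IsCocartesian ((R.obj K').homology m) :=
      IsCocartesian.of_iso ((DerivedCategory.homologyFunctorFactors _ m).symm.app _ ≪≫
        (DerivedCategory.homologyFunctor _ m).mapIso i) (hK m).1
    obtain ⟨M, ⟨j⟩⟩ := homology_trSharp_iso_const hL (hR K') n
    exact ⟨M, ⟨(DerivedCategory.homologyFunctor _ n).mapIso
      (LtrSharp.mapIso i.symm ≪≫ asIso (α.app (R.obj K'))) ≪≫
      (DerivedCategory.homologyFunctorFactors _ n).app _ ≪≫ j⟩⟩
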